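/- Let $d\in\mathbb N$ and $0<\gamma<1$. For $S\subseteq\mathbb R^d$ put $\|f\|_{C^{1,\gamma}(S)}=\|f\|_{L^\infty(S)}+[f]_{C^\gamma(S)}+\|\nabla f\|_{L^\infty(S)}+[\nabla f]_{C^\gamma(S)}$, and for $\delta,m>0$ let $\mathcal K(\gamma,\delta,m)=\{f\in C^{1,\gamma}(\mathbb R^d): f\ge\delta,\ \|f\|_{C^{1,\gamma}(\mathbb R^d)}\le m\}$ and $\mathcal K=\bigcup_{\delta>0}\bigcup_{m>\delta}\mathcal K(\gamma,\delta,m)$. Let $J:\mathcal K\to C^0(\mathbb R^d)$, $f\mapsto J(f)=J(f,\cdot)$, be an operator such that: (a) for all $0<\delta<m$, $J$ is Lipschitz on $\mathcal K(\gamma,\delta,m)$ from the $C^{1,\gamma}(\mathbb R^d)$ norm to the sup norm, with a constant $C(\delta,m)$ that increases as $\delta$ decreases or $m$ increases; (b) (global comparison property) if $u,v\in\mathcal K$, $u\le v$ on $\mathbb R^d$ and $u(x_0)=v(x_0)$, then $J(u,x_0)\le J(v,x_0)$; (c) $J$ is translation invariant: $J(f(\cdot+h),x)=J(f,x+h)$;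 (d) $J(f+c,x)\le J(f,x)$ for all $f\in\mathcal K$, all constants $c>0$ and all $x$; (e) for all $0<\delta<m$ there are $C\ge0$ and $\omega\ge0$ with $\omega(R)\to0$ as $R\to\infty$ such that, for all $f,g\in\mathcal K(\gamma,\delta,m)$ and $R>1$, $$\|J(f)-J(g)\|_{L^\infty(B_R)}\le C\big(\|f-g\|_{C^{1,\gamma}(B_{2R})}+\omega(R)\|f-g\|_{L^\infty(\mathbb R^d)}+\omega(R)\big).$$ Let $T>0$, $\delta>0$, and let $f_0:\mathbb R^d\to\mathbb R$ be bounded and uniformly continuous with $f_0\ge\delta$. Consider the Cauchy problem $$\partial_t f=J(f)\ \text{ in }\mathbb R^d\times(0,T],\qquad f(\cdot,0)=f_0. \tag{1}$$ A test function on $\mathbb R^d\times(t-r,t]$ is a function $\varphi$ which for some $\beta>0$ with $\gamma+\beta<1$ is in $C^{1,\gamma+\beta}(\mathbb R^d)$ in space, uniformly in time, and which is differentiable in time with $\partial_t\varphi$ continuous on $\mathbb R^d\times(t-r,t]$ (at the final time $t$ the derivative is the left one). A function $f:\mathbb R^d\times[0,T]\to\mathbb R$ is a viscosity subsolution of $\partial_t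 f=J(f)$ if it is upper semicontinuous, $\inf f>0$, and, whenever $(x,t)\in\mathbb R^d\times(0,T]$, $0<r<t$ and $\varphi$ is a test function on $\mathbb R^d\times(t-r,t]$ with $f\le\varphi$ there and $f(x,t)=\varphi(x,t)$, then $\partial_t\varphi(x,t)\le J(\varphi(\cdot,t),x)$. It is a viscosity supersolution if it is lower semicontinuous, $\inf f>0$, and, whenever instead $f\ge\varphi$, $f(x,t)=\varphi(x,t)$ and $\inf\varphi>0$, then $\partial_t\varphi(x,t)\ge J(\varphi(\cdot,t),x)$. A bounded viscosity solution of (1) is a bounded function on $\mathbb R^d\times[0,T]$ which is both a subsolution and a supersolution and satisfies $f(\cdot,0)=f_0$. Then: 1. (Uniqueness) Problem (1) has at most one bounded viscosity solution. 2. (Existence) Problem (1) has a bounded viscosity solution, provided that the spatially constant flow started at $\delta$ stays positive up to time $T$, i.e. there is a differentiable $c:[0,T]\to(0,\infty)$ with $c(0)\le\delta$ and $c'(t)\le J(c(t))$ for all $t\in[0,T]$, where $J(c(t))$ denotes the (constant) value of $J$ on the constant function $c(t)$. (The proviso in 2 holds whenever $J(c)\ge0$ for some constant $c\in(0,\delta]$,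 and always for small $T$. It cannot be dropped: for $J\equiv-1$, $f_0\equiv\delta$ and $T\ge\delta$, problem (1) has no viscosity solution.) -/

import Mathlib

open scoped NNReal ENNReal Topology

noncomputable section

namespace FractionalParabolic

/-- The Euclidean space `ℝ^d`. -/
abbrev Space (d : ℕ) : Type := EuclideanSpace ℝ (Fin d)

/-- The sup norm of `f` on `S`, with values in `[0, ∞]`. -/
def supNormOn {d : ℕ} {F : Type} [NormedAddCommGroup F] (S : Set (Space d)) (f : Space d → F) :
    ℝ≥0∞ :=
  ⨆ x ∈ S, ‖f x‖ₑ

/-- For a differentiable `f`, the `C^{1,γ}(S)` norm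
`‖f‖_{L^∞(S)} + [f]_{C^γ(S)} + ‖∇f‖_{L^∞(S)} + [∇f]_{C^γ(S)}`, with values in `[0, ∞]`. -/
def c1Norm {d : ℕ} (γ : ℝ≥0) (S : Set (Space d)) (f : Space d → ℝ) : ℝ≥0∞ :=
  supNormOn S f + eHolderNorm γ (S.domRestrict f)
    + supNormOn S (fderiv ℝ f) + eHolderNorm γ (S.domRestrict (fderiv ℝ f))

/-- `f ∈ C^{1,γ}(ℝ^d)` with norm at most `m`. -/
def C1Bound {d : ℕ} (γ : ℝ≥0) (m : ℝ) (f : Space d → ℝ) : Prop :=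
  Differentiable ℝ f ∧ c1Norm γ Set.univ f ≤ ENNReal.ofReal m

/-- The set `𝒦(γ, δ, m)` of the `f ∈ C^{1,γ}(ℝ^d)` with `f ≥ δ` and norm at most `m`. -/
def classK (d : ℕ) (γ : ℝ≥0) (δ m : ℝ) : Set (Space d → ℝ) :=
  {f | (∀ x, δ ≤ f x) ∧ C1Bound γ m f}

/-- The union of the sets `𝒦(γ, δ, m)` over all `δ > 0` and `m > δ`: the domain of the
operators. -/
def domainK (d : ℕ) (γ : ℝ≥0) : Set (Space d → ℝ) :=
  {f | ∃ δ m : ℝ, 0 < δ ∧ δ < m ∧ f ∈ classK d γ δ m}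

/-- The assumptions on the operator `J`. The operator is a total function here, but only its
values on `domainK d γ` are ever constrained or used. -/
structure AdmissibleOperator {d : ℕ} (γ : ℝ≥0) (J : (Space d → ℝ) → Space d → ℝ) : Prop where
  exponent_pos : 0 < γ
  exponent_lt_one : γ < 1
  /-- `J` maps its domain to continuous functions. -/
  continuous_apply : ∀ f ∈ domainK d γ, Continuous (J f)
  /-- `J` is Lipschitz on each `𝒦(γ, δ, m)`, as a map from `C^{1,γ}` to `C^0`; the constant
  `C δ m` increases as `δ` decreases and as `m` increases. -/
  lipschitz : ∃ C : ℝ → ℝ → ℝ≥0,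
    (∀ δ₁ δ₂ m₁ m₂ : ℝ, 0 < δ₁ → δ₁ ≤ δ₂ → δ₂ < m₂ → m₂ ≤ m₁ → C δ₂ m₂ ≤ C δ₁ m₁) ∧
    ∀ δ m : ℝ, 0 < δ → δ < m → ∀ f ∈ classK d γ δ m, ∀ g ∈ classK d γ δ m,
      supNormOn Set.univ (fun x => J f x - J g x)
        ≤ C δ m * c1Norm γ Set.univ (fun x => f x - g x)
  /-- The global comparison property. -/
  gcp : ∀ u ∈ domainK d γ, ∀ v ∈ domainK d γ, (∀ x, u x ≤ v x) →
    ∀ x₀, u x₀ = v x₀ → J u x₀ ≤ J v x₀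
  /-- Translation invariance. -/
  translation : ∀ f ∈ domainK d γ, ∀ h x, J (fun y => f (y + h)) x = J f (x + h)
  /-- Adding a positive constant to the argument does not increase `J`. -/
  add_const : ∀ f ∈ domainK d γ, ∀ c : ℝ, 0 < c → ∀ x, J (fun y => f y + c) x ≤ J f x
  /-- The operator splitting property. -/
  splitting : ∀ δ m : ℝ, 0 < δ → δ < m → ∃ (C : ℝ≥0) (ω : ℝ → ℝ≥0),
    Filter.Tendsto ω Filter.atTop (𝓝 0) ∧
    ∀ f ∈ classK d γ δ m, ∀ g ∈ classK d γ δ m, ∀ R : ℝ, 1 < R →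
      supNormOn (Metric.ball 0 R) (fun x => J f x - J g x)
        ≤ C * (c1Norm γ (Metric.ball 0 (2 * R)) (fun x => f x - g x)
          + ω R * supNormOn Set.univ (fun x => f x - g x) + ω R)

/-- `φ` is an admissible test function on `ℝ^d × (t - r, t]` with time derivative `φt`: for some
`β > 0` with `γ + β < 1` it is `C^{1,γ+β}(ℝ^d)` in space, with a bound uniform in time, and it is
`C^1` in time (at the final time `t`, the derivative is the one from the left). -/
def IsTestFunction {d : ℕ} (γ : ℝ≥0) (t r : ℝ) (φ φt : Space d → ℝ → ℝ) : Prop :=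
  (∃ β : ℝ≥0, 0 < β ∧ γ + β < 1 ∧
    ∃ m : ℝ, ∀ s ∈ Set.Ioc (t - r) t, C1Bound (γ + β) m (fun y => φ y s)) ∧
  (∀ y, ∀ s ∈ Set.Ioc (t - r) t,
    HasDerivWithinAt (φ y) (φt y s) (Set.Ioc (t - r) t) s) ∧
  ContinuousOn (fun p : Space d × ℝ => φt p.1 p.2) (Set.univ ×ˢ Set.Ioc (t - r) t)

/-- Viscosity subsolutions of `∂ₜ f = J(f)` in `ℝ^d × (0, T]`. A test function `φ` touches `f` from
above at `(x, t)` over `ℝ^d × (t - r, t]`; then `φ ≥ f` has a positive infimum there. -/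
structure IsViscositySubsolution {d : ℕ} (γ : ℝ≥0) (J : (Space d → ℝ) → Space d → ℝ) (T : ℝ)
    (f : Space d → ℝ → ℝ) : Prop where
  usc : UpperSemicontinuousOn (fun p : Space d × ℝ => f p.1 p.2) (Set.univ ×ˢ Set.Icc 0 T)
  inf_pos : ∃ η : ℝ, 0 < η ∧ ∀ x, ∀ t ∈ Set.Icc 0 T, η ≤ f x t
  test : ∀ x, ∀ t ∈ Set.Ioc 0 T, ∀ r : ℝ, 0 < r → r < t → ∀ φ φt : Space d → ℝ → ℝ,
    IsTestFunction γ t r φ φt →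
    (∀ y, ∀ s ∈ Set.Ioc (t - r) t, f y s ≤ φ y s) → f x t = φ x t →
    φt x t ≤ J (fun y => φ y t) x

/-- Viscosity supersolutions of `∂ₜ f = J(f)` in `ℝ^d × (0, T]`: only test functions with a positive
infimum are used. -/
structure IsViscositySupersolution {d : ℕ} (γ : ℝ≥0) (J : (Space d → ℝ) → Space d → ℝ) (T : ℝ)
    (f : Space d → ℝ → ℝ) : Prop where
  lsc : LowerSemicontinuousOn (fun p : Space d × ℝ => f p.1 p.2) (Set.univ ×ˢ Set.Icc 0 T)
  inf_pos : ∃ η : ℝ, 0 < η ∧ ∀ x, ∀ t ∈ Set.Icc 0 T, η ≤ f x t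
  test : ∀ x, ∀ t ∈ Set.Ioc 0 T, ∀ r : ℝ, 0 < r → r < t → ∀ φ φt : Space d → ℝ → ℝ,
    IsTestFunction γ t r φ φt →
    (∃ η : ℝ, 0 < η ∧ ∀ y, ∀ s ∈ Set.Ioc (t - r) t, η ≤ φ y s) →
    (∀ y, ∀ s ∈ Set.Ioc (t - r) t, φ y s ≤ f y s) → f x t = φ x t →
    J (fun y => φ y t) x ≤ φt x t

/-- Bounded viscosity solutions on `ℝ^d × [0, T]` of the Cauchy problem `∂ₜ f = J(f)`,
`f(·, 0) = f₀`. -/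
structure IsCauchySolution {d : ℕ} (γ : ℝ≥0) (J : (Space d → ℝ) → Space d → ℝ) (T : ℝ)
    (f₀ : Space d → ℝ) (f : Space d → ℝ → ℝ) : Prop where
  sub : IsViscositySubsolution γ J T f
  super : IsViscositySupersolution γ J T f
  initial : ∀ x, f x 0 = f₀ x
  bounded : ∃ M : ℝ, ∀ x, ∀ t ∈ Set.Icc 0 T, f x t ≤ M

/-- There is a differentiable `c : [0, T] → (0, ∞)` with `c(0) ≤ δ` and `c' ≤ J(c)`, where `J(c)` is
the value of `J` on the constant function `c`. This says that the spatially constant flow started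
at `δ` stays positive, hence in the domain of `J`, up to the time `T`. -/
def ConstantFlowStaysPositive {d : ℕ} (J : (Space d → ℝ) → Space d → ℝ) (T δ : ℝ) : Prop :=
  ∃ c c' : ℝ → ℝ, c 0 ≤ δ ∧ ∀ t ∈ Set.Icc 0 T, 0 < c t ∧
    HasDerivWithinAt c (c' t) (Set.Icc 0 T) t ∧ c' t ≤ J (fun _ => c t) 0

end FractionalParabolic

end

/-! Uniqueness is a comparison principle. Suppose a subsolution u exceeds a supersolution v
somewhere, and maximize u(y,s) - l s - v(z,τ) - k(|y-z|² + (s-τ)²). No theorem on sums and no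
integral representation of J is needed: a single C^{1,1} function tests both equations. The
sup-convolution of u with parameter k is semiconvex, so its inf-convolution with parameter 2k is
C^{1,1} (`exists_insertion`). Translated by half the vector joining the two maximum points, it
touches u from above and, shifted by a constant, translated the opposite way, it touches v from
below. Both contacts sit over the midpoint, with the same time derivative (`exists_common_test`). By
translation invariance the two values of J are taken at the same function, up to a constant, and at
the same point; adding constants lowers J, so the two inequalities contradict each other by the
slope l.

Three difficulties remain. On the unbounded space the maximum need not be attained, so a bump that
is small in C^{1,γ} is added; J changes little by its Lipschitz bound (`exists_perturbed_max`). The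
function used for v must stay positive, which requires a penalty at the maximum small relative to
inf v; this holds at a suitable dyadic k, since the suprema converge (`exists_consecutive_close`).
Finally the maximum must avoid the initial time, which follows from barriers giving a uniform
modulus at t = 0 (`sub_initial_modulus`, `super_initial_modulus`).

Existence is Perron's method. The supremum of all bounded subsolutions below f₀ at time 0 is finite
by comparison with M + |J(M)| t. Its upper envelope U is a subsolution, and the lower envelope V of
U is a supersolution, for otherwise a local bump would enlarge U. Maxima are localized despite the
nonlocality of J because test functions can be made constant far away at little cost: this is the
splitting property (`exists_cutoff_profile`). The constant flow supplies subsolutions that attain f₀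
from below while staying positive (`exists_subsolution_barrier`), so V ≥ f₀ at time 0. Comparison
then gives U ≤ V, hence U = V. -/

noncomputable section

namespace FractionalParabolic

/-! ### `C^{1,α}` bounds with real constants, cutoffs and penalties. -/

section

variable {d : ℕ}

/-- A real-valued form of the `C^{1,α}` bounds. -/
structure C1H (α : ℝ≥0) (A : ℝ) (f : Space d → ℝ) : Prop where
  diff : Differentiable ℝ f
  bdd : ∀ x, |f x| ≤ A
  grad : ∀ x, ‖fderiv ℝ f x‖ ≤ A
  holder : ∀ x y, ‖fderiv ℝ f x - fderiv ℝ f y‖ ≤ A * dist x y ^ (α : ℝ)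

namespace C1H

variable {α α' : ℝ≥0} {A B : ℝ} {f g : Space d → ℝ}

theorem nonneg (h : C1H α A f) : 0 ≤ A := (abs_nonneg _).trans (h.bdd 0)

theorem mono (h : C1H α A f) (hAB : A ≤ B) : C1H α B f :=
  ⟨h.diff, fun x => (h.bdd x).trans hAB, fun x => (h.grad x).trans hAB, fun x y =>
    (h.holder x y).trans (mul_le_mul_of_nonneg_right hAB (by positivity))⟩

theorem lipschitz (h : C1H α A f) (x y : Space d) : |f x - f y| ≤ A * dist x y := by
  have := (convex_univ (𝕜 := ℝ) (E := Space d)).norm_image_sub_le_of_norm_fderiv_le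
    (f := f) (C := A) (fun x _ => h.diff x) (fun x _ => h.grad x)
    (Set.mem_univ y) (Set.mem_univ x)
  rwa [Real.norm_eq_abs, ← dist_eq_norm] at this

/-- For t ≤ 1 a smaller exponent gives a larger power; for t > 1 the trivial bound 2A already
suffices. This interpolation lowers Hölder exponents and turns Lipschitz bounds into Hölder bounds.
-/
theorem _root_.FractionalParabolic.le_two_mul_rpow {A t D a a' : ℝ} (hA : 0 ≤ A) (ht : 0 ≤ t)
    (ha : 0 ≤ a') (haa : a' ≤ a) (h1 : D ≤ 2 * A) (h2 : D ≤ A * t ^ a) :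
    D ≤ 2 * A * t ^ a' := by
  rcases le_or_gt t 1 with h | h
  · have h3 : t ^ a ≤ t ^ a' := by
      rcases ht.eq_or_lt with h0 | h0
      · subst h0
        rcases ha.eq_or_lt with h4 | h4
        · rw [← h4, Real.rpow_zero]
          rcases (ha.trans haa).eq_or_lt with h5 | h5
          · rw [← h5, Real.rpow_zero]
          · rw [Real.zero_rpow h5.ne']; norm_num
        · rw [Real.zero_rpow h4.ne', Real.zero_rpow (h4.trans_le haa).ne']
      · exact Real.rpow_le_rpow_of_exponent_ge h0 h haa
    have h4 : 0 ≤ t ^ a' := by positivity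
    nlinarith [mul_le_mul_of_nonneg_left h3 hA]
  · have h3 : 1 ≤ t ^ a' := Real.one_le_rpow h.le ha
    nlinarith

theorem exp_mono (h : C1H α A f) (hα : α' ≤ α) : C1H α' (2 * A) f where
  diff := h.diff
  bdd x := (h.bdd x).trans (by linarith [h.nonneg])
  grad x := (h.grad x).trans (by linarith [h.nonneg])
  holder x y := by
    refine le_two_mul_rpow h.nonneg dist_nonneg α'.2 hα ?_ (h.holder x y)
    linarith [norm_sub_le (fderiv ℝ f x) (fderiv ℝ f y), h.grad x, h.grad y]

theorem const (c : ℝ) : C1H α |c| (fun _ : Space d => c) where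
  diff := differentiable_const c
  bdd _ := le_rfl
  grad x := by simp
  holder x y := by simp; positivity

theorem add (hf : C1H α A f) (hg : C1H α B g) : C1H α (A + B) (fun x => f x + g x) := by
  have e : ∀ x, fderiv ℝ (fun x => f x + g x) x = fderiv ℝ f x + fderiv ℝ g x := fun x =>
    fderiv_fun_add (hf.diff x) (hg.diff x)
  refine ⟨hf.diff.add hg.diff, fun x => ?_, fun x => ?_, fun x y => ?_⟩
  · exact (abs_add_le _ _).trans (add_le_add (hf.bdd x) (hg.bdd x))
  · rw [e]; exact (norm_add_le _ _).trans (add_le_add (hf.grad x) (hg.grad x))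
  · rw [e, e, add_sub_add_comm, add_mul]
    exact (norm_add_le _ _).trans (add_le_add (hf.holder x y) (hg.holder x y))

theorem add_const (hf : C1H α A f) (c : ℝ) : C1H α (A + |c|) (fun x => f x + c) :=
  hf.add (const c)

theorem const_mul (hf : C1H α A f) (c : ℝ) : C1H α (|c| * A) (fun x => c * f x) := by
  have e : ∀ x, fderiv ℝ (fun x => c * f x) x = c • fderiv ℝ f x := fun x =>
    fderiv_const_mul (hf.diff x) c
  refine ⟨hf.diff.const_mul c, fun x => ?_, fun x => ?_, fun x y => ?_⟩
  · rw [abs_mul]; exact mul_le_mul_of_nonneg_left (hf.bdd x) (abs_nonneg c)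
  · rw [e, norm_smul, Real.norm_eq_abs]
    exact mul_le_mul_of_nonneg_left (hf.grad x) (abs_nonneg c)
  · rw [e, e, ← smul_sub, norm_smul, Real.norm_eq_abs, mul_assoc]
    exact mul_le_mul_of_nonneg_left (hf.holder x y) (abs_nonneg c)

theorem neg (hf : C1H α A f) : C1H α A (fun x => -f x) := by
  simpa using hf.const_mul (-1)

theorem sub (hf : C1H α A f) (hg : C1H α B g) : C1H α (A + B) (fun x => f x - g x) := by
  simpa [sub_eq_add_neg] using hf.add hg.neg

theorem mul (hα : α ≤ 1) (hf : C1H α A f) (hg : C1H α B g) :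
    C1H α (6 * A * B) (fun x => f x * g x) := by
  have hA := hf.nonneg
  have hB := hg.nonneg
  have hAB := mul_nonneg hA hB
  have e : ∀ x, fderiv ℝ (fun x => f x * g x) x = f x • fderiv ℝ g x + g x • fderiv ℝ f x :=
    fun x => fderiv_fun_mul (hf.diff x) (hg.diff x)
  have lip : ∀ {F : Space d → ℝ} {C : ℝ}, C1H α C F → ∀ x y,
      |F x - F y| ≤ 2 * C * dist x y ^ (α : ℝ) := fun {F C} hF x y => by
    refine le_two_mul_rpow (a := 1) hF.nonneg dist_nonneg α.2 (by exact_mod_cast hα) ?_ ?_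
    · linarith [abs_sub (F x) (F y), hF.bdd x, hF.bdd y]
    · simpa using hF.lipschitz x y
  -- Each term of the product rule has Hölder constant CD + 2CD, the oscillation of F being at most
  -- 2C dist^α; the two terms together account for the factor 6.
  have key : ∀ {F G : Space d → ℝ} {C D : ℝ}, C1H α C F → C1H α D G → ∀ x y,
      ‖F x • fderiv ℝ G x - F y • fderiv ℝ G y‖ ≤ 3 * C * D * dist x y ^ (α : ℝ) := by
    intro F G C D hF hG x y
    have : F x • fderiv ℝ G x - F y • fderiv ℝ G y
        = F x • (fderiv ℝ G x - fderiv ℝ G y) + (F x - F y) • fderiv ℝ G y := by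
      rw [smul_sub, sub_smul]; abel
    rw [this]
    refine (norm_add_le _ _).trans ?_
    rw [norm_smul, norm_smul, Real.norm_eq_abs, Real.norm_eq_abs]
    have h1 := mul_le_mul (hF.bdd x) (hG.holder x y) (norm_nonneg _) hF.nonneg
    have h2 := mul_le_mul (lip hF x y) (hG.grad y) (norm_nonneg _)
      (by have := hF.nonneg; positivity)
    nlinarith
  refine ⟨hf.diff.mul hg.diff, fun x => ?_, fun x => ?_, fun x y => ?_⟩
  · rw [abs_mul]
    nlinarith [mul_le_mul (hf.bdd x) (hg.bdd x) (abs_nonneg _) hA]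
  · rw [e]
    refine (norm_add_le _ _).trans ?_
    rw [norm_smul, norm_smul, Real.norm_eq_abs, Real.norm_eq_abs]
    nlinarith [mul_le_mul (hf.bdd x) (hg.grad x) (norm_nonneg _) hA,
      mul_le_mul (hg.bdd x) (hf.grad x) (norm_nonneg _) hB]
  · rw [e, e, add_sub_add_comm]
    refine (norm_add_le _ _).trans ?_
    nlinarith [key hf hg x y, key hg hf x y]

theorem comp_add (hf : C1H α A f) (h : Space d) : C1H α A (fun x => f (x + h)) := by
  have e : ∀ x, fderiv ℝ (fun x => f (x + h)) x = fderiv ℝ f (x + h) := fun x =>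
    fderiv_comp_add_right h
  refine ⟨hf.diff.comp (differentiable_id.add_const h), fun x => hf.bdd _, fun x => ?_,
    fun x y => ?_⟩
  · rw [e]; exact hf.grad _
  · rw [e, e]; simpa using hf.holder (x + h) (y + h)

theorem comp_smul (hf : C1H α A f) {c : ℝ} (hc : 0 ≤ c) :
    C1H α ((1 + c + c * c ^ (α : ℝ)) * A) (fun x => f (c • x)) := by
  have hA := hf.nonneg
  have e : ∀ x, fderiv ℝ (fun x => f (c • x)) x = c • fderiv ℝ f (c • x) := fun x => by
    rw [fderiv_comp_smul]
  have hcα : 0 ≤ c ^ (α : ℝ) := by positivity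
  refine ⟨hf.diff.comp (differentiable_id.const_smul c), fun x => (hf.bdd _).trans ?_,
    fun x => ?_, fun x y => ?_⟩
  · nlinarith [mul_nonneg hc hA, mul_nonneg (mul_nonneg hc hcα) hA]
  · rw [e, norm_smul, Real.norm_eq_abs, abs_of_nonneg hc]
    nlinarith [mul_nonneg hc hA, mul_nonneg (mul_nonneg hc hcα) hA,
      mul_le_mul_of_nonneg_left (hf.grad (c • x)) hc]
  · rw [e, e, ← smul_sub, norm_smul, Real.norm_eq_abs, abs_of_nonneg hc]
    have h1 := mul_le_mul_of_nonneg_left (hf.holder (c • x) (c • y)) hc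
    rw [dist_smul₀, Real.norm_eq_abs, abs_of_nonneg hc, Real.mul_rpow hc dist_nonneg] at h1
    have h2 : 0 ≤ dist x y ^ (α : ℝ) := by positivity
    nlinarith [mul_nonneg hA h2, mul_nonneg hc (mul_nonneg hA h2)]

/-- The four terms of the norm cost A, 2A, A and A, the second by interpolating between the sup
bound and the gradient bound; the sum 5A is rounded up to 6A. -/
theorem c1Norm_le (hα : α ≤ 1) (hf : C1H α A f) (S : Set (Space d)) :
    c1Norm α S f ≤ ENNReal.ofReal (6 * A) := by
  have hA := hf.nonneg
  have sup : ∀ {F : Type} [NormedAddCommGroup F] (k : Space d → F), (∀ x, ‖k x‖ ≤ A) →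
      supNormOn S k ≤ ENNReal.ofReal A := fun k hk => by
    refine iSup₂_le fun x _ => ?_
    rw [← ofReal_norm]
    exact ENNReal.ofReal_le_ofReal (hk x)
  have hol : ∀ {F : Type} [NormedAddCommGroup F] (k : Space d → F) (C : ℝ), 0 ≤ C →
      (∀ x y, ‖k x - k y‖ ≤ C * dist x y ^ (α : ℝ)) →
      eHolderNorm α (S.domRestrict k) ≤ ENNReal.ofReal C := fun k C hC hk => by
    refine HolderWith.eHolderNorm_le (C := C.toNNReal) fun x y => ?_
    have h1 := ENNReal.ofReal_le_ofReal (hk x y)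
    rw [ENNReal.ofReal_mul hC, ← ENNReal.ofReal_rpow_of_nonneg dist_nonneg α.coe_nonneg, ← edist_dist,
      ← dist_eq_norm, ← edist_dist] at h1
    exact h1
  have h1 := sup f hf.bdd
  have h2 := sup (fderiv ℝ f) hf.grad
  have h3 := hol (fderiv ℝ f) A hA hf.holder
  have h4 := hol f (2 * A) (by linarith) fun x y => by
    refine le_two_mul_rpow (a := 1) hA dist_nonneg α.2 (by exact_mod_cast hα) ?_ ?_
    · rw [Real.norm_eq_abs]
      linarith [abs_sub (f x) (f y), hf.bdd x, hf.bdd y]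
    · simpa using hf.lipschitz x y
  calc c1Norm α S f ≤ ENNReal.ofReal A + ENNReal.ofReal (2 * A) + ENNReal.ofReal A
        + ENNReal.ofReal A := by
        unfold c1Norm; gcongr
    _ = ENNReal.ofReal (5 * A) := by
        rw [← ENNReal.ofReal_add, ← ENNReal.ofReal_add, ← ENNReal.ofReal_add] <;>
          first | positivity | (congr 1; ring)
    _ ≤ _ := ENNReal.ofReal_le_ofReal (by linarith)

theorem toC1Bound (hα : α ≤ 1) (hf : C1H α A f) : C1Bound α (6 * A) f :=
  ⟨hf.diff, hf.c1Norm_le hα _⟩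

end C1H

theorem C1Bound.toC1H {α : ℝ≥0} {m : ℝ} {f : Space d → ℝ} (h : C1Bound α m f) :
    C1H α |m| f := by
  obtain ⟨hd, hm⟩ := h
  have hm' : c1Norm α Set.univ f ≤ ENNReal.ofReal |m| :=
    hm.trans (ENNReal.ofReal_le_ofReal (le_abs_self m))
  have conv : ∀ {a : ℝ} , ENNReal.ofReal a ≤ ENNReal.ofReal |m| → a ≤ |m| := fun h =>
    (ENNReal.ofReal_le_ofReal_iff (abs_nonneg m)).1 h
  have sup : ∀ {F : Type} [NormedAddCommGroup F] (k : Space d → F),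
      supNormOn Set.univ k ≤ ENNReal.ofReal |m| → ∀ x, ‖k x‖ ≤ |m| := fun k hk x => by
    refine conv (le_trans ?_ hk)
    rw [ofReal_norm]
    exact le_iSup₂ (f := fun x (_ : x ∈ Set.univ) => ‖k x‖ₑ) x (Set.mem_univ x)
  unfold c1Norm at hm'
  refine ⟨hd, sup f (le_trans ?_ hm'), sup _ (le_trans ?_ hm'), fun x y => ?_⟩
  · rw [add_assoc, add_assoc]; exact le_self_add
  · rw [add_assoc, add_comm, add_assoc]; exact le_self_add
  · have h3 : eHolderNorm α ((Set.univ : Set (Space d)).domRestrict (fderiv ℝ f))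
        ≤ ENNReal.ofReal |m| := le_trans le_add_self hm'
    have h4 : MemHolder α ((Set.univ : Set (Space d)).domRestrict (fderiv ℝ f)) :=
      eHolderNorm_lt_top.1 (h3.trans_lt ENNReal.ofReal_lt_top)
    have h5 := h4.holderWith ⟨x, Set.mem_univ x⟩ ⟨y, Set.mem_univ y⟩
    have h6 : (nnHolderNorm α ((Set.univ : Set (Space d)).domRestrict (fderiv ℝ f)) : ℝ≥0∞)
        ≤ ENNReal.ofReal |m| := coe_nnHolderNorm_le_eHolderNorm.trans h3
    have h7 : edist (fderiv ℝ f x) (fderiv ℝ f y) ≤ ENNReal.ofReal |m| * edist x y ^ (α : ℝ) :=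
      le_trans h5 (mul_le_mul_left h6 _)
    rw [edist_dist, edist_dist, ENNReal.ofReal_rpow_of_nonneg dist_nonneg α.coe_nonneg,
      ← ENNReal.ofReal_mul (abs_nonneg m), ENNReal.ofReal_le_ofReal_iff (by positivity),
      dist_eq_norm] at h7
    exact h7

/-- Smooth functions with compact support satisfy `C^{1,1}` bounds. -/
theorem exists_c1H_of_hasCompactSupport {f : Space d → ℝ} (hf : ContDiff ℝ 2 f)
    (hs : HasCompactSupport f) : ∃ A, C1H 1 A f := by
  have hd : ContDiff ℝ 1 (fderiv ℝ f) := hf.fderiv_right (by norm_num)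
  have hds := hs.fderiv ℝ
  obtain ⟨C₁, h1⟩ := hs.exists_bound_of_continuous hf.continuous
  obtain ⟨C₂, h2⟩ := hds.exists_bound_of_continuous hd.continuous
  obtain ⟨C₃, h3⟩ := hd.lipschitzWith_of_hasCompactSupport hds (by norm_num)
  refine ⟨max (max C₁ C₂) C₃, hf.differentiable (by norm_num), fun x => ?_, fun x => ?_,
    fun x y => ?_⟩
  · exact (h1 x).trans ((le_max_left _ _).trans (le_max_left _ _))
  · exact (h2 x).trans ((le_max_right _ _).trans (le_max_left _ _))
  · rw [← dist_eq_norm, NNReal.coe_one, Real.rpow_one]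
    exact (h3.dist_le_mul x y).trans (mul_le_mul_of_nonneg_right (le_max_right _ _) dist_nonneg)

theorem exists_cutoff (d : ℕ) : ∃ (A : ℝ) (χ : Space d → ℝ), C1H 1 A χ ∧ (∀ x, 0 ≤ χ x) ∧
    (∀ x, χ x ≤ 1) ∧ (∀ x, ‖x‖ ≤ 1 → χ x = 1) ∧ (∀ x, 2 ≤ ‖x‖ → χ x = 0) := by
  let χ : ContDiffBump (0 : Space d) := ⟨1, 2, by norm_num, by norm_num⟩
  obtain ⟨A, hA⟩ := exists_c1H_of_hasCompactSupport χ.contDiff χ.hasCompactSupport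
  exact ⟨A, χ, hA, fun x => χ.nonneg, fun x => χ.le_one,
    fun x hx => χ.one_of_mem_closedBall (by simpa using hx),
    fun x hx => χ.zero_of_le_dist (by simpa using hx)⟩

/-- The function 1 + (‖x‖² - 1)χ is ‖x‖² near the origin and 1 far away. Unlike ‖x‖² it is bounded
in C^{1,1}, so a small multiple singles out one point at a small cost in J. -/
theorem exists_penalty (d : ℕ) : ∃ (A : ℝ) (ψ : Space d → ℝ), C1H 1 A ψ ∧ ψ 0 = 0 ∧
    (∀ x, x ≠ 0 → 0 < ψ x) ∧ (∀ x, 1 ≤ ‖x‖ → 1 ≤ ψ x) := by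
  let χ : ContDiffBump (0 : Space d) := ⟨1, 2, by norm_num, by norm_num⟩
  have hc : ContDiff ℝ 2 (fun x : Space d => (‖x‖ ^ 2 - 1) * χ x) :=
    ((contDiff_norm_sq ℝ).sub contDiff_const).mul χ.contDiff
  obtain ⟨A, hA⟩ := exists_c1H_of_hasCompactSupport hc χ.hasCompactSupport.mul_left
  refine ⟨A + |1|, _, hA.add_const 1, ?_, fun x hx => ?_, fun x hx => ?_⟩
  · have : χ 0 = 1 := χ.one_of_mem_closedBall (by simp [χ])
    simp [this]
  · have h0 : 0 < ‖x‖ := norm_pos_iff.2 hx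
    have h1 : χ x ≤ 1 := χ.le_one
    have h2 : 0 ≤ χ x := χ.nonneg
    rcases h1.lt_or_eq with h | h
    · nlinarith [mul_nonneg (sq_nonneg ‖x‖) h2]
    · rw [h]; nlinarith
  · have h2 : 0 ≤ χ x := χ.nonneg
    have h3 : 0 ≤ ‖x‖ ^ 2 - 1 := by nlinarith
    show 1 ≤ (‖x‖ ^ 2 - 1) * χ x + 1
    linarith [mul_nonneg h3 h2]

end

/-! ### Quantitative consequences of the assumptions on `J`. -/

section

variable {d : ℕ}

theorem C1H.mem_classK {γ : ℝ≥0} (hγ : γ ≤ 1) {δ A m : ℝ} {f : Space d → ℝ} (hf : C1H γ A f)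
    (hδ : ∀ x, δ ≤ f x) (hm : 6 * A ≤ m) : f ∈ classK d γ δ m :=
  ⟨hδ, hf.diff, (hf.c1Norm_le hγ _).trans (ENNReal.ofReal_le_ofReal hm)⟩

theorem C1H.mem_domainK {γ : ℝ≥0} (hγ : γ ≤ 1) {δ A : ℝ} (hδ0 : 0 < δ) {f : Space d → ℝ}
    (hf : C1H γ A f) (hδ : ∀ x, δ ≤ f x) : f ∈ domainK d γ :=
  ⟨δ, 6 * A + δ + 1, hδ0, by linarith [hf.nonneg], hf.mem_classK hγ hδ (by linarith)⟩

theorem const_mem_domainK {γ : ℝ≥0} (hγ : γ ≤ 1) {c : ℝ} (hc : 0 < c) :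
    (fun _ : Space d => c) ∈ domainK d γ :=
  (C1H.const c).mem_domainK hγ hc fun _ => le_rfl

/-- If `f` lies below `g` on `(a, t]` and touches it at `t`, then the left derivative of `g` at `t`
is at most that of `f`. -/
theorem left_deriv_le_of_touching {f g : ℝ → ℝ} {f' g' a t : ℝ} (ha : a < t)
    (hf : HasDerivWithinAt f f' (Set.Ioc a t) t) (hg : HasDerivWithinAt g g' (Set.Ioc a t) t)
    (hle : ∀ s ∈ Set.Ioc a t, f s ≤ g s) (heq : f t = g t) : g' ≤ f' := by
  have h := hg.sub hf
  have hs : Set.Ioc a t \ {t} = Set.Ioo a t := Set.Ioc_sdiff_right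
  rw [hasDerivWithinAt_iff_tendsto_slope, hs] at h
  have hne : (𝓝[Set.Ioo a t] t).NeBot := right_nhdsWithin_Ioo_neBot ha
  have : g' - f' ≤ 0 := by
    refine le_of_tendsto h ?_
    filter_upwards [self_mem_nhdsWithin] with s hs
    have h1 := hle s ⟨hs.1, hs.2.le⟩
    rw [slope_def_field]
    refine div_nonpos_of_nonneg_of_nonpos ?_ (by linarith [hs.2])
    simp only [Pi.sub_apply]
    linarith
  linarith

namespace AdmissibleOperator

variable {γ : ℝ≥0} {J : (Space d → ℝ) → Space d → ℝ}

theorem exponent_le_one (hJ : AdmissibleOperator γ J) : γ ≤ 1 := hJ.exponent_lt_one.le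

theorem apply_const_eq (hJ : AdmissibleOperator γ J) {c : ℝ} (hc : 0 < c) (x : Space d) :
    J (fun _ => c) x = J (fun _ => c) 0 := by
  have := hJ.translation _ (const_mem_domainK hJ.exponent_le_one hc) x 0
  rw [zero_add] at this
  exact this.symm

theorem le_add_const (hJ : AdmissibleOperator γ J) {f : Space d → ℝ} (hf : f ∈ domainK d γ)
    {c : ℝ} (hc : 0 ≤ c) (x : Space d) : J (fun y => f y + c) x ≤ J f x := by
  rcases hc.eq_or_lt with h | h
  · simp [← h]
  · exact hJ.add_const f hf c h x

/-- The size B of f - g is kept apart from the bound A that determines L, so that a perturbation can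
be chosen small after L is known. -/
theorem exists_lipschitz (hJ : AdmissibleOperator γ J) {δ : ℝ} (hδ : 0 < δ) (A : ℝ) :
    ∃ L : ℝ, 0 ≤ L ∧ ∀ f g : Space d → ℝ, C1H γ A f → (∀ x, δ ≤ f x) → C1H γ A g →
      (∀ x, δ ≤ g x) → ∀ B, C1H γ B (fun x => f x - g x) → ∀ x, |J f x - J g x| ≤ L * B := by
  obtain ⟨C, -, hC⟩ := hJ.lipschitz
  have hm : δ < 6 * |A| + δ + 1 := by linarith [abs_nonneg A]
  refine ⟨C δ (6 * |A| + δ + 1) * 6, by positivity, fun f g hf hf' hg hg' B hB x => ?_⟩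
  have hA : 6 * A ≤ 6 * |A| + δ + 1 := by linarith [le_abs_self A]
  have h1 := hC δ _ hδ hm f (hf.mem_classK hJ.exponent_le_one hf' hA) g
    (hg.mem_classK hJ.exponent_le_one hg' hA)
  have h2 := hB.c1Norm_le hJ.exponent_le_one Set.univ
  have h3 : ‖J f x - J g x‖ₑ ≤ C δ (6 * |A| + δ + 1) * ENNReal.ofReal (6 * B) :=
    (le_iSup₂ (f := fun x (_ : x ∈ Set.univ) => ‖J f x - J g x‖ₑ) x (Set.mem_univ x)).trans
      (h1.trans (mul_le_mul_right h2 _))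
  rw [← ofReal_norm, ← ENNReal.ofReal_coe_nnreal, ← ENNReal.ofReal_mul NNReal.zero_le_coe,
    ENNReal.ofReal_le_ofReal_iff (by have := hB.nonneg; positivity), Real.norm_eq_abs] at h3
  linarith

/-- Compare f with the constant δ, on which J is a constant function by translation invariance. -/
theorem exists_bound (hJ : AdmissibleOperator γ J) {δ : ℝ} (hδ : 0 < δ) (A : ℝ) :
    ∃ b : ℝ, 0 ≤ b ∧ ∀ f : Space d → ℝ, C1H γ A f → (∀ x, δ ≤ f x) → ∀ x, |J f x| ≤ b := by
  obtain ⟨L, hL, h⟩ := hJ.exists_lipschitz hδ (A + δ)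
  refine ⟨L * |A + δ| + |J (fun _ => δ) 0|, by positivity, fun f hf hf' x => ?_⟩
  have hA := hf.nonneg
  have h1 := h f (fun _ => δ) (hf.mono (by linarith)) hf'
    ((C1H.const δ).mono (by rw [abs_of_pos hδ]; linarith)) (fun _ => le_rfl) (A + |δ|)
    (hf.sub (C1H.const δ)) x
  rw [hJ.apply_const_eq hδ, abs_of_pos hδ] at h1
  have h2 := mul_le_mul_of_nonneg_left (le_abs_self (A + δ)) hL
  have h3 := abs_sub_abs_le_abs_sub (J f x) (J (fun _ => δ) 0)
  linarith

/-- When f and g agree on the ball of radius 2R, the local term of the splitting inequality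
vanishes. What is left is a multiple of ω(R) controlled by A alone, so R₀ does not depend on f and
g. -/
theorem exists_radius (hJ : AdmissibleOperator γ J) {δ : ℝ} (hδ : 0 < δ) (A : ℝ) {ε : ℝ}
    (hε : 0 < ε) : ∃ R₀ : ℝ, ∀ R, R₀ ≤ R → ∀ f g : Space d → ℝ, C1H γ A f → (∀ x, δ ≤ f x) →
      C1H γ A g → (∀ x, δ ≤ g x) → (∀ x ∈ Metric.ball (0 : Space d) (2 * R), f x = g x) →
      ∀ x ∈ Metric.ball (0 : Space d) R, |J f x - J g x| ≤ ε := by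
  have hm : δ < 6 * |A| + δ + 1 := by linarith [abs_nonneg A]
  obtain ⟨C, ω, hω, hC⟩ := hJ.splitting δ _ hδ hm
  have hlim : Filter.Tendsto (fun R => (C : ℝ) * ((ω R : ℝ) * (12 * |A|) + ω R)) Filter.atTop
      (𝓝 0) := by
    have : Filter.Tendsto (fun R => (ω R : ℝ)) Filter.atTop (𝓝 0) := by
      have := NNReal.tendsto_coe.2 hω
      rwa [NNReal.coe_zero] at this
    simpa using ((this.mul_const (12 * |A|)).add this).const_mul (C : ℝ)
  obtain ⟨R₀, hR₀⟩ := Filter.eventually_atTop.1 (hlim.eventually (gt_mem_nhds hε))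
  refine ⟨max R₀ 2, fun R hR f g hf hf' hg hg' hfg x hx => ?_⟩
  have hA : 6 * A ≤ 6 * |A| + δ + 1 := by linarith [le_abs_self A]
  have hA0 := hf.nonneg
  have h1 := hC f (hf.mem_classK hJ.exponent_le_one hf' hA) g
    (hg.mem_classK hJ.exponent_le_one hg' hA) R (by linarith [le_max_right R₀ 2])
  have hfd : ∀ y ∈ Metric.ball (0 : Space d) (2 * R), fderiv ℝ (fun x => f x - g x) y = 0 := by
    intro y hy
    have : (fun x => f x - g x) =ᶠ[𝓝 y] fun _ => 0 := by
      filter_upwards [Metric.isOpen_ball.mem_nhds hy] with z hz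
      rw [hfg z hz, sub_self]
    rw [this.fderiv_eq]; simp
  have hz : c1Norm γ (Metric.ball 0 (2 * R)) (fun x => f x - g x) = 0 := by
    have e1 : (Metric.ball (0 : Space d) (2 * R)).domRestrict (fun x => f x - g x) = 0 := by
      funext y; exact sub_eq_zero.2 (hfg _ y.2)
    have e2 : (Metric.ball (0 : Space d) (2 * R)).domRestrict (fderiv ℝ (fun x => f x - g x))
        = 0 := by
      funext y; exact hfd _ y.2
    unfold c1Norm
    rw [e1, e2, eHolderNorm_zero, eHolderNorm_zero, add_zero, add_zero, add_eq_zero]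
    constructor
    · refine le_antisymm (iSup₂_le fun y hy => ?_) (zero_le)
      show ‖f y - g y‖ₑ ≤ 0
      rw [hfg y hy, sub_self, enorm_zero]
    · refine le_antisymm (iSup₂_le fun y hy => ?_) (zero_le)
      rw [hfd y hy]
      simp
  have hs : supNormOn Set.univ (fun x => f x - g x) ≤ ENNReal.ofReal (12 * |A|) := by
    refine iSup₂_le fun y _ => ?_
    rw [← ofReal_norm]
    refine ENNReal.ofReal_le_ofReal ?_
    rw [Real.norm_eq_abs]
    linarith [abs_sub (f y) (g y), hf.bdd y, hg.bdd y, le_abs_self A, abs_nonneg A]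
  have h3 : ‖J f x - J g x‖ₑ
      ≤ C * (0 + ω R * ENNReal.ofReal (12 * |A|) + ω R) := by
    refine (le_iSup₂ (f := fun x (_ : x ∈ Metric.ball (0 : Space d) R) => ‖J f x - J g x‖ₑ)
      x hx).trans (h1.trans ?_)
    rw [hz]
    gcongr
  have h4 : ENNReal.ofReal ‖J f x - J g x‖
      ≤ ENNReal.ofReal (C * ((ω R : ℝ) * (12 * |A|) + ω R)) := by
    rw [ENNReal.ofReal_mul NNReal.zero_le_coe, ENNReal.ofReal_add (by positivity) (by positivity),
      ENNReal.ofReal_mul NNReal.zero_le_coe, ENNReal.ofReal_coe_nnreal, ENNReal.ofReal_coe_nnreal,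
      ofReal_norm]
    rwa [zero_add] at h3
  rw [ENNReal.ofReal_le_ofReal_iff (by positivity), Real.norm_eq_abs] at h4
  exact h4.trans (hR₀ R ((le_max_left _ _).trans hR)).le

/-- Joint continuity of `(x, s) ↦ J(p + s)(x)` at `(x₀, 0)`. -/
theorem exists_near (hJ : AdmissibleOperator γ J) {δ A : ℝ} (hδ : 0 < δ) {p : Space d → ℝ}
    (hp : C1H γ A p) (hp' : ∀ x, δ ≤ p x) (x₀ : Space d) {ε : ℝ} (hε : 0 < ε) :
    ∃ ρ > 0, ∃ s₁ > 0, s₁ ≤ δ / 2 ∧ ∀ x, dist x x₀ < ρ → ∀ s, |s| ≤ s₁ →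
      |J (fun y => p y + s) x - J p x₀| < ε := by
  obtain ⟨L, hL, h⟩ := hJ.exists_lipschitz (half_pos hδ) (A + δ)
  have hc := hJ.continuous_apply p (hp.mem_domainK hJ.exponent_le_one hδ hp')
  obtain ⟨ρ, hρ, h1⟩ := Metric.continuous_iff.1 hc x₀ (ε / 2) (by linarith)
  refine ⟨ρ, hρ, min (δ / 2) (ε / (2 * (L + 1))), by positivity, min_le_left _ _,
    fun x hx s hs => ?_⟩
  have hs1 := hs.trans (min_le_left _ _)
  have hs2 := hs.trans (min_le_right _ _)
  have h2 := h (fun y => p y + s) p ((hp.add_const s).mono (by linarith))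
    (fun y => by linarith [hp' y, neg_abs_le s]) (hp.mono (by linarith))
    (fun y => by linarith [hp' y]) |s| (by simpa using (C1H.const (d := d) (α := γ) s)) x
  have h3 := h1 x hx
  rw [Real.dist_eq] at h3
  have h4 : L * |s| < ε / 2 := by
    rw [le_div_iff₀ (by positivity)] at hs2
    nlinarith [abs_nonneg s]
  calc |J (fun y => p y + s) x - J p x₀|
      ≤ |J (fun y => p y + s) x - J p x| + |J p x - J p x₀| := abs_sub_le _ _ _
    _ < ε := by linarith

theorem exists_test_exponent (hJ : AdmissibleOperator γ J) : ∃ β : ℝ≥0, 0 < β ∧ γ + β < 1 := by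
  obtain ⟨c, h1, h2⟩ := exists_between hJ.exponent_lt_one
  exact ⟨c - γ, tsub_pos_of_lt h1, by rwa [add_tsub_cancel_of_le h1.le]⟩

end AdmissibleOperator

/-- Test functions from `C^{1,1}` bounds in space and a time derivative. -/
theorem isTestFunction_of_c1H {γ : ℝ≥0} {β : ℝ≥0} (hβ : 0 < β) (hγβ : γ + β < 1)
    {t r A : ℝ} {φ φt : Space d → ℝ → ℝ}
    (h : ∀ s ∈ Set.Ioc (t - r) t, C1H (γ + β) A (fun y => φ y s))
    (hd : ∀ y, ∀ s ∈ Set.Ioc (t - r) t, HasDerivWithinAt (φ y) (φt y s) (Set.Ioc (t - r) t) s)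
    (hc : ContinuousOn (fun p : Space d × ℝ => φt p.1 p.2) (Set.univ ×ˢ Set.Ioc (t - r) t)) :
    IsTestFunction γ t r φ φt :=
  ⟨⟨β, hβ, hγβ, 6 * A, fun s hs => (h s hs).toC1Bound hγβ.le⟩, hd, hc⟩

/-- The separated test functions `p(x) + a t + c`. -/
theorem isTestFunction_separated {γ : ℝ≥0} {β : ℝ≥0} (hβ : 0 < β) (hγβ : γ + β < 1)
    {t r A : ℝ} {p : Space d → ℝ} (hp : C1H (γ + β) A p) (a c : ℝ) :
    IsTestFunction γ t r (fun y s => p y + (a * s + c)) (fun _ _ => a) := by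
  refine isTestFunction_of_c1H hβ hγβ (A := A + (|a| * (|t| + |r|) + |c|)) (fun s hs => ?_)
    (fun y s hs => ?_) continuousOn_const
  · refine (hp.add_const (a * s + c)).mono (add_le_add_right ?_ A)
    refine (abs_add_le _ _).trans (add_le_add_left ?_ _)
    rw [abs_mul]
    refine mul_le_mul_of_nonneg_left ?_ (abs_nonneg a)
    rw [abs_le]
    constructor
    · linarith [hs.1, neg_abs_le t, le_abs_self r]
    · linarith [hs.2, le_abs_self t, abs_nonneg r]
  · have := (((hasDerivAt_id s).const_mul a).add_const c).const_add (p y)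
    simpa using this.hasDerivWithinAt

theorem C1H.of_test {γ β : ℝ≥0} {m : ℝ} {f : Space d → ℝ} (h : C1Bound (γ + β) m f) :
    C1H γ (2 * |m|) f :=
  h.toC1H.exp_mono le_self_add

end

/-! ### Insertion of a `C^{1,1}` function between a sup-convolution and an inf-convolution. -/

section

section Insertion

set_option linter.unusedSectionVars false

variable {H : Type*} [NormedAddCommGroup H] [InnerProductSpace ℝ H]

theorem norm_midpoint_sub_sq (x y z : H) :
    ‖(1 / 2 : ℝ) • (x + y) - z‖ ^ 2 = (‖x - z‖ ^ 2 + ‖y - z‖ ^ 2) / 2 - ‖x - y‖ ^ 2 / 4 := by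
  have h1 : (1 / 2 : ℝ) • (x + y) - z = (1 / 2 : ℝ) • ((x - z) + (y - z)) := by
    module
  have h2 : x - y = (x - z) - (y - z) := by abel
  rw [h1, h2]
  generalize x - z = u
  generalize y - z = v
  rw [norm_smul, mul_pow, norm_add_sq_real, norm_sub_sq_real, Real.norm_eq_abs,
    abs_of_pos (by norm_num)]
  ring

/-- The sup-convolution of `U` with parameter `k`. -/
def supConv (k : ℝ) (U : H → ℝ) (x : H) : ℝ := ⨆ y, (U y - k * ‖x - y‖ ^ 2)

variable {k a b : ℝ} {U : H → ℝ}

theorem bddAbove_supConv (hk : 0 < k) (hb : ∀ y, U y ≤ b) (x : H) :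
    BddAbove (Set.range fun y => U y - k * ‖x - y‖ ^ 2) := by
  refine ⟨b, ?_⟩
  rintro _ ⟨y, rfl⟩
  have : 0 ≤ k * ‖x - y‖ ^ 2 := by positivity
  show U y - k * ‖x - y‖ ^ 2 ≤ b
  linarith [hb y]

theorem le_supConv (hk : 0 < k) (hb : ∀ y, U y ≤ b) (x y : H) :
    U y - k * ‖x - y‖ ^ 2 ≤ supConv k U x :=
  le_ciSup (bddAbove_supConv hk hb x) y

theorem supConv_le (hk : 0 < k) (hb : ∀ y, U y ≤ b) (x : H) : supConv k U x ≤ b := by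
  refine ciSup_le fun y => ?_
  have : 0 ≤ k * ‖x - y‖ ^ 2 := by positivity
  linarith [hb y]

theorem le_supConv_self (hk : 0 < k) (hb : ∀ y, U y ≤ b) (x : H) : U x ≤ supConv k U x := by
  simpa using le_supConv hk hb x x

/-- The function `supConv k U` + k‖·‖² is a supremum of affine functions, hence convex; this is its
midpoint inequality, via the parallelogram identity. -/
theorem supConv_midpoint_le (hk : 0 < k) (hb : ∀ y, U y ≤ b) (x y : H) :
    supConv k U ((1 / 2 : ℝ) • (x + y))
      ≤ (supConv k U x + supConv k U y) / 2 + k / 4 * ‖x - y‖ ^ 2 := by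
  refine ciSup_le fun z => ?_
  rw [norm_midpoint_sub_sq]
  have h1 := le_supConv hk hb x z
  have h2 := le_supConv hk hb y z
  linarith

theorem lowerSemicontinuous_supConv (hk : 0 < k) (hb : ∀ y, U y ≤ b) :
    LowerSemicontinuous (supConv k U) := by
  refine lowerSemicontinuous_ciSup (fun x => bddAbove_supConv hk hb x) fun y => ?_
  exact Continuous.lowerSemicontinuous (by fun_prop)

theorem exists_isMin_supConv [ProperSpace H] (hk : 0 < k) (ha : ∀ y, a ≤ U y) (hb : ∀ y, U y ≤ b)
    (x : H) : ∃ y, ∀ z, supConv k U y + 2 * k * ‖x - y‖ ^ 2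
      ≤ supConv k U z + 2 * k * ‖x - z‖ ^ 2 := by
  have hab : a ≤ b := (ha x).trans (hb x)
  -- Beyond the radius ρ ≥ 1 the penalty is at least 2kρ > b - a, which outweighs the oscillation of
  -- the sup-convolution.
  set ρ := (b - a) / (2 * k) + 1 with hρ
  have hρ1 : 1 ≤ ρ := by
    have : 0 ≤ (b - a) / (2 * k) := div_nonneg (by linarith) (by linarith)
    linarith
  have hlsc : LowerSemicontinuous fun z => supConv k U z + 2 * k * ‖x - z‖ ^ 2 :=
    (lowerSemicontinuous_supConv hk hb).add (Continuous.lowerSemicontinuous (by fun_prop))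
  obtain ⟨y, -, hy⟩ := LowerSemicontinuousOn.exists_isMinOn
    (s := Metric.closedBall x ρ) ⟨x, Metric.mem_closedBall_self (by linarith)⟩
    (isCompact_closedBall x ρ) (hlsc.lowerSemicontinuousOn _)
  refine ⟨y, fun z => ?_⟩
  by_cases hz : z ∈ Metric.closedBall x ρ
  · exact hy hz
  · rw [Metric.mem_closedBall, not_le, dist_comm, dist_eq_norm] at hz
    have h1 : supConv k U y + 2 * k * ‖x - y‖ ^ 2 ≤ supConv k U x + 2 * k * ‖x - x‖ ^ 2 :=
      hy (Metric.mem_closedBall_self (by linarith))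
    have h2 := supConv_le hk hb x
    have h3 := (ha z).trans (le_supConv_self hk hb z)
    have h4 : ρ ≤ ‖x - z‖ ^ 2 := by nlinarith
    have h5 : 2 * k * ρ = b - a + 2 * k := by rw [hρ]; field_simp
    have h6 : 2 * k * ρ ≤ 2 * k * ‖x - z‖ ^ 2 := by gcongr
    simp only [sub_self, norm_zero] at h1
    linarith

/-- Insertion of a `C^{1,1}` function between the sup-convolution of `U` and the inf-convolution of
`V + M`. -/
theorem exists_insertion [ProperSpace H] (hk : 0 < k) (ha : ∀ y, a ≤ U y) (hb : ∀ y, U y ≤ b)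
    {V : H → ℝ} {M : ℝ} (hUV : ∀ y z, U y - V z - k * ‖y - z‖ ^ 2 ≤ M) :
    ∃ (φ : H → ℝ) (D : H → H), (∀ x, HasFDerivAt φ (innerSL ℝ (D x)) x) ∧
      (∀ x, a ≤ φ x) ∧ (∀ x, φ x ≤ b) ∧ (∀ x, ‖D x‖ ≤ 8 * k * (b - a) + 1) ∧
      (∀ x y, ‖D x - D y‖ ≤ 20 * k * ‖x - y‖) ∧
      (∀ x y, U y - 2 * k * ‖x - y‖ ^ 2 ≤ φ x) ∧
      (∀ x z, φ x ≤ V z + M + 2 * k * ‖x - z‖ ^ 2) := by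
  choose Y hY using exists_isMin_supConv hk ha hb
  set w := supConv k U with hw
  have hwa : ∀ x, a ≤ w x := fun x => (ha x).trans (le_supConv_self hk hb x)
  have hwb : ∀ x, w x ≤ b := supConv_le hk hb
  -- The quadratic 2k‖x - ·‖² has twice the convexity needed to compensate the semiconvexity of w.
  -- The surplus gives quadratic growth at the minimizer Y x, which makes Y Lipschitz.
  have hconv : ∀ x y, w (Y x) + 2 * k * ‖x - Y x‖ ^ 2 + k / 2 * ‖Y x - y‖ ^ 2
      ≤ w y + 2 * k * ‖x - y‖ ^ 2 := fun x y => by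
    have h1 := hY x ((1 / 2 : ℝ) • (Y x + y))
    have h2 := supConv_midpoint_le hk hb (Y x) y
    rw [norm_sub_rev x ((1 / 2 : ℝ) • _), norm_midpoint_sub_sq, norm_sub_rev _ x,
      norm_sub_rev _ x] at h1
    rw [← hw] at h2
    linarith
  have hYlip : ∀ x y, ‖Y x - Y y‖ ≤ 4 * ‖x - y‖ := fun x y => by
    have h1 := hconv x (Y y)
    have h2 := hconv y (Y x)
    rw [norm_sub_rev (Y y)] at h2
    have h3 : ‖x - Y y‖ ^ 2 - ‖x - Y x‖ ^ 2 + ‖y - Y x‖ ^ 2 - ‖y - Y y‖ ^ 2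
        = 2 * inner ℝ (x - y) (Y x - Y y) := by
      simp only [norm_sub_sq_real, inner_sub_left, inner_sub_right]
      ring
    have h4 := real_inner_le_norm (x - y) (Y x - Y y)
    have h5 : k * ‖Y x - Y y‖ ^ 2 ≤ k * (4 * ‖x - y‖ * ‖Y x - Y y‖) := by
      have : k * ‖Y x - Y y‖ ^ 2
          ≤ 2 * k * (‖x - Y y‖ ^ 2 - ‖x - Y x‖ ^ 2 + ‖y - Y x‖ ^ 2 - ‖y - Y y‖ ^ 2) := by
        linarith
      rw [h3] at this
      nlinarith
    have h6 := le_of_mul_le_mul_left h5 hk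
    rcases (norm_nonneg (Y x - Y y)).eq_or_lt with h | h
    · rw [← h]; positivity
    · rw [sq] at h6
      exact le_of_mul_le_mul_right h6 h
  -- φ is the inf-convolution of w with parameter 2k, and D is its gradient as predicted by the
  -- envelope formula at the minimizer.
  set φ : H → ℝ := fun x => w (Y x) + 2 * k * ‖x - Y x‖ ^ 2 with hφ
  set D : H → H := fun x => (4 * k) • (x - Y x) with hD
  have hDlip : ∀ x y, ‖D x - D y‖ ≤ 20 * k * ‖x - y‖ := fun x y => by
    have : D x - D y = (4 * k) • ((x - y) - (Y x - Y y)) := by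
      simp only [hD]; module
    rw [this, norm_smul, Real.norm_eq_abs, abs_of_pos (by positivity)]
    have h1 := norm_sub_le (x - y) (Y x - Y y)
    have h2 := hYlip x y
    nlinarith
  have hup : ∀ x y, φ y ≤ φ x + inner ℝ (D x) (y - x) + 2 * k * ‖y - x‖ ^ 2 := fun x y => by
    have h1 := hY y (Y x)
    have h2 : ‖y - Y x‖ ^ 2 = ‖x - Y x‖ ^ 2 + 2 * inner ℝ (x - Y x) (y - x) + ‖y - x‖ ^ 2 := by
      rw [← norm_add_sq_real]; congr 2; abel
    have h3 : inner ℝ (D x) (y - x) = 4 * k * inner ℝ (x - Y x) (y - x) := by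
      simp only [hD, real_inner_smul_left]
    rw [h2] at h1
    rw [h3]
    simp only [hφ]
    linarith
  -- Exchanging x and y in `hup` replaces D x by D y, and the Lipschitz bound repairs this: 22 = 2 +
  -- 20. The two quadratic bounds together give the derivative.
  have hlow : ∀ x y, φ x + inner ℝ (D x) (y - x) - 22 * k * ‖y - x‖ ^ 2 ≤ φ y := fun x y => by
    have h1 := hup y x
    have h2 : inner ℝ (D y) (x - y) = -inner ℝ (D x) (y - x) - inner ℝ (D y - D x) (y - x) := by
      rw [← neg_sub y x, inner_neg_right, inner_sub_left]; ring
    have h3 := (abs_real_inner_le_norm (D y - D x) (y - x)).trans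
      (mul_le_mul_of_nonneg_right (hDlip y x) (norm_nonneg _))
    have h4 := neg_abs_le (inner ℝ (D y - D x) (y - x))
    rw [norm_sub_rev x y] at h1
    nlinarith
  refine ⟨φ, D, fun x => ?_, fun x => ?_, fun x => ?_, fun x => ?_, hDlip, fun x y => ?_,
    fun x z => ?_⟩
  · have hO : (fun y => φ y - φ x - innerSL ℝ (D x) (y - x)) =O[𝓝 x] fun y => ‖y - x‖ ^ 2 := by
      refine Asymptotics.IsBigO.of_bound (22 * k) (Filter.Eventually.of_forall fun y => ?_)
      rw [Real.norm_eq_abs, Real.norm_eq_abs, abs_of_nonneg (sq_nonneg ‖y - x‖), innerSL_apply_apply,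
        abs_le]
      have h1 := hup x y
      have h2 := hlow x y
      constructor <;> nlinarith [mul_nonneg hk.le (sq_nonneg ‖y - x‖)]
    have h0 := hO.hasFDerivAt (𝕜 := ℝ) (by norm_num)
    have h1 := (h0.add (innerSL ℝ (D x)).hasFDerivAt).add_const
      (φ x - innerSL ℝ (D x) x)
    rw [zero_add] at h1
    refine h1.congr_of_eventuallyEq (Filter.Eventually.of_forall fun y => ?_)
    simp only [Pi.add_apply, map_sub]
    ring
  · have : 0 ≤ 2 * k * ‖x - Y x‖ ^ 2 := by positivity
    simp only [hφ]; linarith [hwa (Y x)]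
  · have := hY x x
    simp only [sub_self, norm_zero] at this
    simp only [hφ]; linarith [hwb x]
  · have h1 := hY x x
    simp only [sub_self, norm_zero] at h1
    have h2 : 2 * k * ‖x - Y x‖ ^ 2 ≤ b - a := by linarith [hwb x, hwa (Y x)]
    have h3 : ‖D x‖ = 4 * k * ‖x - Y x‖ := by
      simp only [hD]
      rw [norm_smul, Real.norm_eq_abs, abs_of_pos (by positivity)]
    have h4 : ‖D x‖ ^ 2 ≤ 8 * k * (b - a) := by
      rw [h3]; nlinarith
    nlinarith [sq_nonneg (‖D x‖ - 1)]
  · have h1 := le_supConv hk hb (Y x) y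
    -- Here the parameter doubles from k to 2k: the error 2k‖x - Y x‖² is exactly the second term of
    -- φ x.
    have h2 : ‖Y x - y‖ ^ 2 ≤ 2 * ‖x - y‖ ^ 2 + 2 * ‖x - Y x‖ ^ 2 := by
      have := norm_add_sq_real (x - y) (x - Y x)
      have h3 := norm_sub_sq_real (x - y) (x - Y x)
      have h4 : (x - y) - (x - Y x) = Y x - y := by abel
      rw [h4] at h3
      nlinarith [sq_nonneg ‖(x - y) + (x - Y x)‖]
    rw [← hw] at h1
    simp only [hφ]
    nlinarith
  · have h1 := hY x z
    have h2 : w z ≤ V z + M := ciSup_le fun y => by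
      have := hUV y z
      rw [norm_sub_rev] at this
      linarith
    simp only [hφ]
    linarith

end Insertion

variable {d : ℕ}

/-- The insertion theorem on a Hilbert space split as space times time. -/
theorem exists_split_insertion {H : Type*} [NormedAddCommGroup H] [InnerProductSpace ℝ H]
    [ProperSpace H] (L : Space d →L[ℝ] H) (e : H) (π₁ : H → Space d) (π₂ : H → ℝ)
    (hπ : ∀ h, L (π₁ h) + π₂ h • e = h) (hπ₁ : ∀ (x : Space d) (t : ℝ), π₁ (L x + t • e) = x)
    (hπ₂ : ∀ (x : Space d) (t : ℝ), π₂ (L x + t • e) = t)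
    (nrm : ∀ (x y : Space d) (t s : ℝ), ‖(L x + t • e) - (L y + s • e)‖ ^ 2 = ‖x - y‖ ^ 2 + (t - s) ^ 2)
    {k : ℝ} (hk : 0 < k) (B : ℝ) (U V : Space d → ℝ → ℝ) (a b M : ℝ) (haB : |a| ≤ B)
    (hbB : |b| ≤ B) (ha : ∀ y s, a ≤ U y s) (hb : ∀ y s, U y s ≤ b)
    (hUV : ∀ y s z τ, U y s - V z τ - k * (‖y - z‖ ^ 2 + (s - τ) ^ 2) ≤ M) :
    ∃ φ φt : Space d → ℝ → ℝ,
      (∀ s, C1H 1 (B + (8 * k * (2 * B) + 1) + 20 * k) (fun y => φ y s)) ∧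
      (∀ y s, HasDerivAt (φ y) (φt y s) s) ∧
      Continuous (fun p : Space d × ℝ => φt p.1 p.2) ∧ (∀ y s, a ≤ φ y s) ∧
      (∀ x t y s, U y s - 2 * k * (‖x - y‖ ^ 2 + (t - s) ^ 2) ≤ φ x t) ∧
      (∀ x t z τ, φ x t ≤ V z τ + M + 2 * k * (‖x - z‖ ^ 2 + (t - τ) ^ 2)) := by
  have hL : ∀ v, ‖L v‖ = ‖v‖ := fun v => by
    have h1 := nrm v 0 0 0
    simp only [zero_smul, add_zero, map_zero, sub_zero, ne_eq, OfNat.ofNat_ne_zero,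
      not_false_eq_true, zero_pow] at h1
    exact (sq_eq_sq₀ (norm_nonneg _) (norm_nonneg _)).1 h1
  have hab : 0 ≤ b - a := by linarith [ha 0 0, hb 0 0]
  obtain ⟨φ, D, hφD, hφa, hφb, hDn, hDl, h1, h2⟩ := exists_insertion (H := H) hk
    (U := fun p => U (π₁ p) (π₂ p)) (V := fun p => V (π₁ p) (π₂ p)) (a := a) (b := b) (M := M)
    (fun y => ha _ _) (fun y => hb _ _) (fun y z => by
      have := hUV (π₁ y) (π₂ y) (π₁ z) (π₂ z)
      rwa [← nrm, hπ, hπ] at this)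
  have hB : 0 ≤ B := (abs_nonneg a).trans haB
  have hfd : ∀ x (t : ℝ), HasFDerivAt (fun y => φ (L y + t • e))
      ((innerSL ℝ (D (L x + t • e))).comp L) x := fun x t =>
    HasFDerivAt.comp x (hφD _) (L.hasFDerivAt.add_const _)
  have hBk : 0 ≤ k * B := by positivity
  have hD2 : ∀ x, ‖D x‖ ≤ 8 * k * (2 * B) + 1 := fun x => (hDn x).trans (by
    have : b - a ≤ 2 * B := by linarith [le_abs_self b, neg_abs_le a]
    have h8 : 0 ≤ 8 * k := by linarith
    linarith [mul_le_mul_of_nonneg_left this h8])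
  have hop : ∀ (P : H) (C : ℝ), ‖P‖ ≤ C → 0 ≤ C → ‖(innerSL ℝ P).comp L‖ ≤ C := by
    intro P C hP hC
    refine ContinuousLinearMap.opNorm_le_bound _ hC fun v => ?_
    rw [ContinuousLinearMap.comp_apply, innerSL_apply_apply]
    refine (norm_inner_le_norm _ _).trans ?_
    rw [hL]
    exact mul_le_mul_of_nonneg_right hP (norm_nonneg _)
  refine ⟨fun y s => φ (L y + s • e), fun y s => inner ℝ (D (L y + s • e)) e,
    fun s => ⟨fun x => (hfd x s).differentiableAt, fun x => ?_, fun x => ?_, fun x y => ?_⟩,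
    fun y s => ?_, ?_, fun y s => hφa _, fun x t y s => ?_, fun x t z τ => ?_⟩
  · have : |φ (L x + s • e)| ≤ B := abs_le.2
      ⟨by linarith [hφa (L x + s • e), neg_abs_le a],
        by linarith [hφb (L x + s • e), le_abs_self b]⟩
    linarith
  · rw [(hfd x s).fderiv]
    exact hop _ _ ((hD2 _).trans (by linarith)) (by linarith)
  · rw [(hfd x s).fderiv, (hfd y s).fderiv]
    have : (innerSL ℝ (D (L x + s • e))).comp L - (innerSL ℝ (D (L y + s • e))).comp L
        = (innerSL ℝ (D (L x + s • e) - D (L y + s • e))).comp L := by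
      rw [map_sub]; rfl
    rw [this, NNReal.coe_one, Real.rpow_one]
    refine hop _ _ ((hDl _ _).trans ?_) (by positivity)
    rw [add_sub_add_right_eq_sub, ← map_sub, hL, ← dist_eq_norm]
    exact mul_le_mul_of_nonneg_right (by linarith) dist_nonneg
  · have h3 : HasDerivAt (fun s : ℝ => L y + s • e) e s := by
      simpa using ((hasDerivAt_id s).smul_const e).const_add (L y)
    exact (hφD (L y + s • e)).comp_hasDerivAt s h3
  · have h3 : Continuous D := by
      refine (LipschitzWith.of_dist_le_mul (K := (20 * k).toNNReal) fun x y => ?_).continuous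
      rw [dist_eq_norm, dist_eq_norm, Real.coe_toNNReal _ (by positivity)]
      exact hDl x y
    have h4 : Continuous fun p : Space d × ℝ => L p.1 + p.2 • e := by fun_prop
    exact (h3.comp h4).inner continuous_const
  · have := h1 (L x + t • e) (L y + s • e)
    rw [nrm, hπ₁, hπ₂] at this
    exact this
  · have := h2 (L x + t • e) (L z + τ • e)
    rw [nrm, hπ₁, hπ₂] at this
    exact this

/-- The insertion theorem in space-time. -/
theorem exists_spacetime_insertion (d : ℕ) {k : ℝ} (hk : 0 < k) (B : ℝ) :
    ∃ A : ℝ, ∀ (U V : Space d → ℝ → ℝ) (a b M : ℝ), |a| ≤ B → |b| ≤ B →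
      (∀ y s, a ≤ U y s) → (∀ y s, U y s ≤ b) →
      (∀ y s z τ, U y s - V z τ - k * (‖y - z‖ ^ 2 + (s - τ) ^ 2) ≤ M) →
      ∃ φ φt : Space d → ℝ → ℝ, (∀ s, C1H 1 A (fun y => φ y s)) ∧
        (∀ y s, HasDerivAt (φ y) (φt y s) s) ∧
        Continuous (fun p : Space d × ℝ => φt p.1 p.2) ∧ (∀ y s, a ≤ φ y s) ∧
        (∀ x t y s, U y s - 2 * k * (‖x - y‖ ^ 2 + (t - s) ^ 2) ≤ φ x t) ∧
        (∀ x t z τ, φ x t ≤ V z τ + M + 2 * k * (‖x - z‖ ^ 2 + (t - τ) ^ 2)) := by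
  refine ⟨B + (8 * k * (2 * B) + 1) + 20 * k, fun U V a b M haB hbB ha hb hUV => ?_⟩
  -- The ordinary product carries the sup norm; the L² product makes space-time a Hilbert space, as
  -- the parallelogram identity requires.
  let L : Space d →L[ℝ] WithLp 2 (Space d × ℝ) :=
    ((WithLp.prodContinuousLinearEquiv 2 ℝ (Space d) ℝ).symm :
      (Space d × ℝ) →L[ℝ] WithLp 2 (Space d × ℝ)).comp (ContinuousLinearMap.inl ℝ (Space d) ℝ)
  have hdec : ∀ (x : Space d) (t : ℝ), L x + t • WithLp.toLp 2 (0, 1) = WithLp.toLp 2 (x, t) :=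
    fun x t => by
      apply WithLp.ofLp_injective 2
      ext1 <;> simp [L]
  refine exists_split_insertion L (WithLp.toLp 2 (0, 1)) WithLp.fst WithLp.snd (fun h => ?_)
    (fun x t => ?_) (fun x t => ?_) (fun x y t s => ?_) hk B U V a b M haB hbB ha hb hUV
  · rw [hdec]; rfl
  · rw [hdec]; rfl
  · rw [hdec]; rfl
  · rw [hdec, hdec, WithLp.prod_norm_sq_eq_of_L2]
    simp

end

/-! ### Barriers at the initial time. -/

section

variable {d : ℕ} {γ : ℝ≥0} {J : (Space d → ℝ) → Space d → ℝ} {T : ℝ}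

theorem exists_cutoff_radius (d : ℕ) {ρ : ℝ} (hρ : 0 < ρ) : ∃ (A : ℝ) (χ : Space d → ℝ),
    C1H 1 A χ ∧ (∀ x, 0 ≤ χ x) ∧ (∀ x, χ x ≤ 1) ∧ (∀ x, ‖x‖ ≤ ρ / 2 → χ x = 1) ∧
    (∀ x, ρ ≤ ‖x‖ → χ x = 0) := by
  obtain ⟨A, χ, h, h0, h1, hin, hout⟩ := exists_cutoff d
  have hc : 0 < 2 / ρ := by positivity
  refine ⟨_, _, h.comp_smul hc.le, fun x => h0 _, fun x => h1 _, fun x hx => hin _ ?_,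
    fun x hx => hout _ ?_⟩
  · rw [norm_smul, Real.norm_eq_abs, abs_of_pos hc]
    calc 2 / ρ * ‖x‖ ≤ 2 / ρ * (ρ / 2) := by gcongr
      _ = 1 := by field_simp
  · rw [norm_smul, Real.norm_eq_abs, abs_of_pos hc]
    calc (2 : ℝ) = 2 / ρ * ρ := by field_simp
      _ ≤ _ := by gcongr

/-- Subsolutions attain initial values from above, uniformly. -/
theorem AdmissibleOperator.sub_initial_modulus (hJ : AdmissibleOperator γ J) {f₀ : Space d → ℝ}
    (huc : UniformContinuous f₀) {δ M : ℝ} (hδ : 0 < δ) (hf₀ : ∀ x, δ ≤ f₀ x)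
    (hM : ∀ x, f₀ x ≤ M) {ε : ℝ} (hε : 0 < ε) : ∃ ρ > 0, ∃ τ > 0, ∀ u : Space d → ℝ → ℝ,
      IsViscositySubsolution γ J T u → (∀ x, ∀ t ∈ Set.Icc 0 T, u x t ≤ M) →
      (∀ x, u x 0 ≤ f₀ x) → ∀ x y t, dist y x ≤ ρ → t ∈ Set.Icc 0 T → t ≤ τ →
      u y t ≤ f₀ x + ε := by
  obtain ⟨ρ₀, hρ₀, h0⟩ := Metric.uniformContinuous_iff.1 huc (ε / 2) (by linarith)
  obtain ⟨A, χ, hχ, hχ0, hχ1, hin, hout⟩ := exists_cutoff_radius d (half_pos hρ₀)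
  obtain ⟨β, hβ, hγβ⟩ := hJ.exists_test_exponent
  have hMδ : δ ≤ M := (hf₀ 0).trans (hM 0)
  set A₁ := |M + ε / 2 + M| + |M| * A with hA₁
  have hp : ∀ x₀, C1H 1 A₁ fun y => -M * χ (y + -x₀) + (f₀ x₀ + ε / 2 + M) := fun x₀ => by
    refine (((hχ.comp_add (-x₀)).const_mul (-M)).add_const _).mono ?_
    have h1 : 0 ≤ M := hδ.le.trans hMδ
    rw [abs_neg, hA₁, abs_of_nonneg (a := f₀ x₀ + ε / 2 + M) (by linarith [hf₀ x₀]),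
      abs_of_nonneg h1, abs_of_nonneg (a := M + ε / 2 + M) (by linarith)]
    linarith [hM x₀]
  -- One b serves the profiles centred at all x₀, so that ρ and τ depend neither on x₀ nor on u.
  obtain ⟨b, hb, hJb⟩ := hJ.exists_bound hδ (2 * A₁)
  refine ⟨ρ₀ / 2 / 2, by positivity, ε / (2 * (b + 1)), by positivity, fun u hu huM hu0 x₀ y t hy ht
    htτ => ?_⟩
  set p : Space d → ℝ := fun y => -M * χ (y + -x₀) + (f₀ x₀ + ε / 2 + M) with hpdef
  have hple : ∀ y, f₀ x₀ + ε / 2 ≤ p y := fun y => by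
    simp only [hpdef]
    nlinarith [hχ1 (y + -x₀)]
  -- At a positive maximum of u minus the barrier, the test would give b + 1 ≤ J(p + const) ≤ J(p) ≤
  -- b. The maximum is global because p ≥ M away from x₀.
  have hbar : ∀ y, ∀ t ∈ Set.Icc 0 T, u y t ≤ p y + (b + 1) * t := by
    by_contra! hcon
    obtain ⟨y₁, t₁, ht₁, hy₁⟩ := hcon
    have hfar : ∀ y, y ∉ Metric.closedBall x₀ (ρ₀ / 2) → ∀ t ∈ Set.Icc 0 T,
        u y t ≤ p y + (b + 1) * t := fun y hy t ht => by
      rw [Metric.mem_closedBall, not_le, dist_eq_norm, sub_eq_add_neg] at hy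
      have h1 := hout (y + -x₀) hy.le
      have h2 := huM y t ht
      have h3 : 0 ≤ (b + 1) * t := mul_nonneg (by linarith) ht.1
      simp only [hpdef, h1]
      linarith [hf₀ x₀]
    have hpc : Continuous p := (hp x₀).diff.continuous
    obtain ⟨⟨x', t'⟩, ⟨hx', ht'⟩, hmax⟩ := UpperSemicontinuousOn.exists_isMaxOn
      (s := Metric.closedBall x₀ (ρ₀ / 2) ×ˢ Set.Icc 0 T)
      (f := fun q : Space d × ℝ => u q.1 q.2 + -(p q.1 + (b + 1) * q.2))
      ⟨(x₀, t₁), ⟨Metric.mem_closedBall_self (by linarith), ht₁⟩⟩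
      ((isCompact_closedBall x₀ (ρ₀ / 2)).prod isCompact_Icc)
      ((hu.usc.mono (Set.prod_mono_left (Set.subset_univ _))).add
        (Continuous.continuousOn (by fun_prop)).upperSemicontinuousOn)
    simp only at hx' ht'
    set μ := u x' t' + -(p x' + (b + 1) * t') with hμ
    have hmax' : ∀ y ∈ Metric.closedBall x₀ (ρ₀ / 2), ∀ t ∈ Set.Icc 0 T,
        u y t + -(p y + (b + 1) * t) ≤ μ := fun y hy t ht => hmax (a := (y, t)) ⟨hy, ht⟩
    have hμ0 : 0 < μ := by
      by_cases h : y₁ ∈ Metric.closedBall x₀ (ρ₀ / 2)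
      · linarith [hmax' y₁ h t₁ ht₁]
      · linarith [hfar y₁ h t₁ ht₁]
    have ht0 : 0 < t' := by
      rcases ht'.1.eq_or_lt with h | h
      · exfalso
        rw [← h] at hμ
        have h1 := h0 (a := x') (b := x₀) (by linarith [Metric.mem_closedBall.1 hx'])
        rw [Real.dist_eq] at h1
        linarith [hu0 x', hple x', le_abs_self (f₀ x' - f₀ x₀)]
      · exact h
    have htest := hu.test x' t' ⟨ht0, ht'.2⟩ (t' / 2) (by linarith) (by linarith) _ _
      (isTestFunction_separated hβ hγβ ((hp x₀).exp_mono hγβ.le) (b + 1) μ)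
      (fun y s hs => by
        have hsT : s ∈ Set.Icc 0 T := ⟨by linarith [hs.1], hs.2.trans ht'.2⟩
        show u y s ≤ p y + ((b + 1) * s + μ)
        by_cases h : y ∈ Metric.closedBall x₀ (ρ₀ / 2)
        · linarith [hmax' y h s hsT]
        · linarith [hfar y h s hsT])
      (by rw [hμ]; ring)
    have hpγ := (hp x₀).exp_mono hJ.exponent_le_one
    have hpδ : ∀ y, δ ≤ p y := fun y => by linarith [hple y, hf₀ x₀]
    have h1 := hJ.le_add_const (hpγ.mem_domainK hJ.exponent_le_one hδ hpδ)
      (c := (b + 1) * t' + μ) (by nlinarith) x'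
    linarith [hJb p hpγ hpδ x', le_abs_self (J p x')]
  have h1 := hbar y t ht
  have h2 : p y = f₀ x₀ + ε / 2 := by
    simp only [hpdef]
    rw [hin (y + -x₀) (by rwa [← sub_eq_add_neg, ← dist_eq_norm])]
    ring
  have h3 : (b + 1) * t ≤ ε / 2 := by
    rw [le_div_iff₀ (by positivity)] at htτ
    linarith
  linarith

/-- Scaling `g` up from `0` to `1`, either `c + l g` stays below `v` or it touches `v`. -/
theorem exists_scaled_contact {X : Type*} [TopologicalSpace X] {K : Set X} (hK : IsCompact K)
    {v g : X → ℝ} (hv : LowerSemicontinuousOn v K) (hg : ContinuousOn g K) {c : ℝ}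
    (hc : ∀ x ∈ K, c ≤ v x) : (∀ x ∈ K, c + g x ≤ v x) ∨
      ∃ l : ℝ, 0 ≤ l ∧ l ≤ 1 ∧ (∀ x ∈ K, c + l * g x ≤ v x) ∧ ∃ x ∈ K, v x = c + l * g x := by
  rcases K.eq_empty_or_nonempty with rfl | hne
  · left; simp
  obtain ⟨B, hB⟩ := (hK.image_of_continuousOn hg).bddAbove
  have hB' : ∀ x ∈ K, g x ≤ |B| + 1 := fun x hx => by
    linarith [hB ⟨x, hx, rfl⟩, le_abs_self B]
  set Λ : Set ℝ := {l | l ∈ Set.Icc 0 1 ∧ ∀ x ∈ K, c + l * g x ≤ v x} with hΛ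
  have hΛ0 : (0 : ℝ) ∈ Λ := ⟨⟨le_rfl, zero_le_one⟩, fun x hx => by linarith [hc x hx]⟩
  have hΛb : BddAbove Λ := ⟨1, fun l hl => hl.1.2⟩
  have hΛc : IsClosed Λ := by
    have : Λ = Set.Icc 0 1 ∩ ⋂ x ∈ K, {l | c + l * g x ≤ v x} := by
      ext l; simp [hΛ]
    rw [this]
    refine isClosed_Icc.inter (isClosed_biInter fun x _ => ?_)
    exact isClosed_le (by fun_prop) continuous_const
  obtain ⟨⟨hl0, hl1⟩, hle⟩ : sSup Λ ∈ Λ := hΛc.csSup_mem ⟨0, hΛ0⟩ hΛb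
  set l := sSup Λ with hl
  rcases hl1.eq_or_lt with h1 | hlt
  · left; simpa [h1] using hle
  right
  refine ⟨l, hl0, hl1, hle, ?_⟩
  obtain ⟨x', hx', hmin⟩ := LowerSemicontinuousOn.exists_isMinOn
    (f := fun x => v x + -(c + l * g x)) hne hK
    (hv.add (ContinuousOn.lowerSemicontinuousOn (by fun_prop)))
  refine ⟨x', hx', ?_⟩
  by_contra hne'
  have hm : 0 < v x' - (c + l * g x') := sub_pos.2 (lt_of_le_of_ne (hle x' hx') (Ne.symm hne'))
  set m := v x' - (c + l * g x')
  have hA : 0 < |B| + 1 := by positivity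
  have hstep : 0 < m / (|B| + 1) := by positivity
  -- If there were no contact, the least gap m on the compact set would be positive and would leave
  -- room to increase l.
  have hmem : min 1 (l + m / (|B| + 1)) ∈ Λ := by
    refine ⟨⟨le_min zero_le_one (by linarith), min_le_left _ _⟩, fun x hx => ?_⟩
    set l' := min 1 (l + m / (|B| + 1)) with hl'
    have hl'l : l ≤ l' := le_min hlt.le (by linarith)
    have h1 : v x' + -(c + l * g x') ≤ v x + -(c + l * g x) := hmin hx
    have h2 : (l' - l) * g x ≤ (l' - l) * (|B| + 1) :=
      mul_le_mul_of_nonneg_left (hB' x hx) (by linarith)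
    have h3 : l' - l ≤ m / (|B| + 1) := by linarith [min_le_right 1 (l + m / (|B| + 1))]
    rw [le_div_iff₀ hA] at h3
    have h4 : m = v x' - (c + l * g x') := rfl
    linarith
  have h1 := le_csSup hΛb hmem
  have h2 : l < min 1 (l + m / (|B| + 1)) := lt_min hlt (by linarith)
  linarith

/-- Supersolutions attain initial values from below, uniformly. -/
theorem AdmissibleOperator.super_initial_modulus (hJ : AdmissibleOperator γ J) (hT : 0 < T)
    {f₀ : Space d → ℝ} (huc : UniformContinuous f₀) {M : ℝ} (hM : ∀ x, f₀ x ≤ M)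
    {v : Space d → ℝ → ℝ} (hv : IsViscositySupersolution γ J T v) (hv0 : ∀ x, f₀ x ≤ v x 0)
    {ε : ℝ} (hε : 0 < ε) : ∃ ρ > 0, ∃ τ > 0, ∀ x y t, dist y x ≤ ρ → t ∈ Set.Icc 0 T → t ≤ τ →
      f₀ x - ε ≤ v y t := by
  obtain ⟨ρ₀, hρ₀, h0⟩ := Metric.uniformContinuous_iff.1 huc (ε / 2) (by linarith)
  obtain ⟨A, χ, hχ, hχ0, hχ1, hin, hout⟩ := exists_cutoff_radius d (half_pos hρ₀)
  obtain ⟨β, hβ, hγβ⟩ := hJ.exists_test_exponent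
  obtain ⟨η, hη, hvη⟩ := hv.inf_pos
  set A₁ := |M| * A + |η / 2| with hA₁
  have hA0 := hχ.nonneg
  obtain ⟨b, hb, hJb⟩ := hJ.exists_bound (δ := η / 4) (by linarith) (2 * (A₁ + η / 4))
  -- A contact at scale l forces l|M| ≥ η/2, because v ≥ η, while the equation forces l K ≤ b. This
  -- K makes the two incompatible.
  set K := 2 * |M| * b / η + 1 with hK
  have hK0 : 0 < K := by positivity
  set τ := min T (η / (4 * K)) with hτ
  have hτ0 : 0 < τ := lt_min hT (by positivity)
  have hKτ : K * τ ≤ η / 4 := by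
    have := min_le_right T (η / (4 * K))
    rw [← hτ, le_div_iff₀ (by positivity)] at this
    linarith
  refine ⟨ρ₀ / 2 / 2, by positivity, min τ (ε / (2 * K)), by positivity, fun x₀ y t hy ht htτ => ?_⟩
  rcases le_or_gt (f₀ x₀ - ε / 2) η with hsmall | hbig
  · linarith [hvη y t ht]
  -- With this amplitude the barrier η/2 + g at full scale equals f₀ x₀ - ε/2 - K t near x₀.
  set A₀ := f₀ x₀ - ε / 2 - η / 2 with hA₀
  have hA₀M : A₀ ≤ |M| := by linarith [hM x₀, le_abs_self M]
  have hA₀0 : 0 < A₀ := by linarith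
  set g : Space d → ℝ → ℝ := fun y t => A₀ * χ (y + -x₀) - K * t with hg
  have hgle : ∀ y t, 0 ≤ t → g y t ≤ A₀ := fun y t ht => by
    have := mul_nonneg hK0.le ht
    simp only [hg]; nlinarith [hχ1 (y + -x₀)]
  have hfar : ∀ y, y ∉ Metric.closedBall x₀ (ρ₀ / 2) → ∀ t, 0 ≤ t → g y t ≤ 0 := fun y hy t ht => by
    rw [Metric.mem_closedBall, not_le, dist_eq_norm, sub_eq_add_neg] at hy
    have := mul_nonneg hK0.le ht
    simp only [hg, hout _ hy.le]; linarith
  have hτT : ∀ t ∈ Set.Icc 0 τ, t ∈ Set.Icc 0 T := fun t ht => ⟨ht.1, ht.2.trans (min_le_left _ _)⟩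
  have hgc : Continuous fun q : Space d × ℝ => g q.1 q.2 := by
    have := hχ.diff.continuous
    simp only [hg]; fun_prop
  -- The barrier is scaled rather than slid down by a constant: sliding could destroy positivity,
  -- while every scaled barrier stays above η/4 on the time interval considered.
  have hbar : ∀ y, ∀ t ∈ Set.Icc 0 τ, η / 2 + g y t ≤ v y t := by
    rcases exists_scaled_contact
      ((isCompact_closedBall x₀ (ρ₀ / 2)).prod (isCompact_Icc (a := (0 : ℝ)) (b := τ)))
      (hv.lsc.mono fun q hq => ⟨Set.mem_univ _, hτT _ hq.2⟩) hgc.continuousOn (c := η / 2)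
      (fun q hq => by linarith [hvη q.1 q.2 (hτT _ hq.2)]) with h | ⟨l, hl0, hl1, hle', ⟨x', t'⟩,
        ⟨hx', ht'⟩, hcontact⟩
    · intro y t ht
      by_cases hy : y ∈ Metric.closedBall x₀ (ρ₀ / 2)
      · exact h (y, t) ⟨hy, ht⟩
      · linarith [hfar y hy t ht.1, hvη y t (hτT t ht)]
    exfalso
    simp only at hx' ht' hcontact
    have hle : ∀ y, ∀ t ∈ Set.Icc 0 τ, η / 2 + l * g y t ≤ v y t := fun y t ht => by
      by_cases hy : y ∈ Metric.closedBall x₀ (ρ₀ / 2)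
      · exact hle' (y, t) ⟨hy, ht⟩
      · have := mul_nonpos_of_nonneg_of_nonpos hl0 (hfar y hy t ht.1)
        linarith [hvη y t (hτT t ht)]
    have hlow := hvη x' t' (hτT t' ht')
    have ht0 : 0 < t' := by
      rcases ht'.1.eq_or_lt with h | h
      · exfalso
        have h1 := h0 (a := x') (b := x₀) (by linarith [Metric.mem_closedBall.1 hx'])
        rw [Real.dist_eq] at h1
        have h2 := hgle x' t' ht'.1
        have h3 : l * g x' t' ≤ A₀ := by nlinarith [hl0]
        have h4 := hv0 x'
        rw [h] at h4
        linarith [neg_abs_le (f₀ x' - f₀ x₀)]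
      · exact h
    set p : Space d → ℝ := fun y => (l * A₀) * χ (y + -x₀) + η / 2 with hpdef
    have hlA : 0 ≤ l * A₀ := mul_nonneg hl0 hA₀0.le
    have hp : C1H 1 A₁ p := by
      refine ((hχ.comp_add (-x₀)).const_mul (l * A₀)).add_const _ |>.mono ?_
      rw [hA₁, abs_of_nonneg hlA]
      have : l * A₀ ≤ |M| := by nlinarith
      nlinarith
    have hpη : ∀ y, η / 2 ≤ p y := fun y => by
      simp only [hpdef]
      nlinarith [mul_nonneg hlA (hχ0 (y + -x₀))]
    have hlK : ∀ s ∈ Set.Icc 0 τ, l * K * s ≤ η / 4 := fun s hs => by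
      have h1 : l * (K * s) ≤ 1 * (K * s) :=
        mul_le_mul_of_nonneg_right hl1 (mul_nonneg hK0.le hs.1)
      have h2 : K * s ≤ K * τ := by gcongr; exact hs.2
      linarith
    have heq : ∀ y s, p y + (-(l * K) * s + 0) = η / 2 + l * g y s := fun y s => by
      simp only [hpdef, hg]; ring
    have htest := hv.test x' t' ⟨ht0, (hτT t' ht').2⟩ (t' / 2) (by linarith) (by linarith) _ _
      (isTestFunction_separated hβ hγβ (hp.exp_mono hγβ.le) (-(l * K)) 0)
      ⟨η / 4, by linarith, fun y s hs => by
        have := hlK s ⟨by linarith [hs.1], hs.2.trans ht'.2⟩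
        linarith [hpη y]⟩
      (fun y s hs => by
        rw [heq]
        exact hle y s ⟨by linarith [hs.1], hs.2.trans ht'.2⟩)
      (by rw [heq, hcontact])
    have h1 := hlK t' ht'
    have h2 : 0 ≤ l * K * t' := mul_nonneg (mul_nonneg hl0 hK0.le) ht'.1
    have h3 := hJb _ (((hp.add_const (-(l * K) * t' + 0)).mono (by
      rw [add_zero, neg_mul, abs_neg, abs_of_nonneg h2]; linarith)).exp_mono hJ.exponent_le_one)
      (fun y => by linarith [hpη y]) x'
    have h4 : η / 2 ≤ l * |M| := by
      have h5 : l * g x' t' ≤ l * A₀ :=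
        mul_le_mul_of_nonneg_left (hgle x' t' ht'.1) hl0
      have h6 : l * A₀ ≤ l * |M| := mul_le_mul_of_nonneg_left hA₀M hl0
      linarith
    have h5 : l * K ≤ b := by linarith [neg_abs_le (J (fun y => p y + (-(l * K) * t' + 0)) x')]
    have h6 : K * η = 2 * |M| * b + η := by rw [hK]; field_simp
    have h7 : K * (η / 2) ≤ K * (l * |M|) := by gcongr
    have h8 : l * K * |M| ≤ b * |M| := by gcongr
    linarith
  have h1 := hbar y t ⟨ht.1, htτ.trans (min_le_left _ _)⟩
  simp only [hg] at h1
  rw [hin (y + -x₀) (by rwa [← sub_eq_add_neg, ← dist_eq_norm])] at h1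
  have h3 : K * t ≤ ε / 2 := by
    have := htτ.trans (min_le_right _ _)
    rw [le_div_iff₀ (by positivity)] at this
    linarith
  linarith

end

/-! ### One test function for both equations at a doubled maximum. -/

section

section Semicontinuity

variable {X Y : Type*} [TopologicalSpace X] [TopologicalSpace Y]

theorem upperSemicontinuousOn_comp {f : X → ℝ} {g : Y → X} {s : Set X} {t : Set Y}
    (hf : UpperSemicontinuousOn f s) (hg : Continuous g) (h : Set.MapsTo g t s) :
    UpperSemicontinuousOn (fun y => f (g y)) t := fun y hy a ha =>
  (hg.continuousWithinAt.tendsto_nhdsWithin h).eventually (hf (g y) (h hy) a ha)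

theorem upperSemicontinuousOn_neg {f : X → ℝ} {s : Set X} (hf : LowerSemicontinuousOn f s) :
    UpperSemicontinuousOn (fun x => -f x) s := fun x hx a ha => by
  filter_upwards [hf x hx (-a) (by simp only at ha; linarith)] with y hy
  linarith

theorem lowerSemicontinuousOn_neg {f : X → ℝ} {s : Set X} (hf : UpperSemicontinuousOn f s) :
    LowerSemicontinuousOn (fun x => -f x) s := fun x hx a ha => by
  filter_upwards [hf x hx (-a) (by simp only at ha; linarith)] with y hy
  linarith

end Semicontinuity

variable {d : ℕ} {γ : ℝ≥0} {J : (Space d → ℝ) → Space d → ℝ} {T : ℝ}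

/-- At a maximum point of the doubled functional, the equations for `u` and `v` can be tested by
shifts of one and the same function. -/
theorem AdmissibleOperator.exists_common_test (hJ : AdmissibleOperator γ J) {k B A : ℝ}
    (hk : 0 < k)
    (hA : ∀ (U V : Space d → ℝ → ℝ) (a b M : ℝ), |a| ≤ B → |b| ≤ B →
      (∀ y s, a ≤ U y s) → (∀ y s, U y s ≤ b) →
      (∀ y s z τ, U y s - V z τ - k * (‖y - z‖ ^ 2 + (s - τ) ^ 2) ≤ M) →
      ∃ φ φt : Space d → ℝ → ℝ, (∀ s, C1H 1 A (fun y => φ y s)) ∧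
        (∀ y s, HasDerivAt (φ y) (φt y s) s) ∧
        Continuous (fun p : Space d × ℝ => φt p.1 p.2) ∧ (∀ y s, a ≤ φ y s) ∧
        (∀ x t y s, U y s - 2 * k * (‖x - y‖ ^ 2 + (t - s) ^ 2) ≤ φ x t) ∧
        (∀ x t z τ, φ x t ≤ V z τ + M + 2 * k * (‖x - z‖ ^ 2 + (t - τ) ^ 2)))
    {u v : Space d → ℝ → ℝ} (hu : IsViscositySubsolution γ J T u)
    (hv : IsViscositySupersolution γ J T v) {η M M' l Aζ c : ℝ} {ζ : Space d → ℝ} (hη : 0 < η)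
    (hvη : ∀ x, ∀ t ∈ Set.Icc 0 T, η ≤ v x t) (hl : 0 ≤ l) (hζ : C1H 1 Aζ ζ)
    (hζ0 : ∀ x, 0 ≤ ζ x) (huM : ∀ x, ∀ t ∈ Set.Icc 0 T, u x t ≤ M) (hM'0 : 0 ≤ M') (hM'M : M' ≤ M)
    (hB : M + η ≤ B)
    (hmax : ∀ y, ∀ s ∈ Set.Icc 0 T, ∀ z, ∀ τ ∈ Set.Icc 0 T,
      u y s - l * s - ζ y - v z τ - k * (‖y - z‖ ^ 2 + (s - τ) ^ 2) ≤ M')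
    {y₀ z₀ : Space d} {s₀ τ₀ : ℝ} (hs₀ : s₀ ∈ Set.Ioc 0 T) (hτ₀ : τ₀ ∈ Set.Ioc 0 T)
    (heq : u y₀ s₀ - l * s₀ - ζ y₀ - v z₀ τ₀ - k * (‖y₀ - z₀‖ ^ 2 + (s₀ - τ₀) ^ 2) = M')
    (hc : c = k / 2 * (‖y₀ - z₀‖ ^ 2 + (s₀ - τ₀) ^ 2)) (hcη : c ≤ η / 4) :
    ∃ (F : Space d → ℝ) (D : ℝ) (h : Space d), C1H 1 A F ∧ (∀ y, M' + 3 * η / 4 ≤ F y) ∧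
      D + l ≤ J (fun y => F (y + h) + (l * s₀ + c) + ζ y) y₀ ∧
      J (fun y => F y + -(M' + c)) (y₀ + h) ≤ D := by
  have hc0 : 0 ≤ c := by rw [hc]; positivity
  -- Truncating below at a keeps φ - (M' + c) ≥ η/2, an admissible test function for v. The
  -- inequality required of U and V survives because v ≥ η.
  set a := M' + 3 * η / 4 with ha
  set b := M + η with hb
  classical
  -- The insertion lives on all times, so U is extended by its floor and V by a constant above U;
  -- neither extension creates a new constraint.
  set U : Space d → ℝ → ℝ := fun y s =>
    if s ∈ Set.Icc 0 T then max (u y s - l * s - ζ y) a else a with hU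
  set V : Space d → ℝ → ℝ := fun z τ => if τ ∈ Set.Icc 0 T then v z τ else b with hV
  have hUin : ∀ y, ∀ s ∈ Set.Icc 0 T, U y s = max (u y s - l * s - ζ y) a := fun y s hs => if_pos hs
  have hVin : ∀ y, ∀ s ∈ Set.Icc 0 T, V y s = v y s := fun y s hs => if_pos hs
  have hUb : ∀ y s, U y s ≤ b := fun y s => by
    by_cases hs : s ∈ Set.Icc 0 T
    · rw [hUin y s hs]
      refine max_le ?_ (by linarith)
      linarith [huM y s hs, hζ0 y, mul_nonneg hl hs.1]
    · simp only [hU, if_neg hs]; linarith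
  obtain ⟨φ, φt, hφ, hφt, hφtc, hφa, h1, h2⟩ := hA U V a b M'
    (abs_le.2 ⟨by linarith, by linarith⟩) (abs_le.2 ⟨by linarith, by linarith⟩)
    (fun y s => by
      by_cases hs : s ∈ Set.Icc 0 T
      · rw [hUin y s hs]; exact le_max_right _ _
      · simp only [hU, if_neg hs]; exact le_rfl) hUb
    (fun y s z τ => by
      have h0 : 0 ≤ k * (‖y - z‖ ^ 2 + (s - τ) ^ 2) := by positivity
      by_cases hτ : τ ∈ Set.Icc 0 T
      · rw [hVin z τ hτ]
        have h3 := hvη z τ hτ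
        by_cases hs : s ∈ Set.Icc 0 T
        · rw [hUin y s hs]
          have h4 := hmax y s hs z τ hτ
          rcases max_choice (u y s - l * s - ζ y) a with h | h <;> rw [h] <;> linarith
        · simp only [hU, if_neg hs]; linarith
      · simp only [hV, if_neg hτ]; linarith [hUb y s])
  obtain ⟨β, hβ, hγβ⟩ := hJ.exists_test_exponent
  -- Half the joining vector, in space and in time, brings both contact points to the midpoint. The
  -- insertion error 2k(‖h‖² + h'²) is then c, half the penalty, so the lower bound from u and the
  -- upper bound from v coincide there.
  set h : Space d := (1 / 2 : ℝ) • (z₀ - y₀) with hh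
  set h' : ℝ := (τ₀ - s₀) / 2 with hh'
  have hX : y₀ + h = z₀ + -h := by
    rw [hh]; module
  have hX' : s₀ + h' = τ₀ + -h' := by rw [hh']; ring
  have hch : 2 * k * (‖h‖ ^ 2 + h' ^ 2) = c := by
    rw [hc, hh, hh', norm_smul, norm_sub_rev, Real.norm_eq_abs, abs_of_pos (by norm_num)]
    ring
  have hlow : ∀ y, ∀ s ∈ Set.Icc 0 T, u y s - l * s - ζ y - c ≤ φ (y + h) (s + h') := by
    intro y s hs
    have h3 := h1 (y + h) (s + h') y s
    rw [add_sub_cancel_left, add_sub_cancel_left, hch, hUin y s hs] at h3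
    linarith [le_max_left (u y s - l * s - ζ y) a]
  have hupp : ∀ z, ∀ τ ∈ Set.Icc 0 T, φ (z + -h) (τ + -h') ≤ v z τ + M' + c := by
    intro z τ hτ
    have h3 := h2 (z + -h) (τ + -h') z τ
    rwa [add_sub_cancel_left, add_sub_cancel_left, norm_neg, neg_sq, hch, hVin z τ hτ] at h3
  have hsI : s₀ ∈ Set.Icc 0 T := ⟨hs₀.1.le, hs₀.2⟩
  have hτI : τ₀ ∈ Set.Icc 0 T := ⟨hτ₀.1.le, hτ₀.2⟩
  have hcontact : φ (y₀ + h) (s₀ + h') = v z₀ τ₀ + M' + c := by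
    have h3 := hlow y₀ s₀ hsI
    have h4 := hupp z₀ τ₀ hτI
    rw [← hX, ← hX'] at h4
    refine le_antisymm h4 ?_
    linarith
  have hgβ : γ + β ≤ 1 := hγβ.le
  refine ⟨fun y => φ y (s₀ + h'), φt (y₀ + h) (s₀ + h'), h, hφ _, fun y => hφa y _, ?_, ?_⟩
  · have ht := hu.test y₀ s₀ hs₀ (s₀ / 2) (by linarith [hs₀.1]) (by linarith [hs₀.1])
      (fun y s => φ (y + h) (s + h') + (l * s + c) + ζ y)
      (fun y s => φt (y + h) (s + h') + l)
      (isTestFunction_of_c1H hβ hγβ (A := 2 * (A + (l * T + c) + Aζ)) (fun s hs => ?_)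
        (fun y s hs => ?_) ?_) (fun y s hs => ?_) ?_
    · exact ht
    · refine C1H.exp_mono (((((hφ (s + h')).comp_add h).add_const (l * s + c)).add hζ).mono ?_) hgβ
      have hs0 : 0 ≤ s := by linarith [hs.1, hs₀.1]
      have : l * s ≤ l * T := mul_le_mul_of_nonneg_left (hs.2.trans hs₀.2) hl
      rw [abs_of_nonneg (add_nonneg (mul_nonneg hl hs0) hc0)]
      linarith
    · have h3 := ((hφt (y + h) (s + h')).comp_add_const s h').add
        (((hasDerivAt_id s).const_mul l).add_const c)
      simpa using (h3.add_const (ζ y)).hasDerivWithinAt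
    · exact ((hφtc.comp (f := fun p : Space d × ℝ => (p.1 + h, p.2 + h')) (by fun_prop)).add
        continuous_const).continuousOn
    · have := hlow y s ⟨by linarith [hs.1, hs₀.1], hs.2.trans hs₀.2⟩
      linarith
    · rw [hcontact]; linarith
  · have ht := hv.test z₀ τ₀ hτ₀ (τ₀ / 2) (by linarith [hτ₀.1]) (by linarith [hτ₀.1])
      (fun y s => φ (y + -h) (s + -h') + -(M' + c))
      (fun y s => φt (y + -h) (s + -h'))
      (isTestFunction_of_c1H hβ hγβ (A := 2 * (A + |-(M' + c)|)) (fun s hs => ?_)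
        (fun y s hs => ?_) ?_) ⟨η / 2, by linarith, fun y s hs => ?_⟩ (fun y s hs => ?_) ?_
    · have hmem : (fun y => φ y (s₀ + h') + -(M' + c)) ∈ domainK d γ :=
        C1H.mem_domainK hJ.exponent_le_one (δ := η / 2) (by linarith)
          (((hφ (s₀ + h')).add_const (-(M' + c))).exp_mono hJ.exponent_le_one)
          (fun y => by linarith [hφa y (s₀ + h')])
      have h3 := hJ.translation _ hmem (-h) z₀
      rw [← hX, ← hX', h3, ← hX] at ht
      exact ht
    · exact C1H.exp_mono (((hφ (s + -h')).comp_add (-h)).add_const _) hgβ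
    · have h3 := ((hφt (y + -h) (s + -h')).comp_add_const s (-h')).add_const (-(M' + c))
      simpa using h3.hasDerivWithinAt
    · exact (hφtc.comp (f := fun p : Space d × ℝ => (p.1 + -h, p.2 + -h'))
        (by fun_prop)).continuousOn
    · linarith [hφa (y + -h) (s + -h')]
    · have := hupp y s ⟨by linarith [hs.1, hτ₀.1], hs.2.trans hτ₀.2⟩
      linarith
    · rw [← hX, ← hX', hcontact]; ring

/-- Without ζ the function tested for u is a translate of the one tested for v plus the nonnegative
constant M' + c + (l s + c). Its J is therefore no larger, which would give D + l ≤ D; the bump ζ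
changes this only by its Lipschitz cost. -/
theorem AdmissibleOperator.le_of_common_test (hJ : AdmissibleOperator γ J) {η M' A B L l c s D Aζ : ℝ}
    (hη : 0 < η) (hM' : 0 ≤ M') (hc0 : 0 ≤ c) (hcη : c ≤ η / 4) (hls : 0 ≤ l * s) {F ζ : Space d → ℝ}
    (hF : C1H 1 A F) (hζ : C1H 1 Aζ ζ) (hζ0 : ∀ x, 0 ≤ ζ x) (hB : 2 * (A + (l * s + c) + Aζ) ≤ B)
    (hFM : ∀ y, M' + 3 * η / 4 ≤ F y)
    (hL : ∀ f g : Space d → ℝ, C1H γ B f → (∀ x, η / 2 ≤ f x) → C1H γ B g →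
      (∀ x, η / 2 ≤ g x) → ∀ B', C1H γ B' (fun x => f x - g x) → ∀ x, |J f x - J g x| ≤ L * B')
    {y h : Space d} (h1 : D + l ≤ J (fun y => F (y + h) + (l * s + c) + ζ y) y)
    (h2 : J (fun y => F y + -(M' + c)) (y + h) ≤ D) : l ≤ L * (2 * Aζ) := by
  have hγ := hJ.exponent_le_one
  have hlsc : 0 ≤ l * s + c := by linarith
  have hG : C1H 1 (A + (l * s + c)) (fun y => F (y + h) + (l * s + c)) := by
    simpa [abs_of_nonneg hlsc] using (hF.comp_add h).add_const (l * s + c)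
  have hζn := hζ.nonneg
  have h3 := hL (fun y => F (y + h) + (l * s + c) + ζ y) (fun y => F (y + h) + (l * s + c))
    (((hG.add hζ).exp_mono hγ).mono hB) (fun x => by linarith [hFM (x + h), hζ0 x])
    ((hG.exp_mono hγ).mono (by linarith)) (fun x => by linarith [hFM (x + h)]) (2 * Aζ)
    (by simpa using hζ.exp_mono hγ) y
  have h4 : J (fun y => F (y + h) + (l * s + c)) y = J (fun y => F y + (l * s + c)) (y + h) :=
    hJ.translation (fun y => F y + (l * s + c)) (((hF.add_const _).exp_mono hγ).mem_domainK hγ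
      (δ := η / 2) (by linarith) fun x => by linarith [hFM x]) h y
  have h5 := hJ.le_add_const (f := fun y => F y + -(M' + c))
    (((hF.add_const _).exp_mono hγ).mem_domainK hγ (δ := η / 2) (by linarith)
      fun x => by linarith [hFM x]) (c := M' + c + (l * s + c)) (by linarith) (y + h)
  have h6 : (fun y => F y + -(M' + c) + (M' + c + (l * s + c))) = fun y => F y + (l * s + c) := by
    funext y; ring
  rw [h6] at h5
  rw [h4] at h3
  linarith [le_abs_self (J (fun y => F (y + h) + (l * s + c) + ζ y) y
    - J (fun y => F y + (l * s + c)) (y + h))]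

/-- A bounded antitone sequence converges, so its consecutive differences tend to zero. Applied to
the doubled suprema at k = 2ⁿ, this makes the penalty term small. -/
theorem exists_consecutive_close {S : ℕ → ℝ} (hS : Antitone S) {m : ℝ} (hm : ∀ n, m ≤ S n) {ν : ℝ}
    (hν : 0 < ν) (N : ℕ) : ∃ n, N ≤ n ∧ S n - S (n + 1) < ν := by
  have hlim := tendsto_atTop_ciInf hS ⟨m, by rintro _ ⟨n, rfl⟩; exact hm n⟩
  have h2 := (Filter.tendsto_add_atTop_iff_nat 1).2 hlim
  have h3 := hlim.sub h2
  rw [sub_self] at h3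
  obtain ⟨n, hn, hn'⟩ := ((h3.eventually (gt_mem_nhds hν)).and (Filter.eventually_ge_atTop N)).exists
  exact ⟨n, hn', hn⟩

end

/-! ### The comparison principle. -/

section

variable {d : ℕ} {γ : ℝ≥0} {J : (Space d → ℝ) → Space d → ℝ} {T : ℝ}

/-- A small localized perturbation makes an almost maximal doubled functional attain its
maximum. -/
theorem exists_perturbed_max {u v : Space d → ℝ → ℝ}
    (hu : UpperSemicontinuousOn (fun p : Space d × ℝ => u p.1 p.2) (Set.univ ×ˢ Set.Icc 0 T))
    (hv : LowerSemicontinuousOn (fun p : Space d × ℝ => v p.1 p.2) (Set.univ ×ˢ Set.Icc 0 T))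
    {M k l S κ : ℝ} (hM : 0 ≤ M) (huM : ∀ x, ∀ t ∈ Set.Icc 0 T, u x t ≤ M)
    (hv0 : ∀ x, ∀ t ∈ Set.Icc 0 T, 0 ≤ v x t) (hk : 0 < k) (hl : 0 ≤ l) (hκ : 0 < κ) (hκS : κ ≤ S)
    (hS : ∀ y, ∀ s ∈ Set.Icc 0 T, ∀ z, ∀ τ ∈ Set.Icc 0 T,
      u y s - l * s - v z τ - k * (‖y - z‖ ^ 2 + (s - τ) ^ 2) ≤ S)
    {ψ : Space d → ℝ} (hψc : Continuous ψ) (hψ0 : ψ 0 = 0) (hψ : ∀ x, 0 ≤ ψ x)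
    (hψ1 : ∀ x, 1 ≤ ‖x‖ → 1 ≤ ψ x) {y₁ z₁ : Space d} {s₁ τ₁ : ℝ} (hs₁ : s₁ ∈ Set.Icc 0 T)
    (hτ₁ : τ₁ ∈ Set.Icc 0 T)
    (h1 : S - κ ≤ u y₁ s₁ - l * s₁ - v z₁ τ₁ - k * (‖y₁ - z₁‖ ^ 2 + (s₁ - τ₁) ^ 2)) :
    ∃ y₀, ∃ s₀ ∈ Set.Icc 0 T, ∃ z₀, ∃ τ₀ ∈ Set.Icc 0 T, ∃ M', S - κ ≤ M' ∧ M' ≤ S ∧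
      u y₀ s₀ - l * s₀ - 2 * κ * ψ (y₀ + -y₁) - v z₀ τ₀ - k * (‖y₀ - z₀‖ ^ 2 + (s₀ - τ₀) ^ 2) = M' ∧
      ∀ y, ∀ s ∈ Set.Icc 0 T, ∀ z, ∀ τ ∈ Set.Icc 0 T,
        u y s - l * s - 2 * κ * ψ (y + -y₁) - v z τ - k * (‖y - z‖ ^ 2 + (s - τ) ^ 2) ≤ M' := by
  -- At distance ‖y - z‖ ≥ r the penalty exceeds M and the doubled functional is nonpositive, so z
  -- may be confined to a ball once y is.
  set r := M / k + 1 with hr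
  have hr1 : 1 ≤ r := by
    have : 0 ≤ M / k := by positivity
    linarith
  have hkr : k * r ^ 2 ≥ M := by
    have h2 : k * r = M + k := by rw [hr]; field_simp
    nlinarith
  have hfar : ∀ y, ∀ s ∈ Set.Icc 0 T, ∀ z, ∀ τ ∈ Set.Icc 0 T, r ≤ ‖y - z‖ →
      u y s - l * s - v z τ - k * (‖y - z‖ ^ 2 + (s - τ) ^ 2) ≤ 0 := by
    intro y s hs z τ hτ hyz
    have h2 : k * r ^ 2 ≤ k * ‖y - z‖ ^ 2 := by gcongr
    have h3 : 0 ≤ k * (s - τ) ^ 2 := by positivity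
    linarith [huM y s hs, hv0 z τ hτ, mul_nonneg hl hs.1]
  obtain ⟨⟨⟨y₀, s₀⟩, ⟨z₀, τ₀⟩⟩, ⟨⟨hy₀, hs₀⟩, ⟨hz₀, hτ₀⟩⟩, hmax⟩ :=
    UpperSemicontinuousOn.exists_isMaxOn
      (s := (Metric.closedBall y₁ (1 + r) ×ˢ Set.Icc 0 T) ×ˢ
        (Metric.closedBall y₁ (1 + r) ×ˢ Set.Icc 0 T))
      (f := fun q : (Space d × ℝ) × (Space d × ℝ) => u q.1.1 q.1.2 + -v q.2.1 q.2.2 +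
        -(l * q.1.2 + 2 * κ * ψ (q.1.1 + -y₁) + k * (‖q.1.1 - q.2.1‖ ^ 2 + (q.1.2 - q.2.2) ^ 2)))
      ⟨((y₁, s₁), (y₁, s₁)), ⟨Metric.mem_closedBall_self (by linarith), hs₁⟩,
        ⟨Metric.mem_closedBall_self (by linarith), hs₁⟩⟩
      (((isCompact_closedBall y₁ (1 + r)).prod isCompact_Icc).prod
        ((isCompact_closedBall y₁ (1 + r)).prod isCompact_Icc))
      (((upperSemicontinuousOn_comp hu continuous_fst fun q hq => ⟨Set.mem_univ _, hq.1.2⟩).add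
        (upperSemicontinuousOn_comp (upperSemicontinuousOn_neg hv) continuous_snd
          fun q hq => ⟨Set.mem_univ _, hq.2.2⟩)).add
        (Continuous.continuousOn (by fun_prop)).upperSemicontinuousOn)
  simp only at hy₀ hs₀ hz₀ hτ₀
  have hmax' : ∀ y ∈ Metric.closedBall y₁ (1 + r), ∀ s ∈ Set.Icc 0 T,
      ∀ z ∈ Metric.closedBall y₁ (1 + r), ∀ τ ∈ Set.Icc 0 T,
      u y s - l * s - 2 * κ * ψ (y + -y₁) - v z τ - k * (‖y - z‖ ^ 2 + (s - τ) ^ 2) ≤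
      u y₀ s₀ - l * s₀ - 2 * κ * ψ (y₀ + -y₁) - v z₀ τ₀ - k * (‖y₀ - z₀‖ ^ 2 + (s₀ - τ₀) ^ 2) := by
    intro y hy s hs z hz τ hτ
    have h2 : u y s + -v z τ + -(l * s + 2 * κ * ψ (y + -y₁) + k * (‖y - z‖ ^ 2 + (s - τ) ^ 2)) ≤
      u y₀ s₀ + -v z₀ τ₀ + -(l * s₀ + 2 * κ * ψ (y₀ + -y₁) + k * (‖y₀ - z₀‖ ^ 2 + (s₀ - τ₀) ^ 2)) :=
      hmax (a := ((y, s), (z, τ))) ⟨⟨hy, hs⟩, ⟨hz, hτ⟩⟩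
    linarith
  set M' := u y₀ s₀ - l * s₀ - 2 * κ * ψ (y₀ + -y₁) - v z₀ τ₀
    - k * (‖y₀ - z₀‖ ^ 2 + (s₀ - τ₀) ^ 2) with hM'
  have hlow : S - κ ≤ M' := by
    by_cases hz : z₁ ∈ Metric.closedBall y₁ (1 + r)
    · have h2 := hmax' y₁ (Metric.mem_closedBall_self (by linarith)) s₁ hs₁ z₁ hz τ₁ hτ₁
      rw [add_neg_cancel, hψ0] at h2
      linarith
    · rw [Metric.mem_closedBall, not_le, dist_eq_norm, norm_sub_rev] at hz
      have h2 := hfar y₁ s₁ hs₁ z₁ τ₁ hτ₁ (by linarith)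
      have h3 := hmax' y₁ (Metric.mem_closedBall_self (by linarith)) s₁ hs₁ y₁
        (Metric.mem_closedBall_self (by linarith)) s₁ hs₁
      have h4 : S = κ := by linarith
      exfalso
      have h5 : k * r ^ 2 < k * ‖y₁ - z₁‖ ^ 2 := by gcongr; linarith
      have h6 : 0 ≤ k * (s₁ - τ₁) ^ 2 := by positivity
      linarith [huM y₁ s₁ hs₁, hv0 z₁ τ₁ hτ₁, mul_nonneg hl hs₁.1]
  refine ⟨y₀, s₀, hs₀, z₀, τ₀, hτ₀, M', hlow, ?_, hM'.symm, fun y s hs z τ hτ => ?_⟩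
  · have h2 := hS y₀ s₀ hs₀ z₀ τ₀ hτ₀
    have h3 : 0 ≤ 2 * κ * ψ (y₀ + -y₁) := mul_nonneg (by linarith) (hψ _)
    linarith
  · have h2 := hS y s hs z τ hτ
    by_cases hy : ‖y + -y₁‖ ≤ 1
    · have hy' : dist y y₁ ≤ 1 := by rwa [dist_eq_norm, sub_eq_add_neg]
      rcases le_or_gt r ‖y - z‖ with h | h
      · have h3 : 0 ≤ 2 * κ * ψ (y + -y₁) := mul_nonneg (by linarith) (hψ _)
        linarith [hfar y s hs z τ hτ h]
      · refine hmax' y (Metric.mem_closedBall.2 (by linarith)) s hs z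
          (Metric.mem_closedBall.2 ?_) τ hτ
        have := dist_triangle z y y₁
        rw [dist_comm z y, dist_eq_norm y z] at this
        linarith
    · have h3 := hψ1 _ (not_le.1 hy).le
      -- Leaving the unit ball about y₁ costs 2κ, more than the gap κ by which (y₁, z₁) misses the
      -- supremum.
      have h4 : 2 * κ * 1 ≤ 2 * κ * ψ (y + -y₁) := by gcongr
      linarith

set_option maxHeartbeats 800000 in
/-- The comparison principle. -/
theorem AdmissibleOperator.comparison (hJ : AdmissibleOperator γ J) (hT : 0 < T)
    {f₀ : Space d → ℝ} (huc : UniformContinuous f₀) {δ M : ℝ} (hδ : 0 < δ) (hf₀ : ∀ x, δ ≤ f₀ x)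
    (hM : ∀ x, f₀ x ≤ M) {u v : Space d → ℝ → ℝ} (hu : IsViscositySubsolution γ J T u)
    (hv : IsViscositySupersolution γ J T v) (huM : ∀ x, ∀ t ∈ Set.Icc 0 T, u x t ≤ M)
    (hu0 : ∀ x, u x 0 ≤ f₀ x) (hv0 : ∀ x, f₀ x ≤ v x 0) :
    ∀ x, ∀ t ∈ Set.Icc 0 T, u x t ≤ v x t := by
  by_contra! hcon
  obtain ⟨x₁, t₁, ht₁, hlt⟩ := hcon
  have hM0 : 0 < M := hδ.trans_le ((hf₀ 0).trans (hM 0))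
  set θ := u x₁ t₁ - v x₁ t₁ with hθ
  have hθ0 : 0 < θ := by linarith
  -- The slope consumes at most half of the excess θ, so every doubled supremum is still at least
  -- θ/2.
  set l := θ / (2 * T) with hl
  have hl0 : 0 < l := by positivity
  have hlT : l * T = θ / 2 := by rw [hl]; field_simp
  obtain ⟨η, hη, hvη⟩ := hv.inf_pos
  have hvn : ∀ x, ∀ t ∈ Set.Icc 0 T, 0 ≤ v x t := fun x t ht => hη.le.trans (hvη x t ht)
  obtain ⟨ρ₁, hρ₁, τ₁, hτ₁, hmu⟩ := hJ.sub_initial_modulus (T := T) huc hδ hf₀ hM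
    (ε := θ / 16) (by linarith)
  obtain ⟨ρ₂, hρ₂, τ₂, hτ₂, hmv⟩ := hJ.super_initial_modulus hT huc hM hv hv0
    (ε := θ / 16) (by linarith)
  set r := min ρ₁ (min (τ₁ / 2) (τ₂ / 2)) with hr
  have hr0 : 0 < r := by positivity
  have hrρ : r ≤ ρ₁ := min_le_left _ _
  have hrτ₁ : r ≤ τ₁ / 2 := (min_le_right _ _).trans (min_le_left _ _)
  have hrτ₂ : r ≤ τ₂ / 2 := (min_le_right _ _).trans (min_le_right _ _)
  have hinit : ∀ y, ∀ s ∈ Set.Icc 0 T, ∀ z, ∀ τ ∈ Set.Icc 0 T, ‖y - z‖ ≤ r → |s - τ| ≤ r →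
      (s = 0 ∨ τ = 0) → u y s - v z τ ≤ θ / 8 := by
    intro y s hs z τ hτ hyz hsτ h0
    have hss : s ≤ r ∧ τ ≤ r := by
      have := abs_le.1 hsτ
      rcases h0 with h | h
      · rw [h] at this ⊢; constructor <;> linarith
      · rw [h] at this ⊢; constructor <;> linarith
    have h1 := hmu u hu huM hu0 z y s (by rw [dist_eq_norm]; linarith) hs (by linarith)
    have h2 := hmv z z τ (by rw [dist_self]; exact hρ₂.le) hτ (by linarith)
    linarith
  let Q : Set ((Space d × ℝ) × (Space d × ℝ)) :=
    (Set.univ ×ˢ Set.Icc 0 T) ×ˢ (Set.univ ×ˢ Set.Icc 0 T)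
  let Ψ : ℝ → (Space d × ℝ) × (Space d × ℝ) → ℝ := fun k q => u q.1.1 q.1.2 - l * q.1.2
    - v q.2.1 q.2.2 - k * (‖q.1.1 - q.2.1‖ ^ 2 + (q.1.2 - q.2.2) ^ 2)
  let S : ℝ → ℝ := fun k => sSup (Ψ k '' Q)
  have hq₁ : ((x₁, t₁), (x₁, t₁)) ∈ Q := ⟨⟨Set.mem_univ _, ht₁⟩, ⟨Set.mem_univ _, ht₁⟩⟩
  have hne : ∀ k, (Ψ k '' Q).Nonempty := fun k => ⟨_, _, hq₁, rfl⟩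
  have hΨM : ∀ k, 0 ≤ k → ∀ q ∈ Q, Ψ k q ≤ M := by
    rintro k hk ⟨⟨y, s⟩, ⟨z, τ⟩⟩ ⟨⟨-, hs⟩, ⟨-, hτ⟩⟩
    have h1 : 0 ≤ k * (‖y - z‖ ^ 2 + (s - τ) ^ 2) := by positivity
    show u y s - l * s - v z τ - k * (‖y - z‖ ^ 2 + (s - τ) ^ 2) ≤ M
    linarith [huM y s hs, hvn z τ hτ, mul_nonneg hl0.le hs.1]
  have hbdd : ∀ k, 0 ≤ k → BddAbove (Ψ k '' Q) := fun k hk =>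
    ⟨M, by rintro _ ⟨q, hq, rfl⟩; exact hΨM k hk q hq⟩
  have hle : ∀ k, 0 ≤ k → ∀ q ∈ Q, Ψ k q ≤ S k := fun k hk q hq => le_csSup (hbdd k hk) ⟨q, hq, rfl⟩
  have hSθ : ∀ k, 0 ≤ k → θ / 2 ≤ S k := fun k hk => by
    refine le_trans ?_ (hle k hk _ hq₁)
    have h1 : Ψ k ((x₁, t₁), (x₁, t₁)) = θ - l * t₁ := by
      simp only [Ψ, sub_self, norm_zero]; rw [hθ]; ring
    rw [h1]
    have : l * t₁ ≤ l * T := mul_le_mul_of_nonneg_left ht₁.2 hl0.le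
    linarith
  have hSM : ∀ k, 0 ≤ k → S k ≤ M := fun k hk =>
    csSup_le (hne k) (by rintro _ ⟨q, hq, rfl⟩; exact hΨM k hk q hq)
  have hanti : Antitone fun n : ℕ => S (2 ^ n) := by
    intro m n hmn
    refine csSup_le (hne _) ?_
    rintro _ ⟨q, hq, rfl⟩
    refine le_trans ?_ (hle (2 ^ m) (by positivity) q hq)
    have h1 : (2 : ℝ) ^ m ≤ 2 ^ n := pow_le_pow_right₀ (by norm_num) hmn
    have h2 : 0 ≤ ‖q.1.1 - q.2.1‖ ^ 2 + (q.1.2 - q.2.2) ^ 2 := by positivity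
    have := mul_le_mul_of_nonneg_right h1 h2
    simp only [Ψ]
    linarith
  -- Beyond this index the penalty forces the two maximum points within r of each other, the
  -- distance at which the initial moduli apply.
  obtain ⟨N, hN⟩ := pow_unbounded_of_one_lt (M / r ^ 2) (one_lt_two (α := ℝ))
  obtain ⟨n, hnN, hclose⟩ := exists_consecutive_close hanti (fun n => hSθ (2 ^ n) (by positivity))
    (ν := η / 8) (by linarith) N
  set k : ℝ := 2 ^ (n + 1) with hk
  have hk0 : 0 < k := by positivity
  have hk2 : (2 : ℝ) ^ n = k / 2 := by rw [hk, pow_succ]; ring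
  rw [hk2] at hclose
  have hkr : M ≤ k * r ^ 2 := by
    have h1 : (2 : ℝ) ^ N ≤ k := pow_le_pow_right₀ (by norm_num) (by omega)
    have h2 : M / r ^ 2 ≤ k := hN.le.trans h1
    rwa [div_le_iff₀ (by positivity)] at h2
  obtain ⟨A, hA⟩ := exists_spacetime_insertion d hk0 (M + η)
  obtain ⟨Aψ, ψ, hψ, hψ0, hψpos, hψ1⟩ := exists_penalty d
  have hψn : ∀ x, 0 ≤ ψ x := fun x => by
    by_cases h : x = 0
    · rw [h, hψ0]
    · exact (hψpos x h).le
  have hAψ := hψ.nonneg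
  -- The order of choice matters: k determines A, A determines L, and only then is κ chosen. Using
  -- 2Aψ for the bump, justified by κ ≤ 1, keeps L independent of κ.
  obtain ⟨L, hL0, hL⟩ := hJ.exists_lipschitz (half_pos hη) (2 * (A + (θ / 2 + η / 4) + 2 * Aψ))
  obtain ⟨κ, hκ0, hκη, hκθ, hκ1, hκL⟩ : ∃ κ : ℝ, 0 < κ ∧ κ ≤ η / 8 ∧ κ ≤ θ / 8 ∧ κ ≤ 1 ∧
      L * (2 * (2 * κ * Aψ)) < l := by
    refine ⟨min (min (η / 8) (θ / 8)) (min 1 (l / (8 * (L * Aψ + 1)))), by positivity,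
      (min_le_left _ _).trans (min_le_left _ _), (min_le_left _ _).trans (min_le_right _ _),
      (min_le_right _ _).trans (min_le_left _ _), ?_⟩
    set κ := min (min (η / 8) (θ / 8)) (min 1 (l / (8 * (L * Aψ + 1))))
    have h1 : κ ≤ l / (8 * (L * Aψ + 1)) := (min_le_right _ _).trans (min_le_right _ _)
    have h2 : 0 ≤ L * Aψ := by positivity
    rw [le_div_iff₀ (by positivity)] at h1
    have h3 : 0 < κ := by positivity
    nlinarith
  obtain ⟨_, ⟨⟨⟨y₁, s₁⟩, ⟨z₁, τ₁'⟩⟩, ⟨⟨-, hs₁⟩, ⟨-, hτ₁'⟩⟩, rfl⟩, hnear⟩ :=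
    exists_lt_of_lt_csSup (hne k) (show S k - κ < S k by linarith)
  have hSk := hSθ k hk0.le
  obtain ⟨y₀, s₀, hs₀, z₀, τ₀, hτ₀, M', hM'1, hM'2, heq, hmax⟩ := exists_perturbed_max hu.usc hv.lsc
    hM0.le huM hvn hk0 hl0.le hκ0 (by linarith)
    (fun y s hs z τ hτ => hle k hk0.le ((y, s), (z, τ)) ⟨⟨Set.mem_univ _, hs⟩, ⟨Set.mem_univ _, hτ⟩⟩)
    hψ.diff.continuous hψ0 hψn hψ1 hs₁ hτ₁' hnear.le
  set ζ : Space d → ℝ := fun y => 2 * κ * ψ (y + -y₁) with hζdef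
  have hζ : C1H 1 (2 * κ * Aψ) ζ := by
    have := (hψ.comp_add (-y₁)).const_mul (2 * κ)
    rwa [abs_of_pos (by linarith)] at this
  have hζ0 : ∀ x, 0 ≤ ζ x := fun x => mul_nonneg (by linarith) (hψn _)
  have hM'0 : 0 ≤ M' := by linarith only [hM'1, hSk, hκθ, hθ0]
  have hM'M : M' ≤ M := hM'2.trans (hSM k hk0.le)
  set P := ‖y₀ - z₀‖ ^ 2 + (s₀ - τ₀) ^ 2 with hP
  have hls₀ : 0 ≤ l * s₀ := mul_nonneg hl0.le hs₀.1
  have hPM : P ≤ r ^ 2 := by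
    have h1 : k * P ≤ k * r ^ 2 := by
      linarith only [huM y₀ s₀ hs₀, hvn z₀ τ₀ hτ₀, hζ0 y₀, heq, hM'0, hls₀, hkr]
    exact le_of_mul_le_mul_left h1 hk0
  have hyz : ‖y₀ - z₀‖ ≤ r :=
    abs_le_of_sq_le_sq' (by linarith only [sq_nonneg (s₀ - τ₀), hPM, hP]) hr0.le |>.2
  have hst : |s₀ - τ₀| ≤ r :=
    abs_le.2 (abs_le_of_sq_le_sq' (by linarith only [sq_nonneg ‖y₀ - z₀‖, hPM, hP]) hr0.le)
  have hkP : 0 ≤ k * P := by positivity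
  have hpos : ¬(s₀ = 0 ∨ τ₀ = 0) := fun h => by
    have := hinit y₀ s₀ hs₀ z₀ τ₀ hτ₀ hyz hst h
    linarith only [this, hζ0 y₀, heq, hkP, hls₀, hM'1, hSk, hκθ, hθ0]
  rw [not_or] at hpos
  have hs₀' : s₀ ∈ Set.Ioc 0 T := ⟨lt_of_le_of_ne hs₀.1 (Ne.symm hpos.1), hs₀.2⟩
  have hτ₀' : τ₀ ∈ Set.Ioc 0 T := ⟨lt_of_le_of_ne hτ₀.1 (Ne.symm hpos.2), hτ₀.2⟩
  -- The same points compete in the functional with parameter k/2, whose value there is larger by at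
  -- least (k/2)P. Hence (k/2)P ≤ S(k/2) - S(k) + κ.
  have hcη : k / 2 * P ≤ η / 4 := by
    have h1 := hle (k / 2) (by positivity) ((y₀, s₀), (z₀, τ₀))
      ⟨⟨Set.mem_univ _, hs₀⟩, ⟨Set.mem_univ _, hτ₀⟩⟩
    have h2 : Ψ (k / 2) ((y₀, s₀), (z₀, τ₀)) = u y₀ s₀ - l * s₀ - v z₀ τ₀ - k / 2 * P := rfl
    rw [h2] at h1
    linarith only [h1, hζ0 y₀, heq, hM'1, hclose, hκη]
  obtain ⟨F, D, h, hF, hFM, h1, h2⟩ := hJ.exists_common_test hk0 hA hu hv hη hvη hl0.le hζ hζ0 huM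
    hM'0 hM'M le_rfl hmax hs₀' hτ₀' heq rfl hcη
  have hlsT : l * s₀ ≤ θ / 2 := by
    rw [← hlT]; exact mul_le_mul_of_nonneg_left hs₀.2 hl0.le
  have hκA : 2 * κ * Aψ ≤ 2 * Aψ := mul_le_mul_of_nonneg_right (by linarith only [hκ1]) hAψ
  have := hJ.le_of_common_test hη hM'0 (by positivity) hcη hls₀ hF hζ hζ0
    (by linarith only [hlsT, hcη, hκA]) hFM hL h1 h2
  exact absurd this (not_le.2 hκL)

end

/-! ### Semicontinuous envelopes and strict separated test functions. -/

section

section Envelope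

variable {X : Type*} [TopologicalSpace X] {s : Set X} {f : X → ℝ} {m M : ℝ}

/-- The upper semicontinuous envelope of `f` on `s`. -/
def uscEnvelope (s : Set X) (f : X → ℝ) (x : X) : ℝ := sInf {a | ∀ᶠ y in 𝓝[s] x, f y ≤ a}

theorem uscEnvelope_le (hm : ∀ x ∈ s, m ≤ f x) {x : X} (hx : x ∈ s) {a : ℝ}
    (ha : ∀ᶠ y in 𝓝[s] x, f y ≤ a) : uscEnvelope s f x ≤ a :=
  csInf_le ⟨m, fun b (hb : ∀ᶠ y in 𝓝[s] x, f y ≤ b) =>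
    (hm x hx).trans (hb.self_of_nhdsWithin hx)⟩ ha

theorem le_uscEnvelope (hM : ∀ x ∈ s, f x ≤ M) {x : X} (hx : x ∈ s) : f x ≤ uscEnvelope s f x :=
  le_csInf ⟨M, Filter.eventually_of_mem self_mem_nhdsWithin hM⟩
    fun b (hb : ∀ᶠ y in 𝓝[s] x, f y ≤ b) => hb.self_of_nhdsWithin hx

theorem uscEnvelope_le_of_le (hm : ∀ x ∈ s, m ≤ f x) (hM : ∀ x ∈ s, f x ≤ M) {x : X} (hx : x ∈ s) :
    uscEnvelope s f x ≤ M :=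
  uscEnvelope_le hm hx (Filter.eventually_of_mem self_mem_nhdsWithin hM)

theorem frequently_lt_of_lt_uscEnvelope (hm : ∀ x ∈ s, m ≤ f x) {x : X} (hx : x ∈ s) {a : ℝ}
    (ha : a < uscEnvelope s f x) : ∃ᶠ y in 𝓝[s] x, a < f y := by
  intro h
  refine not_le.2 ha (uscEnvelope_le hm hx ?_)
  filter_upwards [h] with y hy using not_lt.1 hy

theorem upperSemicontinuousOn_uscEnvelope (hm : ∀ x ∈ s, m ≤ f x) (hM : ∀ x ∈ s, f x ≤ M) :
    UpperSemicontinuousOn (uscEnvelope s f) s := fun x _ a ha => by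
  obtain ⟨b, hb, hba⟩ := exists_lt_of_csInf_lt
    ⟨M, Filter.eventually_of_mem self_mem_nhdsWithin hM⟩ ha
  filter_upwards [eventually_eventually_nhdsWithin.2 hb, self_mem_nhdsWithin] with y hy hys
  exact (uscEnvelope_le hm hys hy).trans_lt hba

end Envelope

variable {d : ℕ} {γ : ℝ≥0} {J : (Space d → ℝ) → Space d → ℝ} {T : ℝ}

/-- The separated function `p(x) + a (t - t₀)` touches `u` from above at `(x₀, t₀)` over
`t ≤ t₀`, strictly elsewhere, and stays above `u` away from `x₀` for a short time after `t₀`. -/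
structure StrictTouch (T : ℝ) (u : Space d → ℝ → ℝ) (p : Space d → ℝ) (a : ℝ) (x₀ : Space d)
    (t₀ : ℝ) : Prop where
  contact : u x₀ t₀ = p x₀
  away : ∀ ρ > 0, ∃ σ > 0, ∃ κ > 0, ∀ x, ρ ≤ dist x x₀ → ∀ t ∈ Set.Icc 0 T, |t - t₀| ≤ σ →
    u x t + κ ≤ p x + a * (t - t₀)
  past : ∃ e > 0, ∃ σ > 0, ∀ x, ∀ t ∈ Set.Icc 0 T, t ≤ t₀ → t₀ - σ ≤ t →
    u x t + e * (t₀ - t) ≤ p x + a * (t - t₀)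

/-- Strictness in space comes from p, and strictness in past time from lowering the slope to a <
φt(x₀, t₀). The slack away from x₀ also extends to times after t₀, where φ is not defined as a test
function: there semicontinuity on a compact set is used, and the bound B near infinity. -/
theorem strictTouch_of_test {u : Space d → ℝ → ℝ}
    (hu : UpperSemicontinuousOn (fun p : Space d × ℝ => u p.1 p.2) (Set.univ ×ˢ Set.Icc 0 T))
    {B κ₀ : ℝ} (hκ₀ : 0 < κ₀) (huB : ∀ x, ∀ t ∈ Set.Icc 0 T, u x t + κ₀ ≤ B) {x₀ : Space d}
    {t₀ r : ℝ} (ht₀ : t₀ ∈ Set.Ioc 0 T) (hr : 0 < r) {φ φt : Space d → ℝ → ℝ}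
    (hφ : ∀ y, ∀ s ∈ Set.Ioc (t₀ - r) t₀,
      HasDerivWithinAt (φ y) (φt y s) (Set.Ioc (t₀ - r) t₀) s)
    (hφt : ContinuousOn (fun p : Space d × ℝ => φt p.1 p.2) (Set.univ ×ˢ Set.Ioc (t₀ - r) t₀))
    (hle : ∀ y, ∀ s ∈ Set.Ioc (t₀ - r) t₀, u y s ≤ φ y s) (heq : u x₀ t₀ = φ x₀ t₀) {a : ℝ}
    (ha : a < φt x₀ t₀) {p : Space d → ℝ} (hp : Continuous p) (hpx₀ : p x₀ = φ x₀ t₀) {ρ₁ R : ℝ}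
    (hρ₁ : 0 < ρ₁) (hp₁ : ∀ x, dist x x₀ < ρ₁ → φ x t₀ ≤ p x)
    (hp₂ : ∀ x, x ≠ x₀ → ∃ θ ∈ Set.Icc (0 : ℝ) 1, (1 - θ) * φ x t₀ + θ * B < p x)
    (hp₃ : ∀ x, R ≤ ‖x‖ → B ≤ p x) : StrictTouch T u p a x₀ t₀ := by
  have hmem : t₀ ∈ Set.Ioc (t₀ - r) t₀ := ⟨by linarith, le_rfl⟩
  have hT : t₀ ∈ Set.Icc 0 T := ⟨ht₀.1.le, ht₀.2⟩
  have haway : ∀ ρ > 0, ∃ σ > 0, ∃ κ > 0, ∀ x, ρ ≤ dist x x₀ → ∀ t ∈ Set.Icc 0 T, |t - t₀| ≤ σ →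
      u x t + κ ≤ p x + a * (t - t₀) := by
    intro ρ hρ
    set C : Set (Space d) := Metric.closedBall 0 R ∩ (Metric.ball x₀ ρ)ᶜ with hC
    have hCc : IsCompact C := (isCompact_closedBall 0 R).inter_right Metric.isOpen_ball.isClosed_compl
    set G : Space d × ℝ → ℝ := fun q => u q.1 q.2 + -(p q.1 + a * (q.2 - t₀)) with hG
    have hGu : UpperSemicontinuousOn G (Set.univ ×ˢ Set.Icc 0 T) :=
      hu.add (Continuous.continuousOn (by fun_prop)).upperSemicontinuousOn
    have hneg : ∀ x ∈ C, G (x, t₀) < 0 := fun x hx => by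
      have hxne : x ≠ x₀ := fun h => hx.2 (by rw [h]; exact Metric.mem_ball_self hρ)
      obtain ⟨θ, hθ, h⟩ := hp₂ x hxne
      have h1 := hle x t₀ hmem
      have h2 := huB x t₀ hT
      -- Since u lies below both φ and B, it lies below each of their convex combinations, and p is
      -- strictly above one of these.
      have h3 : (1 - θ) * u x t₀ ≤ (1 - θ) * φ x t₀ :=
        mul_le_mul_of_nonneg_left h1 (by linarith [hθ.2])
      have h4 : θ * u x t₀ ≤ θ * B := mul_le_mul_of_nonneg_left (by linarith) hθ.1
      simp only [hG, sub_self, mul_zero, add_zero]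
      linarith
    obtain ⟨κ, hκ, hGκ⟩ : ∃ κ > 0, ∀ x ∈ C, G (x, t₀) < -κ := by
      rcases C.eq_empty_or_nonempty with h | h
      · exact ⟨1, one_pos, fun x hx => by rw [h] at hx; exact hx.elim⟩
      · obtain ⟨x', hx', hmax⟩ := UpperSemicontinuousOn.exists_isMaxOn (f := fun x => G (x, t₀)) h hCc
          (upperSemicontinuousOn_comp hGu (by fun_prop) fun x _ => ⟨Set.mem_univ _, hT⟩)
        have h1 := hneg x' hx'
        refine ⟨-G (x', t₀) / 2, by linarith, fun x hx => ?_⟩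
        have h2 : G (x, t₀) ≤ G (x', t₀) := hmax hx
        linarith
    have hev : ∀ᶠ t in 𝓝 t₀, ∀ x ∈ C, t ∈ Set.Icc 0 T → G (x, t) < -κ := by
      refine hCc.eventually_forall_of_forall_eventually fun x hx => ?_
      have h1 := hGu (x, t₀) ⟨Set.mem_univ _, hT⟩ (-κ) (hGκ x hx)
      rw [eventually_nhdsWithin_iff] at h1
      have h2 : Filter.Tendsto Prod.swap (𝓝 ((t₀, x) : ℝ × Space d)) (𝓝 (x, t₀)) :=
        continuous_swap.tendsto _
      filter_upwards [h2.eventually h1] with q hq hqT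
      exact hq ⟨Set.mem_univ _, hqT⟩
    obtain ⟨σ, hσ, hσG⟩ := Metric.eventually_nhds_iff.1 hev
    refine ⟨min (σ / 2) (κ₀ / (2 * (|a| + 1))), by positivity, min κ (κ₀ / 2), by positivity,
      fun x hx t ht htσ => ?_⟩
    have h1 := htσ.trans (min_le_left _ _)
    have h2 := htσ.trans (min_le_right _ _)
    rcases le_or_gt R ‖x‖ with hR | hR
    · have h3 := hp₃ x hR
      have h4 := huB x t ht
      rw [le_div_iff₀ (by positivity)] at h2
      have h5 : |a * (t - t₀)| ≤ κ₀ / 2 := by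
        rw [abs_mul]; nlinarith [abs_nonneg (t - t₀)]
      linarith [neg_abs_le (a * (t - t₀)), min_le_right κ (κ₀ / 2)]
    · have h3 : x ∈ C := ⟨by simpa using hR.le, by simpa using hx⟩
      have h4 := hσG (y := t) (by rw [Real.dist_eq]; linarith) x h3 ht
      simp only [hG] at h4
      linarith [min_le_left κ (κ₀ / 2)]
  refine ⟨heq.trans hpx₀.symm, haway, ?_⟩
  -- Near (x₀, t₀) the time derivative of φ exceeds a₂, so going back in time φ decreases at rate at
  -- least a₂; the margin a₂ - a is the slack e.
  obtain ⟨a₂, ha₁, ha₂⟩ := exists_between ha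
  have hnear : ∀ᶠ q in 𝓝[Set.univ ×ˢ Set.Ioc (t₀ - r) t₀] (x₀, t₀), a₂ < φt q.1 q.2 :=
    (hφt (x₀, t₀) ⟨Set.mem_univ _, hmem⟩).eventually (lt_mem_nhds ha₂)
  obtain ⟨ρ₂, hρ₂, hρ₂'⟩ := Metric.mem_nhdsWithin_iff.1 hnear
  set ρ := min ρ₁ ρ₂ with hρ
  have hρ0 : 0 < ρ := lt_min hρ₁ hρ₂
  have hin : ∀ x, dist x x₀ < ρ → ∀ t, t ≤ t₀ → t₀ - t < ρ₂ → t₀ - r < t →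
      u x t + (a₂ - a) * (t₀ - t) ≤ p x + a * (t - t₀) := by
    intro x hx t ht htρ htr
    have hsub : Set.Icc t t₀ ⊆ Set.Ioc (t₀ - r) t₀ := fun s hs => ⟨htr.trans_le hs.1, hs.2⟩
    have hder : ∀ s ∈ interior (Set.Icc t t₀), HasDerivAt (φ x) (φt x s) s := fun s hs => by
      rw [interior_Icc] at hs
      exact (hφ x s (hsub ⟨hs.1.le, hs.2.le⟩)).hasDerivAt
        (Ioc_mem_nhds (htr.trans hs.1) hs.2)
    have h1 := (convex_Icc t t₀).mul_sub_le_image_sub_of_le_deriv (f := φ x) (C := a₂)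
      (fun s hs => ((hφ x s (hsub hs)).continuousWithinAt.mono hsub))
      (fun s hs => (hder s hs).differentiableAt.differentiableWithinAt)
      (fun s hs => by
        rw [(hder s hs).deriv]
        rw [interior_Icc] at hs
        refine (hρ₂' ⟨?_, Set.mem_univ _, hsub ⟨hs.1.le, hs.2.le⟩⟩ :
          a₂ < φt (x, s).1 (x, s).2).le
        rw [Metric.mem_ball, Prod.dist_eq, max_lt_iff, Real.dist_eq]
        refine ⟨hx.trans_le (min_le_right _ _), ?_⟩
        rw [abs_lt]
        constructor <;> linarith [hs.1, hs.2])
      t (Set.left_mem_Icc.2 ht) t₀ (Set.right_mem_Icc.2 ht) ht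
    have h2 := hle x t ⟨htr, ht⟩
    have h3 := hp₁ x (hx.trans_le (min_le_left _ _))
    linarith
  obtain ⟨σ, hσ, κ, hκ, h⟩ := haway ρ hρ0
  have he : 0 < a₂ - a := by linarith
  refine ⟨a₂ - a, he, min (min σ (ρ₂ / 2)) (min (r / 2) (κ / (a₂ - a))), by positivity,
    fun x t ht htt hσt => ?_⟩
  have h1 := (min_le_left (min σ (ρ₂ / 2)) (min (r / 2) (κ / (a₂ - a)))).trans (min_le_left _ _)
  have h2 := (min_le_left (min σ (ρ₂ / 2)) (min (r / 2) (κ / (a₂ - a)))).trans (min_le_right _ _)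
  have h3 := (min_le_right (min σ (ρ₂ / 2)) (min (r / 2) (κ / (a₂ - a)))).trans (min_le_left _ _)
  have h4 := (min_le_right (min σ (ρ₂ / 2)) (min (r / 2) (κ / (a₂ - a)))).trans (min_le_right _ _)
  rcases lt_or_ge (dist x x₀) ρ with hx | hx
  · exact hin x hx t htt (by linarith) (by linarith)
  · have h5 := h x hx t ht (by rw [abs_le]; constructor <;> linarith)
    rw [le_div_iff₀ he] at h4
    have h6 : (a₂ - a) * (t₀ - t) ≤ κ := by
      refine le_trans ?_ h4
      rw [mul_comm]
      exact mul_le_mul_of_nonneg_right (by linarith) he.le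
    linarith

/-- Far from `x₀`, a space profile `f` can be replaced by a constant `B`, and perturbed so as to be
strict near `x₀`, without changing `J` much at `x₀`. The sign `s = ±1` selects the side. -/
theorem AdmissibleOperator.exists_cutoff_profile (hJ : AdmissibleOperator γ J) {α : ℝ≥0}
    (hγα : γ ≤ α) (hα : α ≤ 1) {A η B : ℝ} {f : Space d → ℝ} (hf : C1H α A f) (hη : 0 < η)
    (hfη : ∀ x, η ≤ f x) (hB : 0 < B) (x₀ : Space d) {ε : ℝ} (hε : 0 < ε) {s : ℝ}
    (hs : s = 1 ∨ s = -1) :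
    ∃ (p : Space d → ℝ) (A' δ' ρ R : ℝ), 0 < δ' ∧ C1H α A' p ∧ (∀ x, δ' ≤ p x) ∧
      |J p x₀ - J f x₀| < ε ∧ p x₀ = f x₀ ∧ 0 < ρ ∧ (∀ x, dist x x₀ < ρ → 0 ≤ s * (p x - f x)) ∧
      (∀ x, x ≠ x₀ → ∃ θ ∈ Set.Icc (0 : ℝ) 1, 0 < s * (p x - ((1 - θ) * f x + θ * B))) ∧
      ∀ x, R ≤ ‖x‖ → 0 ≤ s * (p x - B) := by
  obtain ⟨Aχ, χ, hχ, hχ0, hχ1, hin, hout⟩ := exists_cutoff d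
  obtain ⟨Aψ, ψ, hψ, hψ0, hψpos, -⟩ := exists_penalty d
  have hψn : ∀ x, 0 ≤ ψ x := fun x => by
    by_cases h : x = 0
    · rw [h, hψ0]
    · exact (hψpos x h).le
  have hAψ := hψ.nonneg
  have hAχ := hχ.nonneg
  have hA := hf.nonneg
  set δ := min η B with hδ
  have hδ0 : 0 < δ := lt_min hη hB
  -- This bound does not involve R: dilating the cutoff by c = 1/(2R) ≤ 1 costs at most a factor 3.
  -- Hence R₀ can be taken for A₁ before R is fixed.
  set A₁ := 6 * (2 * (3 * Aχ)) * (A + B) + B with hA₁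
  have hAA₁ : A ≤ 2 * (A₁ + A) := by
    have : 0 ≤ A₁ := by positivity
    linarith
  obtain ⟨R₀, hR₀⟩ := hJ.exists_radius hδ0 (2 * (A₁ + A)) (half_pos hε)
  obtain ⟨L, hL0, hL⟩ := hJ.exists_lipschitz (half_pos hδ0) (2 * (A₁ + 2 * Aψ))
  set R := max R₀ (‖x₀‖ + 1) with hR
  have hR1 : ‖x₀‖ + 1 ≤ R := le_max_right _ _
  have hRpos : 1 ≤ R := by linarith [norm_nonneg x₀]
  set c := 1 / (2 * R) with hc
  have hc0 : 0 < c := by positivity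
  have hc1 : c ≤ 1 := by rw [hc, div_le_one (by positivity)]; linarith
  set χR : Space d → ℝ := fun x => χ (c • x) with hχR
  have hχRin : ∀ x, ‖x‖ ≤ 2 * R → χR x = 1 := fun x hx => by
    refine hin _ ?_
    rw [norm_smul, Real.norm_eq_abs, abs_of_pos hc0]
    calc c * ‖x‖ ≤ c * (2 * R) := by gcongr
      _ = 1 := by rw [hc]; field_simp
  have hχRout : ∀ x, 4 * R ≤ ‖x‖ → χR x = 0 := fun x hx => by
    refine hout _ ?_
    rw [norm_smul, Real.norm_eq_abs, abs_of_pos hc0]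
    calc (2 : ℝ) = c * (4 * R) := by rw [hc]; field_simp; norm_num
      _ ≤ c * ‖x‖ := by gcongr
  have hχRb : C1H α (2 * (3 * Aχ)) χR := by
    refine ((hχ.comp_smul hc0.le).mono ?_).exp_mono hα
    rw [NNReal.coe_one, Real.rpow_one]
    gcongr
    nlinarith
  set q : Space d → ℝ := fun x => χR x * (f x + -B) + B with hq
  have hqb : C1H α A₁ q := by
    have h1 := (hχRb.mul hα (hf.add_const (-B))).add_const B
    rwa [abs_neg, abs_of_pos hB] at h1
  have hqδ : ∀ x, δ ≤ q x := fun x => by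
    have h1 : δ ≤ f x := (min_le_left _ _).trans (hfη x)
    have h2 : δ ≤ B := min_le_right _ _
    have h3 : 0 ≤ χR x := hχ0 _
    have h4 : χR x ≤ 1 := hχ1 _
    simp only [hq]
    nlinarith [mul_nonneg h3 (sub_nonneg.2 h1), mul_nonneg (sub_nonneg.2 h4) (sub_nonneg.2 h2)]
  have hqf : ∀ x, ‖x‖ ≤ 2 * R → q x = f x := fun x hx => by
    simp only [hq, hχRin x hx]; ring
  have hJq := hR₀ R (le_max_left _ _) q f
    ((hqb.exp_mono hγα).mono (by linarith)) hqδ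
    ((hf.exp_mono hγα).mono (by have : 0 ≤ A₁ := hqb.nonneg; linarith))
    (fun x => (min_le_left _ _).trans (hfη x))
    (fun x hx => hqf x (by rw [mem_ball_zero_iff] at hx; exact hx.le))
    x₀ (by rw [mem_ball_zero_iff]; linarith)
  obtain ⟨κ, hκ0, hκ1, hκδ, hκL⟩ : ∃ κ : ℝ, 0 < κ ∧ κ ≤ 1 ∧ κ * Aψ ≤ δ / 2 ∧
      L * (2 * (κ * Aψ)) < ε / 2 := by
    refine ⟨min 1 (min (δ / (2 * (Aψ + 1))) (ε / (8 * (L * Aψ + 1)))), by positivity,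
      min_le_left _ _, ?_, ?_⟩
    · have h1 := (min_le_right 1 (min (δ / (2 * (Aψ + 1))) (ε / (8 * (L * Aψ + 1))))).trans
        (min_le_left _ _)
      rw [le_div_iff₀ (by positivity)] at h1
      have h2 : 0 < min 1 (min (δ / (2 * (Aψ + 1))) (ε / (8 * (L * Aψ + 1)))) := by positivity
      nlinarith
    · have h1 := (min_le_right 1 (min (δ / (2 * (Aψ + 1))) (ε / (8 * (L * Aψ + 1))))).trans
        (min_le_right _ _)
      rw [le_div_iff₀ (by positivity)] at h1
      have h2 : 0 < min 1 (min (δ / (2 * (Aψ + 1))) (ε / (8 * (L * Aψ + 1)))) := by positivity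
      have h3 : 0 ≤ L * Aψ := by positivity
      nlinarith
  have hs1 : |s| = 1 := by rcases hs with h | h <;> rw [h] <;> norm_num
  have hs2 : s * s = 1 := by rcases hs with h | h <;> rw [h] <;> norm_num
  set ζ : Space d → ℝ := fun x => s * κ * ψ (x + -x₀) with hζ
  have hζb : C1H 1 (κ * Aψ) ζ := by
    have := (hψ.comp_add (-x₀)).const_mul (s * κ)
    rwa [abs_mul, hs1, one_mul, abs_of_pos hκ0] at this
  have hsζ : ∀ x, s * ζ x = κ * ψ (x + -x₀) := fun x => by
    simp only [hζ]; linear_combination κ * ψ (x + -x₀) * hs2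
  have hsζ0 : ∀ x, 0 ≤ s * ζ x := fun x => by rw [hsζ]; exact mul_nonneg hκ0.le (hψn _)
  have hκA : κ * Aψ ≤ Aψ := by nlinarith
  have hpb : C1H α (A₁ + 2 * (κ * Aψ)) (fun x => q x + ζ x) := hqb.add (hζb.exp_mono hα)
  have hpδ : ∀ x, δ / 2 ≤ q x + ζ x := fun x => by
    linarith [hqδ x, hζb.bdd x, neg_abs_le (ζ x)]
  have hζx₀ : ζ x₀ = 0 := by simp only [hζ, add_neg_cancel, hψ0, mul_zero]
  refine ⟨fun x => q x + ζ x, _, δ / 2, 1, 4 * R, half_pos hδ0, hpb, hpδ, ?_, ?_, one_pos,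
    fun x hx => ?_, fun x hx => ?_, fun x hx => ?_⟩
  · have h1 := hL (fun x => q x + ζ x) q ((hpb.exp_mono hγα).mono (by linarith)) hpδ
      ((hqb.exp_mono hγα).mono (by linarith)) (fun x => by linarith [hqδ x]) (2 * (κ * Aψ))
      (by simpa using hζb.exp_mono hJ.exponent_le_one) x₀
    linarith [abs_sub_le (J (fun x => q x + ζ x) x₀) (J q x₀) (J f x₀)]
  · show q x₀ + ζ x₀ = f x₀
    rw [hqf x₀ (by linarith [norm_nonneg x₀]), hζx₀, add_zero]
  · have h1 : ‖x‖ ≤ 2 * R := by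
      have := norm_le_norm_add_norm_sub' x x₀
      rw [← dist_eq_norm] at this
      linarith
    show 0 ≤ s * (q x + ζ x - f x)
    rw [hqf x h1, add_sub_cancel_left]
    exact hsζ0 x
  · refine ⟨1 - χR x, ⟨by linarith [hχ1 (c • x)], by linarith [hχ0 (c • x)]⟩, ?_⟩
    have h1 : q x + ζ x - ((1 - (1 - χR x)) * f x + (1 - χR x) * B) = ζ x := by
      simp only [hq]; ring
    show 0 < s * (q x + ζ x - ((1 - (1 - χR x)) * f x + (1 - χR x) * B))
    rw [h1, hsζ]
    exact mul_pos hκ0 (hψpos _ fun h => hx (by rwa [← sub_eq_add_neg, sub_eq_zero] at h))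
  · have h1 : q x + ζ x - B = ζ x := by simp only [hq, hχRout x hx]; ring
    show 0 ≤ s * (q x + ζ x - B)
    rw [h1]
    exact hsζ0 x

/-- Subsolutions can be tested with strictly touching separated functions. -/
theorem AdmissibleOperator.subsolution_of_strictTouch (hJ : AdmissibleOperator γ J)
    {u : Space d → ℝ → ℝ}
    (hu : UpperSemicontinuousOn (fun p : Space d × ℝ => u p.1 p.2) (Set.univ ×ˢ Set.Icc 0 T))
    {η M : ℝ} (hη : 0 < η) (huη : ∀ x, ∀ t ∈ Set.Icc 0 T, η ≤ u x t)
    (huM : ∀ x, ∀ t ∈ Set.Icc 0 T, u x t ≤ M)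
    (h : ∀ x₀, ∀ t₀ ∈ Set.Ioc 0 T, ∀ (α : ℝ≥0) (p : Space d → ℝ) (A δ a : ℝ), γ < α → α < 1 →
      C1H α A p → 0 < δ → (∀ x, δ ≤ p x) → StrictTouch T u p a x₀ t₀ → a ≤ J p x₀) :
    IsViscositySubsolution γ J T u := by
  refine ⟨hu, ⟨η, hη, huη⟩, fun x₀ t₀ ht₀ r hr hrt φ φt hφ hle heq => ?_⟩
  obtain ⟨⟨β, hβ, hγβ, m, hm⟩, hd, hc⟩ := hφ
  have hmem : t₀ ∈ Set.Ioc (t₀ - r) t₀ := ⟨by linarith, le_rfl⟩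
  have hT : t₀ ∈ Set.Icc 0 T := ⟨ht₀.1.le, ht₀.2⟩
  by_contra! hlt
  obtain ⟨a, ha1, ha2⟩ := exists_between hlt
  have hMη : η ≤ M := (huη 0 t₀ hT).trans (huM 0 t₀ hT)
  -- The far value M + 1 leaves a uniform gap above u. The error allowed in J is a - J(φ), so a
  -- still exceeds J(p).
  obtain ⟨p, A', δ', ρ, R, hδ', hp, hpδ, hJp, hpx, hρ, h1, h2, h3⟩ :=
    hJ.exists_cutoff_profile (α := γ + β) le_self_add hγβ.le (hm t₀ hmem).toC1H hη
      (fun x => (huη x t₀ hT).trans (hle x t₀ hmem)) (B := M + 1) (by linarith) x₀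
      (sub_pos.2 ha1) (s := 1) (Or.inl rfl)
  have hst : StrictTouch T u p a x₀ t₀ := strictTouch_of_test (B := M + 1) hu one_pos
    (fun x t ht => by linarith [huM x t ht]) ht₀ hr hd hc hle heq ha2 hp.diff.continuous hpx hρ
    (fun x hx => by linarith [h1 x hx])
    (fun x hx => by
      obtain ⟨θ, hθ, h4⟩ := h2 x hx
      exact ⟨θ, hθ, by linarith⟩)
    (R := R) (fun x hx => by linarith [h3 x hx])
  have h4 := h x₀ t₀ ht₀ _ p A' δ' a (lt_add_of_pos_right γ hβ) hγβ hp hδ' hpδ hst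
  linarith [le_abs_self (J p x₀ - J (fun y => φ y t₀) x₀)]

/-- Supersolutions can be tested with strictly touching separated functions. -/
theorem AdmissibleOperator.supersolution_of_strictTouch (hJ : AdmissibleOperator γ J)
    {v : Space d → ℝ → ℝ}
    (hv : LowerSemicontinuousOn (fun p : Space d × ℝ => v p.1 p.2) (Set.univ ×ˢ Set.Icc 0 T))
    {η : ℝ} (hη : 0 < η) (hvη : ∀ x, ∀ t ∈ Set.Icc 0 T, η ≤ v x t)
    (h : ∀ x₀, ∀ t₀ ∈ Set.Ioc 0 T, ∀ (α : ℝ≥0) (p : Space d → ℝ) (A δ a : ℝ), γ < α → α < 1 →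
      C1H α A p → 0 < δ → (∀ x, δ ≤ p x) →
      StrictTouch T (fun x t => -v x t) (fun x => -p x) (-a) x₀ t₀ → J p x₀ ≤ a) :
    IsViscositySupersolution γ J T v := by
  refine ⟨hv, ⟨η, hη, hvη⟩, fun x₀ t₀ ht₀ r hr hrt φ φt hφ hpos hle heq => ?_⟩
  obtain ⟨⟨β, hβ, hγβ, m, hm⟩, hd, hc⟩ := hφ
  obtain ⟨η', hη', hφη⟩ := hpos
  have hmem : t₀ ∈ Set.Ioc (t₀ - r) t₀ := ⟨by linarith, le_rfl⟩
  by_contra! hlt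
  obtain ⟨a, ha1, ha2⟩ := exists_between hlt
  -- The far value η/2 lies uniformly below v and remains positive, so the modified profile stays in
  -- the domain of J.
  obtain ⟨p, A', δ', ρ, R, hδ', hp, hpδ, hJp, hpx, hρ, h1, h2, h3⟩ :=
    hJ.exists_cutoff_profile (α := γ + β) le_self_add hγβ.le (hm t₀ hmem).toC1H hη'
      (fun x => hφη x t₀ hmem) (B := η / 2) (by linarith) x₀
      (sub_pos.2 ha2) (s := -1) (Or.inr rfl)
  have hst : StrictTouch T (fun x t => -v x t) (fun x => -p x) (-a) x₀ t₀ :=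
    strictTouch_of_test (u := fun x t => -v x t) (φ := fun x t => -φ x t)
      (φt := fun x t => -φt x t) (upperSemicontinuousOn_neg hv) (κ₀ := η / 2) (B := -(η / 2))
      (by linarith) (fun x t ht => by linarith [hvη x t ht]) ht₀ hr
      (fun y s hs => (hd y s hs).neg) hc.neg (fun y s hs => neg_le_neg (hle y s hs))
      (neg_inj.2 heq) (neg_lt_neg ha1) hp.diff.continuous.neg (neg_inj.2 hpx) hρ
      (fun x hx => by linarith [h1 x hx])
      (fun x hx => by
        obtain ⟨θ, hθ, h4⟩ := h2 x hx
        exact ⟨θ, hθ, by linarith⟩)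
      (R := R) (fun x hx => by linarith [h3 x hx])
  have h4 := h x₀ t₀ ht₀ _ p A' δ' a (lt_add_of_pos_right γ hβ) hγβ hp hδ' hpδ hst
  linarith [neg_abs_le (J p x₀ - J (fun y => φ y t₀) x₀)]

end

/-! ### Perron's method: envelopes of families of subsolutions. -/

section

variable {d : ℕ} {γ : ℝ≥0} {J : (Space d → ℝ) → Space d → ℝ} {T : ℝ}

/-- The upper semicontinuous envelope of the supremum of a family of subsolutions is a
subsolution. -/
theorem AdmissibleOperator.subsolution_envelope (hJ : AdmissibleOperator γ J)
    {S : Set (Space d → ℝ → ℝ)} (hS : ∀ w ∈ S, IsViscositySubsolution γ J T w)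
    {u : Space d → ℝ → ℝ} (hwu : ∀ w ∈ S, ∀ x, ∀ t ∈ Set.Icc 0 T, w x t ≤ u x t)
    (happrox : ∀ x, ∀ t ∈ Set.Icc 0 T, ∀ b < u x t, ∃ w ∈ S, b < w x t) {η M : ℝ} (hη : 0 < η)
    (huη : ∀ x, ∀ t ∈ Set.Icc 0 T, η ≤ u x t) (huM : ∀ x, ∀ t ∈ Set.Icc 0 T, u x t ≤ M) :
    IsViscositySubsolution γ J T fun x t =>
      uscEnvelope (Set.univ ×ˢ Set.Icc 0 T) (fun q : Space d × ℝ => u q.1 q.2) (x, t) := by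
  set E : Set (Space d × ℝ) := Set.univ ×ˢ Set.Icc 0 T with hE
  set U : Space d → ℝ → ℝ := fun x t => uscEnvelope E (fun q : Space d × ℝ => u q.1 q.2) (x, t)
    with hU
  have hm : ∀ q ∈ E, η ≤ u q.1 q.2 := fun q hq => huη q.1 q.2 hq.2
  have hM : ∀ q ∈ E, u q.1 q.2 ≤ M := fun q hq => huM q.1 q.2 hq.2
  have huU : ∀ x, ∀ t ∈ Set.Icc 0 T, u x t ≤ U x t := fun x t ht =>
    le_uscEnvelope (f := fun q : Space d × ℝ => u q.1 q.2) hM (x := (x, t)) ⟨Set.mem_univ _, ht⟩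
  have husc : UpperSemicontinuousOn (fun q : Space d × ℝ => U q.1 q.2) E :=
    upperSemicontinuousOn_uscEnvelope hm hM
  refine hJ.subsolution_of_strictTouch husc hη (fun x t ht => (huη x t ht).trans (huU x t ht))
    (fun x t ht => uscEnvelope_le_of_le hm hM (x := (x, t)) ⟨Set.mem_univ _, ht⟩)
    fun x₀ t₀ ht₀ α p A δ a hγα hα hp hδ hpδ hst => ?_
  by_contra! hlt
  have hT : t₀ ∈ Set.Icc 0 T := ⟨ht₀.1.le, ht₀.2⟩
  have hmem : (x₀, t₀) ∈ E := ⟨Set.mem_univ _, hT⟩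
  obtain ⟨ρ₁, hρ₁, s₁, hs₁, -, hnear⟩ := hJ.exists_near hδ (hp.exp_mono hγα.le) hpδ x₀
    (sub_pos.2 hlt)
  have hpc := hp.diff.continuous
  obtain ⟨ρ₂, hρ₂, hpρ⟩ := Metric.continuous_iff.1 hpc x₀ (s₁ / 4) (by positivity)
  obtain ⟨ρ₃, hρ₃, hUρ⟩ := Metric.mem_nhdsWithin_iff.1
    (husc (x₀, t₀) hmem (U x₀ t₀ + s₁ / 4) (by linarith))
  set ρ := min (min ρ₁ ρ₂) ρ₃ / 2 with hρ
  have hρ0 : 0 < ρ := by positivity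
  have hmin : min (min ρ₁ ρ₂) ρ₃ = 2 * ρ := by rw [hρ]; ring
  have hρ₁' : ρ < ρ₁ := by
    linarith [(min_le_left (min ρ₁ ρ₂) ρ₃).trans (min_le_left _ _)]
  have hρ₂' : ρ < ρ₂ := by
    linarith [(min_le_left (min ρ₁ ρ₂) ρ₃).trans (min_le_right _ _)]
  have hρ₃' : ρ < ρ₃ := by linarith [min_le_right (min ρ₁ ρ₂) ρ₃]
  obtain ⟨e, he, σ₁, hσ₁, hpast⟩ := hst.past
  obtain ⟨σ₂, hσ₂, κ₁, hκ₁, haway⟩ := hst.away ρ hρ0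
  obtain ⟨σ, hσ, hσ1, hσ2, hσ3, hσa, hσt⟩ : ∃ σ > 0, σ ≤ σ₁ ∧ σ ≤ σ₂ ∧ σ < ρ₃ ∧
      |a| * σ ≤ s₁ / 4 ∧ σ < t₀ := by
    have h0 := ht₀.1
    refine ⟨min (min σ₁ σ₂) (min (ρ₃ / 2) (min (s₁ / (4 * (|a| + 1))) (t₀ / 2))), by positivity,
      (min_le_left _ _).trans (min_le_left _ _), (min_le_left _ _).trans (min_le_right _ _),
      ((min_le_right _ _).trans (min_le_left _ _)).trans_lt (by linarith), ?_,
      (((min_le_right _ _).trans (min_le_right _ _)).trans (min_le_right _ _)).trans_lt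
        (by linarith)⟩
    have h1 : min (min σ₁ σ₂) (min (ρ₃ / 2) (min (s₁ / (4 * (|a| + 1))) (t₀ / 2)))
        ≤ s₁ / (4 * (|a| + 1)) :=
      ((min_le_right _ _).trans (min_le_right _ _)).trans (min_le_left _ _)
    have h2 : 0 < min (min σ₁ σ₂) (min (ρ₃ / 2) (min (s₁ / (4 * (|a| + 1))) (t₀ / 2))) := by
      positivity
    rw [le_div_iff₀ (by positivity)] at h1
    linarith
  set κ := min (min κ₁ (e * σ)) s₁ with hκ
  have hκ0 : 0 < κ := by positivity
  have hκ1 : κ ≤ κ₁ := (min_le_left _ _).trans (min_le_left _ _)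
  have hκ2 : κ ≤ e * σ := (min_le_left _ _).trans (min_le_right _ _)
  have hκ3 : κ ≤ s₁ := min_le_right _ _
  obtain ⟨⟨x₁, t₁⟩, hbig, hx₁, ht₁, hG, ht₁T⟩ : ∃ q : Space d × ℝ, U x₀ t₀ - κ / 4 < u q.1 q.2 ∧
      dist q.1 x₀ < ρ ∧ |q.2 - t₀| < σ ∧ p q.1 + a * (q.2 - t₀) < p x₀ + κ / 4 ∧
      q.2 ∈ Set.Icc 0 T := by
    have h1 := frequently_lt_of_lt_uscEnvelope (f := fun q : Space d × ℝ => u q.1 q.2) hm hmem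
      (a := U x₀ t₀ - κ / 4) (by simp only [hU]; linarith)
    have h2 : ∀ᶠ q : Space d × ℝ in 𝓝[E] (x₀, t₀), dist q.1 x₀ < ρ ∧ |q.2 - t₀| < σ ∧
        p q.1 + a * (q.2 - t₀) < p x₀ + κ / 4 := by
      refine nhdsWithin_le_nhds (Filter.Eventually.and ?_ (Filter.Eventually.and ?_ ?_))
      · exact (continuous_fst.tendsto (x₀, t₀)).eventually (Metric.ball_mem_nhds x₀ hρ0)
      · exact (continuous_snd.tendsto (x₀, t₀)).eventually (Metric.ball_mem_nhds t₀ hσ)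
      · have h3 : Continuous fun q : Space d × ℝ => p q.1 + a * (q.2 - t₀) := by fun_prop
        refine (h3.tendsto (x₀, t₀)).eventually (gt_mem_nhds ?_)
        simp; linarith
    obtain ⟨q, hq1, hq2, hq3⟩ := (h1.and_eventually (h2.and self_mem_nhdsWithin)).exists
    exact ⟨q, hq1, hq2.1, hq2.2.1, hq2.2.2, hq3.2⟩
  obtain ⟨w, hw, hwbig⟩ := happrox x₁ t₁ ht₁T _ hbig
  have hwU : ∀ x, ∀ t ∈ Set.Icc 0 T, w x t ≤ U x t := fun x t ht =>
    (hwu w hw x t ht).trans (huU x t ht)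
  have hIT : ∀ t ∈ Set.Icc (t₀ - σ) (min (t₀ + σ) T), t ∈ Set.Icc 0 T ∧ |t - t₀| ≤ σ := by
    intro t ht
    have h1 := ht.2.trans (min_le_left _ _)
    refine ⟨⟨by linarith [ht.1], ht.2.trans (min_le_right _ _)⟩, ?_⟩
    rw [abs_le]; constructor <;> linarith [ht.1]
  have ht₁' : t₁ ∈ Set.Icc (t₀ - σ) (min (t₀ + σ) T) := by
    have := abs_lt.1 ht₁
    exact ⟨by linarith, le_min (by linarith) ht₁T.2⟩
  -- The near-maximizing member w may touch slightly after t₀, so the time window reaches past t₀. A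
  -- maximum at its upper end is harmless, as tests involve only earlier times.
  obtain ⟨⟨x', t'⟩, ⟨hx', ht'⟩, hmax⟩ := UpperSemicontinuousOn.exists_isMaxOn
    (s := Metric.closedBall x₀ ρ ×ˢ Set.Icc (t₀ - σ) (min (t₀ + σ) T))
    (f := fun q : Space d × ℝ => w q.1 q.2 + -(p q.1 + a * (q.2 - t₀)))
    ⟨(x₁, t₁), ⟨Metric.mem_closedBall.2 hx₁.le, ht₁'⟩⟩
    ((isCompact_closedBall x₀ ρ).prod isCompact_Icc)
    (((hS w hw).usc.mono fun q hq => ⟨Set.mem_univ _, (hIT _ hq.2).1⟩).add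
      (Continuous.continuousOn (by fun_prop)).upperSemicontinuousOn)
  simp only at hx' ht'
  set c := w x' t' + -(p x' + a * (t' - t₀)) with hc
  have hmax' : ∀ x ∈ Metric.closedBall x₀ ρ, ∀ t ∈ Set.Icc (t₀ - σ) (min (t₀ + σ) T),
      w x t + -(p x + a * (t - t₀)) ≤ c := fun x hx t ht => hmax (a := (x, t)) ⟨hx, ht⟩
  have hcontact : U x₀ t₀ = p x₀ := hst.contact
  have hcκ : -κ / 2 < c := by
    have := hmax' x₁ (Metric.mem_closedBall.2 hx₁.le) t₁ ht₁'
    simp only at hG hwbig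
    linarith
  have hglob : ∀ x, ∀ t ∈ Set.Icc (t₀ - σ) (min (t₀ + σ) T), w x t ≤ p x + (a * t + (c - a * t₀)) := by
    intro x t ht
    by_cases hx : x ∈ Metric.closedBall x₀ ρ
    · linarith [hmax' x hx t ht]
    · rw [Metric.mem_closedBall, not_le] at hx
      obtain ⟨h1, h2⟩ := hIT t ht
      linarith [haway x hx.le t h1 (h2.trans hσ2), hwU x t h1]
  obtain ⟨ht'T, ht'σ⟩ := hIT t' ht'
  -- At the lower end of the window the past slack eσ ≥ κ would give c ≤ -κ, against c > -κ/2.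
  have ht'lt : t₀ - σ < t' := by
    rcases ht'.1.eq_or_lt with h | h
    · exfalso
      have h1 := hpast x' t' ht'T (by linarith) (by linarith)
      have h2 := hwU x' t' ht'T
      have h3 : t₀ - t' = σ := by linarith
      rw [h3] at h1
      linarith
    · exact h
  obtain ⟨β, hβ, hγβ⟩ : ∃ β : ℝ≥0, 0 < β ∧ γ + β = α :=
    ⟨α - γ, tsub_pos_of_lt hγα, add_tsub_cancel_of_le hγα.le⟩
  have htest := (hS w hw).test x' t' ⟨by linarith, ht'T.2⟩ (t' - (t₀ - σ)) (by linarith)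
    (by linarith) _ _
    (isTestFunction_separated hβ (by rw [hγβ]; exact hα) (by rw [hγβ]; exact hp) a (c - a * t₀))
    (fun y s hs => hglob y s ⟨by linarith [hs.1], hs.2.trans ht'.2⟩)
    (by rw [hc]; ring)
  have hx'ρ := Metric.mem_closedBall.1 hx'
  have h1 := hpρ x' (by linarith)
  rw [Real.dist_eq] at h1
  have h2 : U x' t' < U x₀ t₀ + s₁ / 4 := hUρ (a := (x', t')) ⟨by
    rw [Metric.mem_ball, Prod.dist_eq, max_lt_iff, Real.dist_eq]
    exact ⟨by linarith, by linarith⟩, Set.mem_univ _, ht'T⟩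
  have h3 : |a * (t' - t₀)| ≤ s₁ / 4 := by
    rw [abs_mul]
    exact (mul_le_mul_of_nonneg_left ht'σ (abs_nonneg a)).trans hσa
  have h4 := hnear x' (by linarith) (a * t' + (c - a * t₀)) (by
    rw [abs_le]
    constructor
    · linarith [neg_abs_le (a * (t' - t₀))]
    · linarith [hwU x' t' ht'T, neg_abs_le (p x' - p x₀)])
  linarith [le_abs_self (J (fun y => p y + (a * t' + (c - a * t₀))) x' - J p x₀)]

/-- The lower semicontinuous envelope of a maximal subsolution is a supersolution. -/
theorem AdmissibleOperator.supersolution_envelope (hJ : AdmissibleOperator γ J)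
    {f₀ : Space d → ℝ} {u : Space d → ℝ → ℝ} (hu : IsViscositySubsolution γ J T u) {η M : ℝ}
    (hη : 0 < η) (huη : ∀ x, ∀ t ∈ Set.Icc 0 T, η ≤ u x t)
    (huM : ∀ x, ∀ t ∈ Set.Icc 0 T, u x t ≤ M) (hu0 : ∀ x, u x 0 ≤ f₀ x)
    (hmaxl : ∀ w : Space d → ℝ → ℝ, IsViscositySubsolution γ J T w →
      (∃ M', ∀ x, ∀ t ∈ Set.Icc 0 T, w x t ≤ M') → (∀ x, w x 0 ≤ f₀ x) →
      ∀ x, ∀ t ∈ Set.Icc 0 T, w x t ≤ u x t) :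
    IsViscositySupersolution γ J T fun x t =>
      -uscEnvelope (Set.univ ×ˢ Set.Icc 0 T) (fun q : Space d × ℝ => -u q.1 q.2) (x, t) := by
  set E : Set (Space d × ℝ) := Set.univ ×ˢ Set.Icc 0 T with hE
  set V : Space d → ℝ → ℝ := fun x t => uscEnvelope E (fun q : Space d × ℝ => -u q.1 q.2) (x, t)
    with hV
  have hm : ∀ q ∈ E, -M ≤ -u q.1 q.2 := fun q hq => neg_le_neg (huM q.1 q.2 hq.2)
  have hM : ∀ q ∈ E, -u q.1 q.2 ≤ -η := fun q hq => neg_le_neg (huη q.1 q.2 hq.2)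
  have huV : ∀ x, ∀ t ∈ Set.Icc 0 T, -V x t ≤ u x t := fun x t ht =>
    neg_le.1 (le_uscEnvelope (f := fun q : Space d × ℝ => -u q.1 q.2) hM (x := (x, t))
      ⟨Set.mem_univ _, ht⟩)
  refine hJ.supersolution_of_strictTouch
    (lowerSemicontinuousOn_neg (upperSemicontinuousOn_uscEnvelope hm hM)) hη
    (fun x t ht => le_neg.1 (uscEnvelope_le_of_le hm hM (x := (x, t)) ⟨Set.mem_univ _, ht⟩))
    fun x₀ t₀ ht₀ α p A δ a hγα hα hp hδ hpδ hst => ?_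
  by_contra! hlt
  have hT : t₀ ∈ Set.Icc 0 T := ⟨ht₀.1.le, ht₀.2⟩
  have hmem : (x₀, t₀) ∈ E := ⟨Set.mem_univ _, hT⟩
  have hpγ := hp.exp_mono hγα.le
  obtain ⟨ρ, hρ, s₁, hs₁, hs₁δ, hnear⟩ := hJ.exists_near hδ hpγ hpδ x₀ (sub_pos.2 hlt)
  have hpc := hp.diff.continuous
  obtain ⟨e, he, σ₁, hσ₁, hpast⟩ := hst.past
  obtain ⟨σ₂, hσ₂, κ₁, hκ₁, haway⟩ := hst.away ρ hρ
  obtain ⟨σ, hσ, hσ1, hσ2, hσa, hσt⟩ : ∃ σ > 0, σ ≤ σ₁ ∧ σ ≤ σ₂ ∧ |a| * σ ≤ s₁ / 2 ∧ σ < t₀ := by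
    have h0 := ht₀.1
    refine ⟨min (min σ₁ σ₂) (min (s₁ / (2 * (|a| + 1))) (t₀ / 2)), by positivity,
      (min_le_left _ _).trans (min_le_left _ _), (min_le_left _ _).trans (min_le_right _ _), ?_,
      ((min_le_right _ _).trans (min_le_right _ _)).trans_lt (by linarith)⟩
    have h1 : min (min σ₁ σ₂) (min (s₁ / (2 * (|a| + 1))) (t₀ / 2)) ≤ s₁ / (2 * (|a| + 1)) :=
      (min_le_right _ _).trans (min_le_left _ _)
    have h2 : 0 < min (min σ₁ σ₂) (min (s₁ / (2 * (|a| + 1))) (t₀ / 2)) := by positivity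
    rw [le_div_iff₀ (by positivity)] at h1
    linarith
  set κ := min (min κ₁ (e * σ)) (s₁ / 2) with hκ
  have hκ0 : 0 < κ := by positivity
  have hκ1 : κ ≤ κ₁ := (min_le_left _ _).trans (min_le_left _ _)
  have hκ2 : κ ≤ e * σ := (min_le_left _ _).trans (min_le_right _ _)
  have hκ3 : κ ≤ s₁ / 2 := min_le_right _ _
  set Φ : Space d → ℝ → ℝ := fun x t => p x + (κ + a * (t - t₀)) with hΦ
  have hs : ∀ t, |t - t₀| ≤ σ → |κ + a * (t - t₀)| ≤ s₁ := fun t ht => by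
    refine (abs_add_le _ _).trans ?_
    rw [abs_mul, abs_of_pos hκ0]
    linarith [mul_le_mul_of_nonneg_left ht (abs_nonneg a)]
  classical
  -- The bump can exceed u only for x near x₀ and t > t₀ - σ. At time t₀ + σ it is switched off
  -- abruptly: the closed window keeps w upper semicontinuous, and later behaviour does not affect
  -- the tests.
  set w : Space d → ℝ → ℝ := fun x t => if |t - t₀| ≤ σ then max (u x t) (Φ x t) else u x t with hw
  have huw : ∀ x t, u x t ≤ w x t := fun x t => by
    simp only [hw]; split_ifs
    · exact le_max_left _ _
    · exact le_rfl
  have hΦw : ∀ x t, |t - t₀| ≤ σ → Φ x t ≤ w x t := fun x t ht => by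
    simp only [hw, if_pos ht]; exact le_max_right _ _
  have hΦc : Continuous fun q : Space d × ℝ => Φ q.1 q.2 := by
    simp only [hΦ]; fun_prop
  have hwusc : UpperSemicontinuousOn (fun q : Space d × ℝ => w q.1 q.2) E := by
    rintro ⟨x, t⟩ hq b hb
    have hub := hu.usc (x, t) hq b ((huw x t).trans_lt hb)
    by_cases ht : |t - t₀| ≤ σ
    · have h1 : Φ x t < b := (hΦw x t ht).trans_lt hb
      filter_upwards [hub, nhdsWithin_le_nhds ((hΦc.tendsto (x, t)).eventually (gt_mem_nhds h1))]
        with q hq1 hq2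
      simp only [hw]; split_ifs
      · exact max_lt hq1 hq2
      · exact hq1
    · have h1 : Continuous fun q : Space d × ℝ => |q.2 - t₀| := by fun_prop
      filter_upwards [hub, nhdsWithin_le_nhds ((h1.tendsto (x, t)).eventually
        (lt_mem_nhds (not_le.1 ht)))] with q hq1 hq2
      simp only [hw, if_neg (not_le.2 hq2)]
      exact hq1
  have hwsub : IsViscositySubsolution γ J T w := by
    refine ⟨hwusc, ⟨η, hη, fun x t ht => (huη x t ht).trans (huw x t)⟩,
      fun x t ht r hr hrt ξ ξt hξ hle heq => ?_⟩
    have htT : t ∈ Set.Icc 0 T := ⟨ht.1.le, ht.2⟩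
    rcases (huw x t).eq_or_lt with h | h
    · exact hu.test x t ht r hr hrt ξ ξt hξ (fun y s hs => (huw y s).trans (hle y s hs))
        (h.trans heq)
    · have htσ : |t - t₀| ≤ σ := by
        by_contra hcon
        simp only [hw, if_neg hcon] at h
        exact lt_irrefl _ h
      have hwΦ : w x t = Φ x t := by
        simp only [hw, if_pos htσ] at h ⊢
        exact max_eq_right (le_of_not_ge fun hcon => by rw [max_eq_left hcon] at h; exact h.false)
      have hVlt : -V x t < Φ x t := by linarith [huV x t htT]
      have hx : dist x x₀ < ρ := by
        by_contra hcon
        have h1 := haway x (not_lt.1 hcon) t htT (htσ.trans hσ2)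
        simp only [hΦ] at hVlt
        linarith
      have htlow : t₀ - σ < t := by
        by_contra hcon
        have h0 := (abs_le.1 htσ).1
        have h1 := hpast x t htT (by linarith) (by linarith)
        have h2 : t₀ - t = σ := by linarith
        rw [h2] at h1
        simp only [hΦ] at hVlt
        linarith
      obtain ⟨⟨β, hβ, hγβ, m, hm'⟩, hd, -⟩ := hξ
      have hsub : Set.Ioc (max (t - r) (t₀ - σ)) t ⊆ Set.Ioc (t - r) t := fun s hs =>
        ⟨(le_max_left _ _).trans_lt hs.1, hs.2⟩
      have hmemt : t ∈ Set.Ioc (t - r) t := ⟨by linarith, le_rfl⟩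
      have hder : ξt x t ≤ a := by
        refine left_deriv_le_of_touching (f := fun s => Φ x s) (g := ξ x)
          (max_lt (by linarith) htlow) ?_ ((hd x t hmemt).mono hsub) (fun s hs => ?_)
          (hwΦ.symm.trans heq)
        · have := ((((hasDerivAt_id t).sub_const t₀).const_mul a).const_add κ).const_add (p x)
          rw [mul_one] at this
          exact this.hasDerivWithinAt
        · refine (hΦw x s ?_).trans (hle x s (hsub hs))
          have h1 := (le_max_right _ _).trans_lt hs.1
          rw [abs_le]
          exact ⟨by linarith, by linarith [hs.2, (abs_le.1 htσ).2]⟩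
      have hstep := hs t htσ
      have h1 := hnear x hx _ hstep
      -- Where the bump is active, the test function lies above it and touches it, so the global
      -- comparison property transfers the strict inequality J(bump) > a to the test function.
      have h2 : J (fun y => p y + (κ + a * (t - t₀))) x ≤ J (fun y => ξ y t) x := by
        refine hJ.gcp _ ((hpγ.add_const _).mem_domainK hJ.exponent_le_one (half_pos hδ)
          fun y => ?_) _ ((C1H.of_test (hm' t hmemt)).mem_domainK hJ.exponent_le_one hη
          fun y => ?_) (fun y => ?_) x ?_
        · linarith [hpδ y, neg_abs_le (κ + a * (t - t₀))]
        · exact (huη y t htT).trans ((huw y t).trans (hle y t hmemt))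
        · exact (hΦw y t htσ).trans (hle y t hmemt)
        · exact hwΦ.symm.trans heq
      linarith [neg_abs_le (J (fun y => p y + (κ + a * (t - t₀))) x - J p x₀)]
  have hwu := hmaxl w hwsub ⟨max M (A + s₁), fun x t ht => by
      simp only [hw]; split_ifs with h
      · refine max_le_max (huM x t ht) ?_
        simp only [hΦ]
        linarith [hp.bdd x, le_abs_self (p x), hs t h, le_abs_self (κ + a * (t - t₀))]
      · exact (huM x t ht).trans (le_max_left _ _)⟩
    (fun x => by
      have h : ¬|0 - t₀| ≤ σ := by
        rw [zero_sub, abs_neg, abs_of_pos ht₀.1]; linarith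
      simp only [hw, if_neg h]
      exact hu0 x)
  have hcontact : -(-V x₀ t₀) = -p x₀ := hst.contact
  rw [neg_neg] at hcontact
  have h1 := frequently_lt_of_lt_uscEnvelope (f := fun q : Space d × ℝ => -u q.1 q.2) hm hmem
    (a := V x₀ t₀ - κ / 2) (by simp only [hV]; linarith)
  have h2 : ∀ᶠ q : Space d × ℝ in 𝓝[E] (x₀, t₀), |q.2 - t₀| < σ ∧ p x₀ + κ / 2 < Φ q.1 q.2 := by
    refine nhdsWithin_le_nhds (Filter.Eventually.and ?_ ?_)
    · exact (continuous_snd.tendsto (x₀, t₀)).eventually (Metric.ball_mem_nhds t₀ hσ)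
    · refine (hΦc.tendsto (x₀, t₀)).eventually (lt_mem_nhds ?_)
      simp only [hΦ, sub_self, mul_zero]
      linarith
  obtain ⟨q, hq1, hq2, hq3⟩ := (h1.and_eventually (h2.and self_mem_nhdsWithin)).exists
  have h3 := hwu q.1 q.2 hq3.2
  have h4 := hΦw q.1 q.2 hq2.1.le
  linarith [hq2.2]

end

/-! ### Global barriers, uniqueness and existence. -/

section

variable {d : ℕ} {γ : ℝ≥0} {J : (Space d → ℝ) → Space d → ℝ} {T : ℝ}

/-- The upper barrier growing linearly in time. -/
theorem AdmissibleOperator.supersolution_cap (hJ : AdmissibleOperator γ J) {M : ℝ} (hM : 0 < M) :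
    IsViscositySupersolution γ J T fun _ t => M + |J (fun _ => M) 0| * t := by
  set K := |J (fun _ => M) 0| with hK
  have hK0 : 0 ≤ K := abs_nonneg _
  refine ⟨(Continuous.continuousOn (by fun_prop)).lowerSemicontinuousOn,
    ⟨M, hM, fun x t ht => by linarith [mul_nonneg hK0 ht.1]⟩,
    fun x t ht r hr hrt φ φt hφ hpos hle heq => ?_⟩
  obtain ⟨⟨β, hβ, hγβ, m, hm⟩, hd, -⟩ := hφ
  obtain ⟨η, hη, hφη⟩ := hpos
  have hmem : t ∈ Set.Ioc (t - r) t := ⟨by linarith, le_rfl⟩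
  have hder : K ≤ φt x t := by
    refine left_deriv_le_of_touching (f := φ x) (g := fun s => M + K * s) (by linarith)
      (hd x t hmem) ?_ (fun s hs => hle x s hs) heq.symm
    have := ((hasDerivAt_id t).const_mul K).const_add M
    rw [mul_one] at this
    exact this.hasDerivWithinAt
  have hKt : 0 ≤ K * t := mul_nonneg hK0 ht.1.le
  have hγ := hJ.exponent_le_one
  have h1 : J (fun y => φ y t) x ≤ J (fun _ => M + K * t) x :=
    hJ.gcp _ ((C1H.of_test (hm t hmem)).mem_domainK hγ hη fun y => hφη y t hmem) _
      (const_mem_domainK hγ (by linarith)) (fun y => hle y t hmem) x heq.symm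
  have h2 := hJ.le_add_const (const_mem_domainK (d := d) hγ hM) hKt x
  rw [hJ.apply_const_eq hM] at h2
  linarith [le_abs_self (J (fun _ => M) 0)]

/-- The lower barriers built on the spatially constant flow. -/
theorem AdmissibleOperator.exists_subsolution_barrier (hJ : AdmissibleOperator γ J)
    {c c' : ℝ → ℝ} {m Mc : ℝ} (hm : 0 < m) (hcm : ∀ t ∈ Set.Icc 0 T, m ≤ c t)
    (hcM : ∀ t ∈ Set.Icc 0 T, c t ≤ Mc)
    (hc : ∀ t ∈ Set.Icc 0 T, HasDerivWithinAt c (c' t) (Set.Icc 0 T) t ∧ c' t ≤ J (fun _ => c t) 0)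
    {Aψ : ℝ} {ψ : Space d → ℝ} (hψ : C1H 1 Aψ ψ) (hψ0 : ∀ x, 0 ≤ ψ x) :
    ∃ w : Space d → ℝ → ℝ, IsViscositySubsolution γ J T w ∧ (∀ x, w x 0 = c 0 + ψ x) ∧
      (∀ x, ∀ t ∈ Set.Icc 0 T, c t ≤ w x t) ∧ (∀ x, ∀ t ∈ Set.Icc 0 T, w x t ≤ Mc + Aψ) ∧
      ContinuousOn (fun q : Space d × ℝ => w q.1 q.2) (Set.univ ×ˢ Set.Icc 0 T) := by
  have hγ := hJ.exponent_le_one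
  have hAψ := hψ.nonneg
  obtain ⟨L, hL0, hL⟩ := hJ.exists_lipschitz (half_pos hm) (2 * (m + (m + Aψ) + |Mc|))
  set κ := m / 2 with hκ
  have hκ0 : 0 < κ := half_pos hm
  -- The bump decays at rate C(κ + ψ) ≥ Cκ even where ψ = 0, and Cκ exceeds the Lipschitz cost of
  -- passing from J(c(t)) to J(g).
  set C := (L * (2 * (2 * κ + Aψ)) + 1) / κ with hC
  have hC0 : 0 < C := by positivity
  have hCκ : C * κ = L * (2 * (2 * κ + Aψ)) + 1 := by rw [hC]; field_simp
  set g : Space d → ℝ → ℝ := fun x t => c t - κ + (1 - C * t) * (κ + ψ x) with hg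
  have hcc : ContinuousOn c (Set.Icc 0 T) := fun t ht => (hc t ht).1.continuousWithinAt
  have hcc' : ContinuousOn (fun q : Space d × ℝ => c q.2) (Set.univ ×ˢ Set.Icc 0 T) :=
    hcc.comp continuousOn_snd fun q hq => hq.2
  have hψc := hψ.diff.continuous
  have hgc : ContinuousOn (fun q : Space d × ℝ => g q.1 q.2) (Set.univ ×ˢ Set.Icc 0 T) :=
    (hcc'.sub continuousOn_const).add (Continuous.continuousOn (by fun_prop))
  have hwc : ContinuousOn (fun q : Space d × ℝ => max (c q.2) (g q.1 q.2))
      (Set.univ ×ˢ Set.Icc 0 T) := hcc'.sup hgc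
  have hmemξ : ∀ {t : ℝ} {ξ : Space d → ℝ → ℝ} {β : ℝ≥0} {m' : ℝ}, t ∈ Set.Icc 0 T →
      C1Bound (γ + β) m' (fun y => ξ y t) → (∀ y, max (c t) (g y t) ≤ ξ y t) →
      (fun y => ξ y t) ∈ domainK d γ := fun ht hb hle =>
    (C1H.of_test hb).mem_domainK hγ hm fun y =>
      (hcm _ ht).trans ((le_max_left _ _).trans (hle y))
  refine ⟨fun x t => max (c t) (g x t), ⟨hwc.upperSemicontinuousOn, ⟨m, hm, fun x t ht =>
    (hcm t ht).trans (le_max_left _ _)⟩, ?_⟩, fun x => ?_, fun x t ht => le_max_left _ _,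
    fun x t ht => max_le ?_ ?_, hwc⟩
  · intro x t ht r hr hrt ξ ξt hξ hle heq
    obtain ⟨⟨β, hβ, hγβ, m', hm'⟩, hd, -⟩ := hξ
    have htT : t ∈ Set.Icc 0 T := ⟨ht.1.le, ht.2⟩
    have hmem : t ∈ Set.Ioc (t - r) t := ⟨by linarith, le_rfl⟩
    have hsub : Set.Ioc (t - r) t ⊆ Set.Icc 0 T := fun s hs => ⟨by linarith [hs.1], hs.2.trans ht.2⟩
    have hdc : HasDerivWithinAt c (c' t) (Set.Ioc (t - r) t) t := (hc t htT).1.mono hsub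
    have hct : 0 < c t := hm.trans_le (hcm t htT)
    have hJc := (hc t htT).2
    rw [← hJ.apply_const_eq hct x] at hJc
    have hξmem := hmemξ htT (hm' t hmem) fun y => hle y t hmem
    rcases le_total (g x t) (c t) with h | h
    · rw [max_eq_left h] at heq
      have h1 : ξt x t ≤ c' t := left_deriv_le_of_touching (f := c) (g := ξ x) (by linarith) hdc
        (hd x t hmem) (fun s hs => (le_max_left _ _).trans (hle x s hs)) heq
      have h2 := hJ.gcp _ (const_mem_domainK hγ hct) _ hξmem
        (fun y => (le_max_left _ _).trans (hle y t hmem)) x heq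
      linarith
    · rw [max_eq_right h] at heq
      have hψx := hψ0 x
      have hCt : 0 ≤ C * t := mul_nonneg hC0.le ht.1.le
      -- A contact with the second branch means g ≥ c at that point, which is impossible once 1 - C
      -- t is negative. Hence g ≥ c - κ ≥ m/2 everywhere at that time.
      have hb0 : 0 ≤ 1 - C * t := by
        by_contra hneg
        have : (1 - C * t) * (κ + ψ x) ≤ 0 :=
          mul_nonpos_of_nonpos_of_nonneg (not_le.1 hneg).le (by linarith)
        simp only [hg] at h
        linarith
      have hdg : HasDerivWithinAt (fun s => g x s) (c' t - C * (κ + ψ x)) (Set.Ioc (t - r) t) t := by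
        have h1 := ((((hasDerivAt_id t).const_mul C).const_sub 1).mul_const
          (κ + ψ x)).hasDerivWithinAt (s := Set.Ioc (t - r) t)
        have h2 := (hdc.sub_const κ).add h1
        have he : c' t - C * (κ + ψ x) = c' t + -(C * 1) * (κ + ψ x) := by ring
        rw [he]
        exact h2
      have h1 : ξt x t ≤ c' t - C * (κ + ψ x) := left_deriv_le_of_touching (f := fun s => g x s)
        (g := ξ x) (by linarith) hdg (hd x t hmem)
        (fun s hs => (le_max_right _ _).trans (hle x s hs)) heq
      have hdiff : C1H 1 (2 * κ + Aψ) (fun y => g y t - c t) := by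
        have h2 := ((((C1H.const (d := d) (α := 1) κ).add hψ)).const_mul (1 - C * t)).add_const (-κ)
        have h3 : (fun y => g y t - c t) = fun y => (1 - C * t) * (κ + ψ y) + -κ := by
          funext y; simp only [hg]; ring
        rw [h3]
        refine h2.mono ?_
        rw [abs_of_nonneg hb0, abs_neg, abs_of_pos hκ0]
        nlinarith [mul_nonneg hCt (add_nonneg hκ0.le hAψ)]
      have hgb : C1H 1 (m + (m + Aψ) + |Mc|) (fun y => g y t) := by
        have h2 := hdiff.add_const (c t)
        simp only [sub_add_cancel] at h2
        refine h2.mono ?_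
        rw [abs_of_pos hct]
        linarith [hcM t htT, le_abs_self Mc]
      have hgm : ∀ y, m / 2 ≤ g y t := fun y => by
        have := mul_nonneg hb0 (add_nonneg hκ0.le (hψ0 y))
        simp only [hg]
        linarith [hcm t htT]
      have h2 := hL (fun y => g y t) (fun _ => c t) (hgb.exp_mono hγ) hgm
        ((C1H.const (c t)).mono (by
          rw [abs_of_pos hct]
          linarith [hcM t htT, le_abs_self Mc, abs_nonneg Mc]))
        (fun _ => by linarith [hcm t htT]) (2 * (2 * κ + Aψ)) (hdiff.exp_mono hγ) x
      have h3 := hJ.gcp _ ((hgb.exp_mono hγ).mem_domainK hγ (half_pos hm) hgm) _ hξmem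
        (fun y => (le_max_right _ _).trans (hle y t hmem)) x heq
      have h4 := mul_nonneg hC0.le hψx
      linarith [neg_abs_le (J (fun y => g y t) x - J (fun _ => c t) x)]
  · have : g x 0 = c 0 + ψ x := by simp only [hg]; ring
    show max (c 0) (g x 0) = c 0 + ψ x
    rw [this, max_eq_right]
    linarith [hψ0 x]
  · linarith [hcM t ht]
  · have h1 := hψ0 x
    have h2 := (le_abs_self _).trans (hψ.bdd x)
    have h3 := mul_nonneg (mul_nonneg hC0.le ht.1) (add_nonneg hκ0.le h1)
    simp only [hg]
    linarith [hcM t ht]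

theorem IsViscositySupersolution.congr {v v' : Space d → ℝ → ℝ}
    (hv : IsViscositySupersolution γ J T v) (h : ∀ x, ∀ t ∈ Set.Icc 0 T, v x t = v' x t) :
    IsViscositySupersolution γ J T v' := by
  obtain ⟨η, hη, hvη⟩ := hv.inf_pos
  refine ⟨fun q hq b hb => ?_, ⟨η, hη, fun x t ht => h x t ht ▸ hvη x t ht⟩,
    fun x t ht r hr hrt φ φt hφ hpos hle heq => ?_⟩
  · have hb' : b < v q.1 q.2 := by rw [h q.1 q.2 hq.2]; exact hb
    filter_upwards [hv.lsc q hq b hb', self_mem_nhdsWithin] with q' hq' hE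
    rw [← h q'.1 q'.2 hE.2]
    exact hq'
  · refine hv.test x t ht r hr hrt φ φt hφ hpos (fun y s hs => ?_) ?_
    · rw [h y s ⟨by linarith [hs.1], hs.2.trans ht.2⟩]
      exact hle y s hs
    · rw [h x t ⟨ht.1.le, ht.2⟩]
      exact heq

theorem AdmissibleOperator.unique (hJ : AdmissibleOperator γ J) (hT : 0 < T) {δ M : ℝ} (hδ : 0 < δ)
    {f₀ : Space d → ℝ} (huc : UniformContinuous f₀) (hM : ∀ x, f₀ x ≤ M) (hf₀ : ∀ x, δ ≤ f₀ x)
    {f g : Space d → ℝ → ℝ} (hf : IsCauchySolution γ J T f₀ f) (hg : IsCauchySolution γ J T f₀ g) :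
    ∀ x, ∀ t ∈ Set.Icc 0 T, f x t ≤ g x t := by
  obtain ⟨Mf, hMf⟩ := hf.bounded
  exact hJ.comparison hT huc hδ hf₀ (M := max M Mf) (fun x => (hM x).trans (le_max_left _ _))
    hf.sub hg.super (fun x t ht => (hMf x t ht).trans (le_max_right _ _))
    (fun x => (hf.initial x).le) (fun x => (hg.initial x).ge)

/-- Perron's method in the class S. The flow c itself gives a member of S, comparison with the
linear cap bounds S, and the initial moduli keep the envelope in the class. -/
theorem AdmissibleOperator.exists_solution (hJ : AdmissibleOperator γ J) (hT : 0 < T) {δ M : ℝ}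
    (hδ : 0 < δ) {f₀ : Space d → ℝ} (huc : UniformContinuous f₀) (hM : ∀ x, f₀ x ≤ M)
    (hf₀ : ∀ x, δ ≤ f₀ x) (hflow : ConstantFlowStaysPositive J T δ) :
    ∃ f : Space d → ℝ → ℝ, IsCauchySolution γ J T f₀ f := by
  obtain ⟨c, c', hc0, hc⟩ := hflow
  have hcc : ContinuousOn c (Set.Icc 0 T) := fun t ht => (hc t ht).2.1.continuousWithinAt
  have hne : (Set.Icc 0 T).Nonempty := ⟨0, le_rfl, hT.le⟩
  obtain ⟨tm, htm, hmin⟩ := isCompact_Icc.exists_isMinOn hne hcc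
  obtain ⟨tM, htM, hmax⟩ := isCompact_Icc.exists_isMaxOn hne hcc
  set m := c tm with hm
  have hm0 : 0 < m := (hc tm htm).1
  have hcm : ∀ t ∈ Set.Icc 0 T, m ≤ c t := fun t ht => hmin ht
  have hcM : ∀ t ∈ Set.Icc 0 T, c t ≤ c tM := fun t ht => hmax ht
  have hbarrier : ∀ {Aψ : ℝ} {ψ : Space d → ℝ}, C1H 1 Aψ ψ → (∀ x, 0 ≤ ψ x) → _ := fun hψ hψ0 =>
    hJ.exists_subsolution_barrier hm0 hcm hcM (fun t ht => (hc t ht).2) hψ hψ0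
  have hM0 : 0 < M := hδ.trans_le ((hf₀ 0).trans (hM 0))
  set S : Set (Space d → ℝ → ℝ) := {w | IsViscositySubsolution γ J T w ∧
    (∃ M', ∀ x, ∀ t ∈ Set.Icc 0 T, w x t ≤ M') ∧ ∀ x, w x 0 ≤ f₀ x} with hS
  set M₁ := M + |J (fun _ => M) 0| * T with hM₁
  have hMM₁ : M ≤ M₁ := by
    have : 0 ≤ |J (fun _ => M) 0| * T := by positivity
    linarith
  have hcap : ∀ w ∈ S, ∀ x, ∀ t ∈ Set.Icc 0 T, w x t ≤ M₁ := by
    rintro w ⟨hw, ⟨M', hM'⟩, hw0⟩ x t ht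
    have h1 := hJ.comparison hT huc hδ hf₀ (M := max M M') (fun x => (hM x).trans (le_max_left _ _))
      hw (hJ.supersolution_cap hM0) (fun x t ht => (hM' x t ht).trans (le_max_right _ _)) hw0
      (fun x => by simpa using hM x) x t ht
    refine h1.trans ?_
    have := mul_le_mul_of_nonneg_left ht.2 (abs_nonneg (J (fun _ => M) 0))
    linarith
  obtain ⟨w₀, hw₀, hw₀0, hw₀c, hw₀M, -⟩ := hbarrier (C1H.const 0) fun _ => le_rfl
  have hw₀S : w₀ ∈ S := ⟨hw₀, ⟨_, hw₀M⟩, fun x => by linarith [hw₀0 x, hf₀ x]⟩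
  set u : Space d → ℝ → ℝ := fun x t => sSup ((fun w => w x t) '' S) with hu
  have hbdd : ∀ x, ∀ t ∈ Set.Icc 0 T, BddAbove ((fun w : Space d → ℝ → ℝ => w x t) '' S) :=
    fun x t ht => ⟨M₁, by rintro _ ⟨w, hw, rfl⟩; exact hcap w hw x t ht⟩
  have hSne : ∀ x t, ((fun w : Space d → ℝ → ℝ => w x t) '' S).Nonempty := fun x t =>
    ⟨_, w₀, hw₀S, rfl⟩
  have hwu : ∀ w ∈ S, ∀ x, ∀ t ∈ Set.Icc 0 T, w x t ≤ u x t := fun w hw x t ht =>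
    le_csSup (hbdd x t ht) ⟨w, hw, rfl⟩
  have huM : ∀ x, ∀ t ∈ Set.Icc 0 T, u x t ≤ M₁ := fun x t ht =>
    csSup_le (hSne x t) (by rintro _ ⟨w, hw, rfl⟩; exact hcap w hw x t ht)
  have huη : ∀ x, ∀ t ∈ Set.Icc 0 T, m ≤ u x t := fun x t ht =>
    (hcm t ht).trans ((hw₀c x t ht).trans (hwu w₀ hw₀S x t ht))
  set E : Set (Space d × ℝ) := Set.univ ×ˢ Set.Icc 0 T with hE
  have hm1 : ∀ q ∈ E, m ≤ u q.1 q.2 := fun q hq => huη q.1 q.2 hq.2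
  have hM1 : ∀ q ∈ E, u q.1 q.2 ≤ M₁ := fun q hq => huM q.1 q.2 hq.2
  set U : Space d → ℝ → ℝ := fun x t => uscEnvelope E (fun q : Space d × ℝ => u q.1 q.2) (x, t)
    with hU
  have hUsub : IsViscositySubsolution γ J T U := hJ.subsolution_envelope (fun w hw => hw.1) hwu
    (fun x t ht b hb => by
      obtain ⟨_, ⟨w, hw, rfl⟩, h⟩ := exists_lt_of_lt_csSup (hSne x t) hb
      exact ⟨w, hw, h⟩) hm0 huη huM
  have huU : ∀ x, ∀ t ∈ Set.Icc 0 T, u x t ≤ U x t := fun x t ht =>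
    le_uscEnvelope (f := fun q : Space d × ℝ => u q.1 q.2) hM1 (x := (x, t)) ⟨Set.mem_univ _, ht⟩
  have hUM : ∀ x, ∀ t ∈ Set.Icc 0 T, U x t ≤ M₁ := fun x t ht =>
    uscEnvelope_le_of_le hm1 hM1 (x := (x, t)) ⟨Set.mem_univ _, ht⟩
  have h0T : (0 : ℝ) ∈ Set.Icc 0 T := ⟨le_rfl, hT.le⟩
  -- Passing to the envelope involves nearby points at positive times; the initial modulus is
  -- uniform over S, so no initial value is lost.
  have hU0 : ∀ x, U x 0 ≤ f₀ x := fun x => by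
    refine le_of_forall_pos_le_add fun ε hε => ?_
    obtain ⟨ρ, hρ, τ, hτ, h⟩ := hJ.sub_initial_modulus (T := T) huc hδ hf₀
      (fun x => (hM x).trans hMM₁) hε
    refine uscEnvelope_le hm1 (x := (x, 0)) ⟨Set.mem_univ _, h0T⟩ ?_
    have h1 : ∀ᶠ q : Space d × ℝ in 𝓝 (x, 0), dist q.1 x < ρ ∧ q.2 < τ :=
      ((continuous_fst.tendsto (x, (0 : ℝ))).eventually (Metric.ball_mem_nhds x hρ)).and
        ((continuous_snd.tendsto (x, (0 : ℝ))).eventually (gt_mem_nhds hτ))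
    filter_upwards [nhdsWithin_le_nhds h1, self_mem_nhdsWithin] with q hq hqE
    refine csSup_le (hSne q.1 q.2) ?_
    rintro _ ⟨w, hw, rfl⟩
    exact h w hw.1 (hcap w hw) hw.2.2 x q.1 q.2 hq.1.le hqE.2 hq.2.le
  have hUη : ∀ x, ∀ t ∈ Set.Icc 0 T, m ≤ U x t := fun x t ht => (huη x t ht).trans (huU x t ht)
  have hVsup := hJ.supersolution_envelope hUsub hm0 hUη hUM hU0
    (fun w hw hwM hw0 x t ht => (hwu w ⟨hw, hwM, hw0⟩ x t ht).trans (huU x t ht))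
  have hm2 : ∀ q ∈ E, -M₁ ≤ -U q.1 q.2 := fun q hq => neg_le_neg (hUM q.1 q.2 hq.2)
  have hM2 : ∀ q ∈ E, -U q.1 q.2 ≤ -m := fun q hq => neg_le_neg (hUη q.1 q.2 hq.2)
  set V : Space d → ℝ → ℝ := fun x t =>
    -uscEnvelope E (fun q : Space d × ℝ => -U q.1 q.2) (x, t) with hV
  have hVU : ∀ x, ∀ t ∈ Set.Icc 0 T, V x t ≤ U x t := fun x t ht =>
    neg_le.1 (le_uscEnvelope (f := fun q : Space d × ℝ => -U q.1 q.2) hM2 (x := (x, t))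
      ⟨Set.mem_univ _, ht⟩)
  have hV0 : ∀ x, f₀ x ≤ V x 0 := fun x₀ => by
    refine le_of_forall_pos_le_add fun ε hε => ?_
    obtain ⟨ρ, hρ, h0⟩ := Metric.uniformContinuous_iff.1 huc (ε / 2) (half_pos hε)
    obtain ⟨A, χ, hχ, hχ0, hχ1, hin, hout⟩ := exists_cutoff_radius d hρ
    -- The height lifts c(0) to f₀ x₀ - ε/2 at x₀. Uniform continuity keeps the bump below f₀ near
    -- x₀, and c(0) ≤ δ ≤ f₀ does so elsewhere.
    set b := max (f₀ x₀ - ε / 2 - c 0) 0 with hb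
    have hb0 : 0 ≤ b := le_max_right _ _
    obtain ⟨w, hw, hw0, hwc, hwM, hwcont⟩ := hbarrier ((hχ.comp_add (-x₀)).const_mul b)
      fun x => mul_nonneg hb0 (hχ0 _)
    have hwS : w ∈ S := by
      refine ⟨hw, ⟨_, hwM⟩, fun x => ?_⟩
      rw [hw0]
      rcases lt_or_ge (dist x x₀) ρ with hx | hx
      · have h1 := h0 hx
        rw [Real.dist_eq] at h1
        have h2 : b ≤ f₀ x - c 0 :=
          max_le (by linarith [neg_abs_le (f₀ x - f₀ x₀)]) (by linarith [hf₀ x])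
        have h3 := mul_le_mul_of_nonneg_left (hχ1 (x + -x₀)) hb0
        linarith
      · rw [hout (x + -x₀) (by rwa [← sub_eq_add_neg, ← dist_eq_norm]), mul_zero]
        linarith [hf₀ x]
    have hwx₀ : f₀ x₀ - ε / 2 ≤ w x₀ 0 := by
      rw [hw0, add_neg_cancel, hin 0 (by rw [norm_zero]; positivity), mul_one]
      linarith [le_max_left (f₀ x₀ - ε / 2 - c 0) 0]
    have hmem : (x₀, (0 : ℝ)) ∈ E := ⟨Set.mem_univ _, h0T⟩
    have h1 : uscEnvelope E (fun q : Space d × ℝ => -U q.1 q.2) (x₀, 0) ≤ -(f₀ x₀ - ε) := by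
      refine uscEnvelope_le hm2 hmem ?_
      filter_upwards [(hwcont (x₀, 0) hmem).eventually
        (lt_mem_nhds (show f₀ x₀ - ε < w x₀ 0 by linarith)), self_mem_nhdsWithin] with q hq hqE
      have := (hwu w hwS q.1 q.2 hqE.2).trans (huU q.1 q.2 hqE.2)
      linarith
    simp only [hV]
    linarith
  have hUV := hJ.comparison hT huc hδ hf₀ (fun x => (hM x).trans hMM₁) hUsub hVsup hUM hU0 hV0
  refine ⟨U, hUsub, hVsup.congr fun x t ht => le_antisymm (hVU x t ht) (hUV x t ht), fun x => ?_,
    M₁, hUM⟩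
  exact le_antisymm (hU0 x) ((hV0 x).trans (hVU x 0 h0T))

end

end FractionalParabolic

end
theorem theorem8p8 {d : ℕ} (γ : NNReal)
    (J : (FractionalParabolic.Space d → ℝ) → FractionalParabolic.Space d → ℝ)
    (hJ : FractionalParabolic.AdmissibleOperator γ J)
    (T : ℝ) (hT : 0 < T) (δ : ℝ) (hδ : 0 < δ)
    (f₀ : FractionalParabolic.Space d → ℝ) (hf₀_uc : UniformContinuous f₀)
    (hf₀_bdd : ∃ M : ℝ, ∀ x, f₀ x ≤ M) (hf₀_pos : ∀ x, δ ≤ f₀ x) :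
    (∀ f g : FractionalParabolic.Space d → ℝ → ℝ,
      FractionalParabolic.IsCauchySolution γ J T f₀ f →
      FractionalParabolic.IsCauchySolution γ J T f₀ g →
      ∀ x, ∀ t ∈ Set.Icc 0 T, f x t = g x t) ∧
    (FractionalParabolic.ConstantFlowStaysPositive J T δ →
      ∃ f : FractionalParabolic.Space d → ℝ → ℝ,
        FractionalParabolic.IsCauchySolution γ J T f₀ f) := by
  obtain ⟨M, hM⟩ := hf₀_bdd
  refine ⟨fun f g hf hg x t ht => le_antisymm ?_ ?_, fun hflow =>
    hJ.exists_solution hT hδ hf₀_uc hM hf₀_pos hflow⟩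
  · exact hJ.unique hT hδ hf₀_uc hM hf₀_pos hf hg x t ht
  · exact hJ.unique hT hδ hf₀_uc hM hf₀_pos hg hf x t ht
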